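/- Fix a dimension $d\ge 1$, a smoothness $\beta\in(0,1]$ and constants $L,\underline c,\bar c,D_0>0$, $\delta_0\in(0,1)$ with $\bar c>2^d$ and $D_0L^{d/\beta}\ge 2^d$. **Environments.** An environment $P$ is a law of $(X,Y^{(1)},Y^{(-1)})$ with $X\in[0,1]^d$, $X\sim P_X$, rewards $Y^{(k)}\in[0,1]$, and $\mathbb E[Y^{(k)}\mid X]=f^{(k)}(X)$ for $k\in\{1,-1\}$. For $\alpha\in\mathcal K:=[0,d/\beta]\cup\{\infty\}$ let $\mathcal P_\alpha$ be the class of all environments such that * $\underline c\,r^d\le P_X(B(x,r))\le \bar c\,r^d$ for all $x\in\operatorname{supp}(P_X)$ and $r\in(0,1]$, where $B(x,r)$ is the $\ell_\infty$ ball; * $|f^{(k)}(x)-f^{(k)}(x')|\le L\|x-x'\|_2^\beta$ for all $x,x'\in[0,1]^d$ and $k\in\{1,-1\}$; * $P_X\big(0<|f^{(1)}(X)-f^{(-1)}(X)|\le\delta\big)\le D_0\,\delta^\alpha$ for all $\delta\in[0,\delta_0]$ (with $\delta^\infty:=0$). **Policies.** For $1\le M\le T$, the rounds $(X_t,Y_t^{(1)},Y_t^{(-1)})$,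 $t=1,\dots,T$, are i.i.d. from $P$. An $M$-batch policy $(\Gamma,\pi)$ consists of a grid $0=t_0<t_1<\dots<t_M=T$ and of decision rules $\pi_1,\dots,\pi_T$. The grid may be adaptive: $t_i$ is a measurable function of the contexts and observed rewards of the rounds up to $t_{i-1}$. In a round $t$ with $t_{i-1}<t\le t_i$ the arm $\pi_t(X_t)$ is a measurable function of the contexts $X_1,\dots,X_t$ and of the rewards $Y_\ell^{(\pi_\ell(X_\ell))}$, $\ell\le t_{i-1}$, of the previous batches. Put $$R_T(\Gamma,\pi;P)=\mathbb E_P\Big[\sum_{t=1}^T\Big(\max_k f^{(k)}(X_t)-f^{(\pi_t(X_t))}(X_t)\Big)\Big],\qquad R_T^\star(\alpha)=\inf_{(\Gamma,\pi)}\sup_{P\in\mathcal P_\alpha}R_T(\Gamma,\pi;P),$$ $$\mathrm{RI}(\Gamma,\pi)=\sup_{\alpha\in\mathcal K}\ \sup_{P\in\mathcal P_\alpha}\frac{R_T(\Gamma,\pi;P)}{R_T^\star(\alpha)},$$ where all infima over policies are over $M$-batch policies with horizon $T$. **Statement.** There are constants $c_1,C>0$, which depend on $d,\beta,L,\underline c,\bar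 c,\delta_0,D_0$ but not on $T$ and $M$, such that for all integers $T\ge 3$ and $M\le T$ with $M\ge c_1\log\log T$, $$\inf_{(\Gamma,\pi)}\mathrm{RI}(\Gamma,\pi)\ \le\ C\,(\log\log T)^5\,\log T .$$ -/

import Mathlib

open scoped ENNReal

namespace BatchedBandit

/-- The two arms: `true` is arm `1`, `false` is arm `-1`. -/
abbrev Arm : Type := Bool

/-- Contexts. The metric of `Fin d → ℝ` is the `ℓ_∞` metric. -/
abbrev Ctx (d : ℕ) : Type := Fin d → ℝ

/-- One round: the context and the two potential rewards. -/
abbrev Outcome (d : ℕ) : Type := Ctx d × (Arm → ℝ)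

/-- All rounds of the horizon; the round with index `t : Fin T` is the `(t+1)`-st round. -/
abbrev Path (d T : ℕ) : Type := Fin T → Outcome d

/-- The context space `[0,1]^d`. -/
def cube (d : ℕ) : Set (Ctx d) := Set.Icc 0 1

/-! ### Environments -/

/-- An environment: the law of `(X, Y^(1), Y^(-1))` with contexts in `[0,1]^d`, rewards in `[0,1]`,
together with the mean reward functions `f k x = E[Y^(k) | X = x]`. -/
structure Environment (d : ℕ) where
  law : MeasureTheory.Measure (Outcome d)
  isProb : MeasureTheory.IsProbabilityMeasure law
  f : Arm → Ctx d → ℝ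
  ctx_mem : ∀ᵐ z ∂law, z.1 ∈ cube d
  reward_mem : ∀ᵐ z ∂law, ∀ k, z.2 k ∈ Set.Icc (0 : ℝ) 1
  condMean : ∀ k,
    MeasureTheory.condExp (MeasurableSpace.comap Prod.fst inferInstance) law (fun z => z.2 k)
      =ᵐ[law] fun z => f k z.1

/-- The context distribution `P_X`. -/
noncomputable def Environment.ctxLaw {d : ℕ} (E : Environment d) :
    MeasureTheory.Measure (Ctx d) :=
  E.law.map Prod.fst

/-- The constants which define a class of environments: dimension `d`, smoothness `β`, `L`,
density bounds `cLow`, `cUp`, margin constants `δ₀`, `D₀`. -/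
structure ClassConstants where
  d : ℕ
  β : ℝ
  L : ℝ
  cLow : ℝ
  cUp : ℝ
  δ₀ : ℝ
  D₀ : ℝ

/-- Bounded density. -/
def BoundedDensity (c : ClassConstants) (E : Environment c.d) : Prop :=
  ∀ x ∈ E.ctxLaw.support, ∀ r : ℝ, 0 < r → r ≤ 1 →
    c.cLow * r ^ c.d ≤ E.ctxLaw.real (Metric.closedBall x r) ∧
      E.ctxLaw.real (Metric.closedBall x r) ≤ c.cUp * r ^ c.d

/-- `(β, L)`-Hölder smoothness on `[0,1]^d` with respect to the Euclidean norm. -/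
def HolderSmooth (c : ClassConstants) (E : Environment c.d) : Prop :=
  ∀ k : Arm, ∀ x ∈ cube c.d, ∀ y ∈ cube c.d,
    |E.f k x - E.f k y| ≤ c.L * ‖WithLp.toLp 2 (x - y)‖ ^ c.β

/-- The function `δ ↦ δ ^ α` for `0 ≤ δ < 1` and `α ∈ [0, ∞]`, where `δ ^ ∞ = 0`. -/
noncomputable def marginPow (δ : ℝ) (α : ℝ≥0∞) : ℝ :=
  if α = ∞ then 0 else δ ^ α.toReal

/-- The margin condition with parameter `α ∈ [0, ∞]`. -/
def Margin (c : ClassConstants) (α : ℝ≥0∞) (E : Environment c.d) : Prop :=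
  ∀ δ : ℝ, 0 ≤ δ → δ ≤ c.δ₀ →
    E.ctxLaw.real {x | 0 < |E.f true x - E.f false x| ∧ |E.f true x - E.f false x| ≤ δ}
      ≤ c.D₀ * marginPow δ α

/-- The class of environments with margin parameter `α`. -/
def envClass (c : ClassConstants) (α : ℝ≥0∞) : Set (Environment c.d) :=
  {E | BoundedDensity c E ∧ HolderSmooth c E ∧ Margin c α E}

/-- The possible margin parameters `[0, d/β] ∪ {∞}`. -/
def marginParams (c : ClassConstants) : Set ℝ≥0∞ :=
  {α | α ≤ ENNReal.ofReal (c.d / c.β) ∨ α = ∞}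

/-! ### Batch policies -/

/-- What a learner may know: the number of revealed rewards, the revealed contexts and the revealed
rewards of the pulled arms (entries which are not revealed are set to `0`). -/
abbrev Info (d T : ℕ) : Type := ℕ × (Fin T → Ctx d) × (Fin T → ℝ)

/-- The information which consists of the first `n` contexts and the first `s` rewards, if `a` is the
sequence of pulled arms. -/
def info {d T : ℕ} (ω : Path d T) (a : Fin T → Arm) (n s : ℕ) : Info d T :=
  (s, fun l => if (l : ℕ) < n then (ω l).1 else 0,
    fun l => if (l : ℕ) < s then (ω l).2 (a l) else 0)

/-- An `M`-batch policy with horizon `T`. On the path `ω`, the grid is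
`0 = grid 0 ω < grid 1 ω < ⋯ < grid M ω = T`, and `arm t ω` is the arm pulled in round `t`.
The end of the next batch is a measurable function of the contexts and rewards up to the end of the
current batch. The arm is a measurable function of the contexts up to the current round
and of the rewards of the previous batches. -/
structure BatchPolicy (d T M : ℕ) where
  grid : ℕ → Path d T → ℕ
  arm : Fin T → Path d T → Arm
  gridRule : ℕ → Info d T → ℕ
  armRule : Fin T → Info d T → Arm
  measurable_gridRule : ∀ i, Measurable (gridRule i)
  measurable_armRule : ∀ t, Measurable (armRule t)
  grid_zero : ∀ ω, grid 0 ω = 0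
  grid_lt : ∀ i < M, ∀ ω, grid i ω < grid (i + 1) ω
  grid_last : ∀ ω, grid M ω = T
  grid_eq : ∀ i < M, ∀ ω,
    grid (i + 1) ω = gridRule i (info ω (fun l => arm l ω) (grid i ω) (grid i ω))
  arm_eq : ∀ (t : Fin T) (ω : Path d T), ∀ i < M, grid i ω ≤ t → (t : ℕ) < grid (i + 1) ω →
    arm t ω = armRule t (info ω (fun l => arm l ω) (t + 1) (grid i ω))

/-! ### Regret and regret inflation -/

/-- The expected cumulative regret, for i.i.d. rounds. The summands are nonnegative. -/
noncomputable def regret {d T M : ℕ} (π : BatchPolicy d T M) (E : Environment d) : ℝ≥0∞ :=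
  ∫⁻ ω, ∑ t : Fin T,
    ENNReal.ofReal (max (E.f true (ω t).1) (E.f false (ω t).1) - E.f (π.arm t ω) (ω t).1)
    ∂(MeasureTheory.Measure.pi fun _ : Fin T => E.law)

/-- The minimax regret of `M`-batch policies which know the margin parameter `α`. -/
noncomputable def oracleRegret (c : ClassConstants) (T M : ℕ) (α : ℝ≥0∞) : ℝ≥0∞ :=
  ⨅ π : BatchPolicy c.d T M, ⨆ E ∈ envClass c α, regret π E

/-- The regret inflation of a policy. -/
noncomputable def regretInflation (c : ClassConstants) {T M : ℕ} (π : BatchPolicy c.d T M) :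
    ℝ≥0∞ :=
  ⨆ α ∈ marginParams c, ⨆ E ∈ envClass c α, regret π E / oracleRegret c T M α

end BatchedBandit

/-!
The theorem compares one policy, which does not know the margin parameter `α`, with lower bounds for
the minimax regret of policies which know it. With `γ α = β (1 + α) / (2 β + d)` (`rateExp`), the
policy has regret `O(log log T · log T · T ^ (1 - γ α))` for all `α ≤ d / β` and `O(log T)` for
`α = ∞` (`exists_adaptive_policy`), while every policy has minimax regret at least of order
`T ^ (1 - γ α)`, respectively of order `1` (`exists_le_oracleRegret`). The quotient is
`O(log log T · log T)`, and the fifth power of `log log T` in the theorem leaves room to spare.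

*Upper bound.* The policy is successive elimination on a deterministic grid. At the end of a batch
of size `n`, the cube is divided into cells of side `w = (const · log T / n) ^ (1 / (2 β + d))`; a
cell inherits a decision made nearby at a coarser scale, and otherwise compares the signed sum of
the rewards of the last batch in a neighbourhood of the cell with a threshold. While no decision has
been made near the cell, the arms pulled there alternate deterministically, hence the statistic is a
sum over independent rounds (`Schedule.stat_eq_sum_testVar`) and concentrates by a Bernstein bound
(`measure_compl_goodEvent_le`). On the good event a chosen arm is optimal, and on undecided cells
the gap is `O(w ^ β)` (`state_correct`); the margin condition bounds the mass of the contexts with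
such gaps, which gives the regret `O(w ^ (β (1 + α)))` of a round. The policy does not depend on
`α`, since one grid serves all rates: the exponents satisfy `γ α ≤ g := (β + d) / (2 β + d) < 1`,
and if the batch end points satisfy `τ (b + 1) ≲ (T log T) ^ (1 - g) * τ b ^ g`, then each batch has
regret `O(log T · T ^ (1 - γ α))` for all these exponents (`mul_roundBound_le`). As `g < 1`, such a
grid reaches `T` after `O(log log T)` batches (`exists_base_grid`).

*Lower bound.* The contexts have independent coordinates, uniform on an interval with periodic
holes. The holes separate small bumps from the rest of the support, so that a gap which is `± h` on
some bumps and `0` elsewhere on the support has a Hölder continuous extension to the cube, and the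
margin condition only concerns the mass of the bumps. Short holes in an interval of length slightly
below `1` respect all density bounds with `cLow ≤ 1` and `2 ^ d < cUp`
(`volume_holedInterval_inter_ball_ge`, `holedLaw_density`); for `cLow > 1` the classes are empty.
If the scale is such that `T` rounds do not reveal the sign on a bump, then averaging over all signs
yields an environment in which the policy errs on a constant fraction of the bumps
(`two_point_bound`, `exists_regret_ge`). This argument reveals all rewards of the past and does not
use the batches. The bound of order `1` comes from the first round, in which no reward is known
(`le_oracleRegret_of_first_round`).

For bounded horizons any policy will do, since its regret is at most `T`.
-/


namespace BatchedBandit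

open MeasureTheory ProbabilityTheory Set

/-! ### Basic facts on environments -/

instance {d : ℕ} (E : Environment d) : IsProbabilityMeasure E.law := E.isProb

instance {d : ℕ} (E : Environment d) : IsProbabilityMeasure E.ctxLaw :=
  Measure.isProbabilityMeasure_map measurable_fst.aemeasurable

/-- The gap `f^(1) - f^(-1)` of the mean rewards. -/
def Environment.gap {d : ℕ} (E : Environment d) (x : Ctx d) : ℝ := E.f true x - E.f false x

lemma measurableSet_cube (d : ℕ) : MeasurableSet (cube d) := isClosed_Icc.measurableSet

lemma Environment.ctxLaw_ae {d : ℕ} (E : Environment d) {p : Ctx d → Prop}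
    (h : ∀ᵐ x ∂E.ctxLaw, p x) : ∀ᵐ z ∂E.law, p z.1 :=
  ae_of_ae_map measurable_fst.aemeasurable h

lemma Environment.ctxLaw_cube {d : ℕ} (E : Environment d) : ∀ᵐ x ∂E.ctxLaw, x ∈ cube d :=
  (ae_map_iff measurable_fst.aemeasurable (measurableSet_cube d)).2 E.ctx_mem

lemma Environment.reward_integrable {d : ℕ} (E : Environment d) (k : Arm) :
    Integrable (fun z : Outcome d => z.2 k) E.law := by
  refine Integrable.of_bound (C := 1)
    ((measurable_pi_apply k).comp measurable_snd).aestronglyMeasurable ?_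
  filter_upwards [E.reward_mem] with z hz
  rw [Real.norm_eq_abs, abs_le]
  constructor <;> linarith [(hz k).1, (hz k).2]

lemma Environment.f_mem {d : ℕ} (E : Environment d) :
    ∀ᵐ z ∂E.law, ∀ k, E.f k z.1 ∈ Icc (0 : ℝ) 1 := by
  rw [ae_all_iff]
  intro k
  have hm : MeasurableSpace.comap (Prod.fst : Outcome d → Ctx d) inferInstance ≤
      (inferInstance : MeasurableSpace (Outcome d)) := measurable_fst.comap_le
  have h0 : (fun _ => (0 : ℝ)) ≤ᵐ[E.law] condExp
      (MeasurableSpace.comap Prod.fst inferInstance) E.law (fun z => z.2 k) := by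
    have := condExp_mono (m := MeasurableSpace.comap (Prod.fst : Outcome d → Ctx d) inferInstance)
      (μ := E.law) (integrable_const (0 : ℝ)) (E.reward_integrable k)
      (by filter_upwards [E.reward_mem] with z hz using (hz k).1)
    rwa [condExp_const hm] at this
  have h1 : condExp (MeasurableSpace.comap Prod.fst inferInstance) E.law (fun z => z.2 k)
      ≤ᵐ[E.law] (fun _ => (1 : ℝ)) := by
    have := condExp_mono (m := MeasurableSpace.comap (Prod.fst : Outcome d → Ctx d) inferInstance)
      (μ := E.law) (E.reward_integrable k) (integrable_const (1 : ℝ))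
      (by filter_upwards [E.reward_mem] with z hz using (hz k).2)
    rwa [condExp_const hm] at this
  filter_upwards [h0, h1, E.condMean k] with z a b e
  rw [e] at a b
  exact ⟨a, b⟩

lemma Environment.f_integrable {d : ℕ} (E : Environment d) (k : Arm) :
    Integrable (fun z : Outcome d => E.f k z.1) E.law :=
  integrable_condExp.congr (E.condMean k)

lemma Environment.setIntegral_reward {d : ℕ} (E : Environment d) (k : Arm) {R : Set (Ctx d)}
    (hR : MeasurableSet R) :
    ∫ z in Prod.fst ⁻¹' R, z.2 k ∂E.law = ∫ z in Prod.fst ⁻¹' R, E.f k z.1 ∂E.law := by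
  have hm : MeasurableSpace.comap (Prod.fst : Outcome d → Ctx d) inferInstance ≤
      (inferInstance : MeasurableSpace (Outcome d)) := measurable_fst.comap_le
  rw [← setIntegral_condExp hm (E.reward_integrable k) ⟨R, hR, rfl⟩]
  exact setIntegral_congr_ae (measurable_fst hR)
    ((E.condMean k).mono fun z hz _ => hz)

lemma Environment.ctxLaw_real_apply {d : ℕ} (E : Environment d) {R : Set (Ctx d)}
    (hR : MeasurableSet R) : E.ctxLaw.real R = E.law.real (Prod.fst ⁻¹' R) :=
  map_measureReal_apply measurable_fst hR

/-- A ball around an arbitrary point either misses the support or lies in the ball of twice the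
radius around a point of the support. -/
lemma BoundedDensity.closedBall_le {c : ClassConstants} {E : Environment c.d}
    (h : BoundedDensity c E) (hc : 0 ≤ c.cUp) (z : Ctx c.d) {r : ℝ} (hr : 0 < r)
    (hr' : 2 * r ≤ 1) :
    E.ctxLaw.real (Metric.closedBall z r) ≤ c.cUp * (2 * r) ^ c.d := by
  by_cases hz : (Metric.closedBall z r ∩ E.ctxLaw.support).Nonempty
  · obtain ⟨x, hx, hxs⟩ := hz
    refine (measureReal_mono ?_).trans (h x hxs (2 * r) (by positivity) hr').2
    apply Metric.closedBall_subset_closedBall'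
    rw [dist_comm]
    linarith [Metric.mem_closedBall.1 hx]
  · have : E.ctxLaw (Metric.closedBall z r) = 0 := by
      by_contra h0
      exact hz (Measure.nonempty_inter_support_of_pos (pos_iff_ne_zero.2 h0))
    rw [measureReal_def, this]
    simp only [ENNReal.toReal_zero]
    positivity

lemma norm_toLp_two_le {d : ℕ} (x : Ctx d) : ‖WithLp.toLp 2 x‖ ≤ d * ‖x‖ := by
  rw [EuclideanSpace.norm_eq]
  rcases Nat.eq_zero_or_pos d with rfl | hd
  · simp
  refine Real.sqrt_le_iff.2 ⟨by positivity, ?_⟩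
  have h1 : ∀ i : Fin d, ‖(WithLp.toLp 2 x : EuclideanSpace ℝ (Fin d)) i‖ ^ 2 ≤ ‖x‖ ^ 2 := by
    intro i
    exact pow_le_pow_left₀ (norm_nonneg _) (norm_le_pi_norm x i) 2
  refine (Finset.sum_le_sum fun i _ => h1 i).trans ?_
  rw [Finset.sum_const, Finset.card_univ, Fintype.card_fin, nsmul_eq_mul, mul_pow]
  refine mul_le_mul_of_nonneg_right ?_ (by positivity)
  have : (1 : ℝ) ≤ d := by exact_mod_cast hd
  nlinarith

lemma norm_le_norm_toLp_two {d : ℕ} (x : Ctx d) : ‖x‖ ≤ ‖WithLp.toLp 2 x‖ := by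
  rw [pi_norm_le_iff_of_nonneg (norm_nonneg _)]
  intro i
  exact PiLp.norm_apply_le (WithLp.toLp 2 x : EuclideanSpace ℝ (Fin d)) i

lemma HolderSmooth.abs_gap_sub_le {c : ClassConstants} {E : Environment c.d}
    (h : HolderSmooth c E) (hd : 1 ≤ c.d) (hβ : 0 < c.β) (hβ1 : c.β ≤ 1) (hL : 0 < c.L)
    {x y : Ctx c.d} (hx : x ∈ cube c.d) (hy : y ∈ cube c.d) {w : ℝ} (hw : 0 ≤ w)
    (hxy : ‖x - y‖ ≤ 3 * w) :
    |E.gap x - E.gap y| ≤ 6 * c.d * c.L * w ^ c.β := by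
  have hd' : (1 : ℝ) ≤ c.d := by exact_mod_cast hd
  have h2 : ‖WithLp.toLp 2 (x - y)‖ ^ c.β ≤ 3 * c.d * w ^ c.β := by
    calc ‖WithLp.toLp 2 (x - y)‖ ^ c.β ≤ ((3 * c.d) * w) ^ c.β := by
          refine Real.rpow_le_rpow (norm_nonneg _) ?_ hβ.le
          have h3 := norm_toLp_two_le (x - y)
          have h4 : (c.d : ℝ) * ‖x - y‖ ≤ c.d * (3 * w) := by gcongr
          nlinarith
      _ = (3 * c.d) ^ c.β * w ^ c.β := Real.mul_rpow (by positivity) hw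
      _ ≤ 3 * c.d * w ^ c.β := by
          refine mul_le_mul_of_nonneg_right ?_ (by positivity)
          calc (3 * (c.d : ℝ)) ^ c.β ≤ (3 * (c.d : ℝ)) ^ (1 : ℝ) :=
                Real.rpow_le_rpow_of_exponent_le (by linarith) hβ1
            _ = _ := Real.rpow_one _
  have e : E.gap x - E.gap y = (E.f true x - E.f true y) - (E.f false x - E.f false y) := by
    unfold Environment.gap; ring
  rw [e]
  refine (abs_sub _ _).trans ?_
  have := h true x hx y hy
  have := h false x hx y hy
  have : c.L * ‖WithLp.toLp 2 (x - y)‖ ^ c.β ≤ c.L * (3 * c.d * w ^ c.β) := by gcongr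
  linarith

lemma HolderSmooth.continuousOn_gap {c : ClassConstants} {E : Environment c.d}
    (h : HolderSmooth c E) (hd : 1 ≤ c.d) (hβ : 0 < c.β) (hβ1 : c.β ≤ 1) (hL : 0 < c.L) :
    ContinuousOn E.gap (cube c.d) := by
  intro x hx
  rw [ContinuousWithinAt, tendsto_iff_dist_tendsto_zero]
  have hlim : Filter.Tendsto (fun y : Ctx c.d => 6 * c.d * c.L * ‖y - x‖ ^ c.β)
      (nhdsWithin x (cube c.d)) (nhds 0) := by
    have : Continuous (fun y : Ctx c.d => 6 * c.d * c.L * ‖y - x‖ ^ c.β) := by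
      refine continuous_const.mul ?_
      exact (continuous_id.sub continuous_const).norm.rpow_const fun _ => Or.inr hβ.le
    have h2 := (this.tendsto x).mono_left (nhdsWithin_le_nhds (s := cube c.d))
    simpa [Real.zero_rpow hβ.ne'] using h2
  refine squeeze_zero' (Filter.Eventually.of_forall fun _ => dist_nonneg) ?_ hlim
  filter_upwards [self_mem_nhdsWithin] with y hy
  rw [Real.dist_eq]
  exact h.abs_gap_sub_le hd hβ hβ1 hL hy hx (norm_nonneg _) (by linarith [norm_nonneg (y - x)])

/-! ### A Bernstein bound for sums over independent rounds -/

/-- The moment generating function in terms of a variance proxy: it follows from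
`exp u ≤ 1 + u + u ^ 2` for `|u| ≤ 1`. -/
lemma mgf_le_exp_of_abs_le_one {Ω : Type*} [MeasurableSpace Ω] {μ : Measure Ω}
    [IsProbabilityMeasure μ] {Z : Ω → ℝ} (hZ : Measurable Z) (hb : ∀ᵐ z ∂μ, |Z z| ≤ 1) {v l : ℝ}
    (hv : ∫ z, Z z ^ 2 ∂μ ≤ v) (hl : |l| ≤ 1) :
    mgf Z μ l ≤ Real.exp (l * ∫ z, Z z ∂μ + l ^ 2 * v) := by
  have hi : Integrable Z μ := Integrable.of_bound (C := 1) hZ.aestronglyMeasurable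
    (by simpa [Real.norm_eq_abs] using hb)
  have hi2 : Integrable (fun z => Z z ^ 2) μ :=
    Integrable.of_bound (C := 1) (hZ.pow_const 2).aestronglyMeasurable (by
      filter_upwards [hb] with z hz
      rw [Real.norm_eq_abs, abs_pow]
      exact pow_le_one₀ (abs_nonneg _) hz)
  have h1 : mgf Z μ l ≤ ∫ z, (1 + l * Z z + l ^ 2 * Z z ^ 2) ∂μ := by
    refine integral_mono_of_nonneg (Filter.Eventually.of_forall fun z => (Real.exp_pos _).le)
      (((integrable_const 1).add (hi.const_mul l)).add (hi2.const_mul (l ^ 2))) ?_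
    filter_upwards [hb] with z hz
    have hu : |l * Z z| ≤ 1 := by
      rw [abs_mul]; exact mul_le_one₀ hl (abs_nonneg _) hz
    have := (abs_le.1 (Real.abs_exp_sub_one_sub_id_le hu)).2
    show Real.exp (l * Z z) ≤ 1 + l * Z z + l ^ 2 * Z z ^ 2
    nlinarith [this]
  refine h1.trans ?_
  have h2 : ∫ z, (1 + l * Z z + l ^ 2 * Z z ^ 2) ∂μ
      = 1 + l * ∫ z, Z z ∂μ + l ^ 2 * ∫ z, Z z ^ 2 ∂μ := by
    have ha : Integrable (fun z => 1 + l * Z z) μ := (integrable_const 1).add (hi.const_mul l)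
    have hb : Integrable (fun z => l ^ 2 * Z z ^ 2) μ := hi2.const_mul _
    rw [integral_add ha hb, integral_add (integrable_const 1) (hi.const_mul l),
      integral_const_mul, integral_const_mul]
    simp
  rw [h2]
  have h3 := Real.add_one_le_exp (l * ∫ z, Z z ∂μ + l ^ 2 * v)
  have h4 : l ^ 2 * ∫ z, Z z ^ 2 ∂μ ≤ l ^ 2 * v := by gcongr
  linarith

lemma mgf_eval_pi {ι Ω : Type*} [Fintype ι] [MeasurableSpace Ω] (μ : Measure Ω)
    [IsProbabilityMeasure μ] {Z : Ω → ℝ} (hZ : Measurable Z) (i : ι) (l : ℝ) :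
    mgf (fun ω : ι → Ω => Z (ω i)) (Measure.pi fun _ => μ) l = mgf Z μ l := by
  have h := measurePreserving_eval (fun _ : ι => μ) i
  have := mgf_map (μ := Measure.pi fun _ : ι => μ) (Y := Function.eval i) (X := Z)
    h.measurable.aemeasurable (t := l) (by
      rw [h.map_eq]
      exact ((hZ.const_mul l).exp).aestronglyMeasurable)
  rw [h.map_eq] at this
  rw [this]; rfl

/-- One-sided Chernoff bound for `l ≥ 0` (upper tail) and `l ≤ 0` (lower tail) together. -/
lemma chernoff_pi {ι Ω : Type*} [Fintype ι] [MeasurableSpace Ω] (μ : Measure Ω)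
    [IsProbabilityMeasure μ] (I : Finset ι) {Z : ι → Ω → ℝ} (hZ : ∀ i, Measurable (Z i))
    (hb : ∀ i, ∀ᵐ z ∂μ, |Z i z| ≤ 1) {v l s : ℝ}
    (hv : ∀ i, ∫ z, Z i z ^ 2 ∂μ ≤ v) (hl : |l| ≤ 1) :
    (Measure.pi fun _ : ι => μ).real
        {ω | s ≤ l * (∑ i ∈ I, Z i (ω i) - ∑ i ∈ I, ∫ z, Z i z ∂μ)}
      ≤ Real.exp (-s + I.card * (l ^ 2 * v)) := by
  set P := Measure.pi fun _ : ι => μ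
  have hind : iIndepFun (fun i (ω : ι → Ω) => Z i (ω i)) P :=
    iIndepFun_pi fun i => (hZ i).aemeasurable
  have hmeas : ∀ i, Measurable (fun ω : ι → Ω => Z i (ω i)) :=
    fun i => (hZ i).comp (measurable_pi_apply i)
  set S : (ι → Ω) → ℝ := fun ω => ∑ i ∈ I, Z i (ω i) with hS
  set e := ∑ i ∈ I, ∫ z, Z i z ∂μ with he
  have hbd : ∀ᵐ ω ∂P, ∀ i, |Z i (ω i)| ≤ 1 := by
    rw [ae_all_iff]
    intro i
    exact (measurePreserving_eval (fun _ : ι => μ) i).quasiMeasurePreserving.ae (hb i)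
  have hSm : Measurable S := by
    rw [hS]; exact Finset.measurable_sum _ fun i _ => hmeas i
  have hint : Integrable (fun ω => Real.exp (1 * (l * S ω))) P := by
    refine Integrable.of_bound (C := Real.exp (I.card)) (by fun_prop) ?_
    filter_upwards [hbd] with ω hω
    rw [Real.norm_eq_abs, abs_of_pos (Real.exp_pos _), one_mul]
    refine Real.exp_le_exp.2 ((le_abs_self _).trans ?_)
    rw [abs_mul]
    have : |S ω| ≤ I.card := by
      refine (Finset.abs_sum_le_sum_abs _ _).trans ?_
      refine (Finset.sum_le_sum fun i _ => hω i).trans ?_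
      simp
    calc |l| * |S ω| ≤ 1 * I.card := by gcongr
      _ = _ := one_mul _
  have h1 := measure_ge_le_exp_mul_mgf (μ := P) (X := fun ω => l * S ω) (t := 1) (s + l * e)
    zero_le_one hint
  have h2 : mgf (fun ω => l * S ω) P 1 = ∏ i ∈ I, mgf (Z i) μ l := by
    have h3 : mgf (fun ω => l * S ω) P 1 = mgf (∑ i ∈ I, fun ω : ι → Ω => Z i (ω i)) P l := by
      unfold mgf
      refine integral_congr_ae (Filter.Eventually.of_forall fun ω => ?_)
      simp [hS]
    rw [h3, hind.mgf_sum hmeas I]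
    exact Finset.prod_congr rfl fun i _ => mgf_eval_pi μ (hZ i) i l
  have h4 : ∏ i ∈ I, mgf (Z i) μ l ≤ Real.exp (l * e + I.card * (l ^ 2 * v)) := by
    refine (Finset.prod_le_prod (fun i _ => mgf_nonneg) fun i _ =>
      mgf_le_exp_of_abs_le_one (hZ i) (hb i) (hv i) hl).trans ?_
    rw [← Real.exp_sum, Finset.sum_add_distrib, ← Finset.mul_sum]
    simp [he]
  have hset : {ω | s ≤ l * (∑ i ∈ I, Z i (ω i) - e)} = {ω | s + l * e ≤ l * S ω} := by
    ext ω; simp only [mem_ofPred_eq, hS, mul_sub]; constructor <;> intro h <;> linarith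
  rw [hset]
  refine h1.trans ?_
  rw [h2]
  calc Real.exp (-1 * (s + l * e)) * ∏ i ∈ I, mgf (Z i) μ l
      ≤ Real.exp (-1 * (s + l * e)) * Real.exp (l * e + I.card * (l ^ 2 * v)) := by gcongr
    _ = _ := by rw [← Real.exp_add]; congr 1; ring

lemma bernstein_pi {ι Ω : Type*} [Fintype ι] [MeasurableSpace Ω] (μ : Measure Ω)
    [IsProbabilityMeasure μ] (I : Finset ι) {Z : ι → Ω → ℝ} (hZ : ∀ i, Measurable (Z i))
    (hb : ∀ i, ∀ᵐ z ∂μ, |Z i z| ≤ 1) {v l s : ℝ}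
    (hv : ∀ i, ∫ z, Z i z ^ 2 ∂μ ≤ v) (hl0 : 0 < l) (hl : l ≤ 1) :
    (Measure.pi fun _ : ι => μ).real
        {ω | s ≤ |∑ i ∈ I, Z i (ω i) - ∑ i ∈ I, ∫ z, Z i z ∂μ|}
      ≤ 2 * Real.exp (-(l * s) + I.card * (l ^ 2 * v)) := by
  have h1 := chernoff_pi μ I hZ hb (s := l * s) hv (l := l) (by rwa [abs_of_pos hl0])
  have h2 := chernoff_pi μ I hZ hb (s := l * s) hv (l := -l) (by rwa [abs_neg, abs_of_pos hl0])
  rw [neg_sq] at h2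
  refine (measureReal_mono (s₂ := {ω | l * s ≤ l * (∑ i ∈ I, Z i (ω i) - ∑ i ∈ I, ∫ z, Z i z ∂μ)} ∪
    {ω | l * s ≤ -l * (∑ i ∈ I, Z i (ω i) - ∑ i ∈ I, ∫ z, Z i z ∂μ)}) ?_).trans
    ((measureReal_union_le _ _).trans (by linarith))
  intro ω hω
  rcases le_abs.1 (mem_ofPred_eq ▸ hω) with h | h
  · left; exact mul_le_mul_of_nonneg_left h hl0.le
  · right
    show l * s ≤ -l * _
    rw [neg_mul, ← mul_neg]
    exact mul_le_mul_of_nonneg_left h hl0.le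

/-! ### Policies on a fixed grid -/

/-- The arms which result from the decision rules `rule`, if the rewards of the first `s t` rounds
are available in round `t`. -/
noncomputable def recArm {d T : ℕ} (rule : Fin T → Info d T → Arm) (s : ℕ → ℕ) (ω : Path d T)
    (n : ℕ) : Arm :=
  if h : n < T then
    rule ⟨n, h⟩ (info ω (fun l => if _ : (l : ℕ) < n then recArm rule s ω l else true) (n + 1)
      (min (s n) n))
  else true
termination_by n

lemma info_congr {d T : ℕ} (ω : Path d T) {a a' : Fin T → Arm} (n s : ℕ)
    (h : ∀ l : Fin T, (l : ℕ) < s → a l = a' l) : info ω a n s = info ω a' n s := by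
  unfold info
  refine Prod.ext rfl (Prod.ext rfl ?_)
  funext l
  by_cases hl : (l : ℕ) < s
  · simp [hl, h l hl]
  · simp [hl]

lemma recArm_eq {d T : ℕ} (rule : Fin T → Info d T → Arm) (s : ℕ → ℕ) (hs : ∀ n, s n ≤ n)
    (ω : Path d T) (t : Fin T) :
    recArm rule s ω t = rule t (info ω (fun l => recArm rule s ω l) (t + 1) (s t)) := by
  conv_lhs => rw [recArm]
  rw [dif_pos t.2, min_eq_left (hs t)]
  congr 1
  refine info_congr ω _ _ fun l hl => ?_
  rw [dif_pos (hl.trans_le (hs t))]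

/-- A deterministic grid and measurable decision rules define a batch policy. -/
lemma exists_policy_of_rule {d T M : ℕ} (g : ℕ → ℕ) (h0 : g 0 = 0)
    (hlt : ∀ i < M, g i < g (i + 1)) (hM : g M = T) (rule : Fin T → Info d T → Arm)
    (hrule : ∀ t, Measurable (rule t)) :
    ∃ π : BatchPolicy d T M, ∀ (t : Fin T) (ω : Path d T), ∃ i < M, g i ≤ t ∧
      (t : ℕ) < g (i + 1) ∧
      π.arm t ω = rule t (info ω (fun l => π.arm l ω) (t + 1) (g i)) := by
  have hmono : ∀ i j, i ≤ j → j ≤ M → g i ≤ g j := by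
    intro i j hij hj
    induction j, hij using Nat.le_induction with
    | base => exact le_rfl
    | succ j _ ih => exact (ih (by omega)).trans (hlt j (by omega)).le
  set s : ℕ → ℕ := fun t => g (Nat.findGreatest (fun i => g i ≤ t) (M - 1)) with hsdef
  have hs : ∀ t, s t ≤ t := fun t =>
    Nat.findGreatest_spec (P := fun i => g i ≤ t) (Nat.zero_le (M - 1)) (by simp [h0])
  have hsi : ∀ t i, i < M → g i ≤ t → t < g (i + 1) → s t = g i := by
    intro t i hi h1 h2
    refine le_antisymm ?_ ?_
    · by_contra! h
      have hle := Nat.findGreatest_le (P := fun i => g i ≤ t) (M - 1)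
      set j := Nat.findGreatest (fun i => g i ≤ t) (M - 1) with hj
      have hji : i + 1 ≤ j := by
        by_contra! h3
        exact absurd (hmono j i (by omega) hi.le) (by simpa [hsdef, ← hj] using h)
      have := hmono (i + 1) j hji (by omega)
      have h5 : g j ≤ t := hs t
      omega
    · have := Nat.le_findGreatest (P := fun i => g i ≤ t) (n := M - 1) (by omega : i ≤ M - 1) h1
      exact hmono _ _ this ((Nat.findGreatest_le _).trans (by omega))
  refine ⟨{ grid := fun i _ => g i
            arm := fun t ω => recArm rule s ω t
            gridRule := fun i _ => g (i + 1)
            armRule := rule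
            measurable_gridRule := fun i => measurable_const
            measurable_armRule := hrule
            grid_zero := fun _ => h0
            grid_lt := fun i hi _ => hlt i hi
            grid_last := fun _ => hM
            grid_eq := fun i _ _ => rfl
            arm_eq := fun t ω i hi h1 h2 => by
              rw [recArm_eq rule s hs ω t, hsi t i hi h1 h2] }, ?_⟩
  intro t ω
  have hM0 : 0 < M := by
    rcases Nat.eq_zero_or_pos M with rfl | h
    · have := t.2; omega
    · exact h
  set j := Nat.findGreatest (fun i => g i ≤ t) (M - 1) with hj
  have hjM : j < M := by
    have := Nat.findGreatest_le (P := fun i => g i ≤ (t : ℕ)) (M - 1)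
    omega
  refine ⟨j, hjM, hs t, ?_, ?_⟩
  · by_cases hj1 : j + 1 ≤ M - 1
    · have := Nat.findGreatest_is_greatest (P := fun i => g i ≤ (t : ℕ)) (n := M - 1) (k := j + 1)
        (by omega) hj1
      omega
    · have : j + 1 = M := by omega
      rw [this, hM]; exact t.2
  · exact recArm_eq rule s hs ω t

/-- A grid with `K` batches extends to a grid with exactly `M` batches. -/
lemma exists_grid_refinement {T M K : ℕ} (hKM : K ≤ M) (hMT : M ≤ T) (τ : ℕ → ℕ) (h0 : τ 0 = 0)
    (hlt : ∀ b < K, τ b < τ (b + 1)) (hK : τ K = T) :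
    ∃ g : ℕ → ℕ, g 0 = 0 ∧ (∀ i j, i < j → j ≤ M → g i < g j) ∧ g M = T ∧
      ∀ b ≤ K, ∃ i ≤ M, g i = τ b := by
  have hmono : ∀ i j, i < j → j ≤ K → τ i < τ j := by
    intro i j hij hj
    induction j, hij using Nat.le_induction with
    | base => exact hlt i (by omega)
    | succ j _ ih => exact (ih (by omega)).trans (hlt j (by omega))
  have hinj : Set.InjOn τ (Finset.range (K + 1) : Set ℕ) := by
    intro i hi j hj hij
    simp only [Finset.coe_range, mem_Iio] at hi hj
    rcases lt_trichotomy i j with h | h | h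
    · have := hmono i j h (by omega); omega
    · exact h
    · have := hmono j i h (by omega); omega
  have hsub : (Finset.range (K + 1)).image τ ⊆ Finset.range (T + 1) := by
    intro x hx
    obtain ⟨b, hb, rfl⟩ := Finset.mem_image.1 hx
    rw [Finset.mem_range] at hb ⊢
    rcases Nat.lt_or_ge b K with h | h
    · have := hmono b K h le_rfl; omega
    · have : b = K := by omega
      rw [this, hK]; omega
  obtain ⟨B, hAB, hBT, hBc⟩ := Finset.exists_subsuperset_card_eq hsub (n := M + 1)
    (by rw [Finset.card_image_of_injOn hinj, Finset.card_range]; omega)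
    (by rw [Finset.card_range]; omega)
  have h0B : 0 ∈ B := hAB (Finset.mem_image.2 ⟨0, by simp, h0⟩)
  have hTB : T ∈ B := hAB (Finset.mem_image.2 ⟨K, by simp, hK⟩)
  set e := B.orderEmbOfFin hBc with he
  refine ⟨fun i => if h : i < M + 1 then e ⟨i, h⟩ else T, ?_, ?_, ?_, ?_⟩
  · have h1 : e ⟨0, by omega⟩ = B.min' ⟨0, h0B⟩ := Finset.orderEmbOfFin_zero hBc (by omega)
    have h2 := Finset.min'_le B 0 h0B
    simp only [Nat.zero_lt_succ, dif_pos]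
    omega
  · intro i j hij hj
    simp only [dif_pos (show i < M + 1 by omega), dif_pos (show j < M + 1 by omega)]
    exact e.strictMono hij
  · have h1 : e ⟨M + 1 - 1, by omega⟩ = B.max' ⟨0, h0B⟩ :=
      Finset.orderEmbOfFin_last hBc (by omega)
    have h2 := Finset.le_max' B T hTB
    have h3 := Finset.mem_range.1 (hBT (Finset.max'_mem B ⟨0, h0B⟩))
    simp only [Nat.lt_succ_self, dif_pos]
    have h4 : e ⟨M, by omega⟩ = B.max' ⟨0, h0B⟩ := h1
    show e ⟨M, _⟩ = T
    omega
  · intro b hb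
    have hbB : τ b ∈ (B : Set ℕ) := hAB (Finset.mem_image.2 ⟨b, by simp; omega, rfl⟩)
    rw [← Finset.range_orderEmbOfFin B hBc] at hbB
    obtain ⟨i, hi⟩ := hbB
    refine ⟨i, by omega, ?_⟩
    have : (⟨(i : ℕ), i.2⟩ : Fin (M + 1)) = i := rfl
    simp only [dif_pos i.2]
    exact hi

/-! ### The successive elimination rule -/

/-- The lower corner of the cell of side `w` which contains `x`. -/
noncomputable def cellPt {d : ℕ} (w : ℝ) (x : Ctx d) : Ctx d := fun j => w * ⌊x j / w⌋₊

/-- The contexts whose rewards are used for the cell with lower corner `z`. It contains the ball of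
radius `w` around each point of the cell, so that it has mass at least of order `w ^ d` if the cell
meets the support of the context distribution. -/
def region {d : ℕ} (w : ℝ) (z : Ctx d) : Set (Ctx d) := Metric.closedBall z (2 * w) ∩ cube d

/-- The arm which an undecided cell pulls in round `l`: the two arms alternate. -/
def parityArm (l : ℕ) : Arm := decide (Even l)

/-- The sign with which the reward of round `l` enters the test statistic. -/
def roundSign (l : ℕ) : ℝ := if Even l then 1 else -1

/-- The tuning parameters of the policy: batch `b` consists of the rounds from `τ b` to `τ (b+1)`,
and its decisions use cells of side `w b` and the threshold `θ b`. -/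
structure Schedule where
  τ : ℕ → ℕ
  w : ℕ → ℝ
  θ : ℕ → ℝ

/-- The rounds of batch `b`. -/
def Schedule.batch (S : Schedule) (T b : ℕ) : Finset (Fin T) :=
  Finset.univ.filter fun l => S.τ b ≤ (l : ℕ) ∧ (l : ℕ) < S.τ (b + 1)

instance : MeasurableSpace (Option Arm) := ⊤

/-- The signed sum of the rewards which batch `b` collected for the cell `z` of side `w (b+1)`. -/
noncomputable def Schedule.stat (S : Schedule) {d T : ℕ} (b : ℕ) (x : Fin T → Ctx d)
    (y : Fin T → ℝ) (z : Ctx d) : ℝ :=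
  ∑ l ∈ S.batch T b, (region (S.w (b + 1)) z).indicator (fun _ => roundSign l * y l) (x l)

open Classical in
/-- The arm which the data `x`, `y` of the batches before `b` select for the cell `z` of side
`w b`; `none` while both arms are active. A cell inherits the selection of a coarser cell which
meets its region; otherwise both arms were active on all of the region during the last batch,
and the test statistic decides. -/
noncomputable def Schedule.state (S : Schedule) {d T : ℕ} (x : Fin T → Ctx d) (y : Fin T → ℝ) :
    ℕ → Ctx d → Option Arm
  | 0, _ => none
  | b + 1, z =>
    if ∃ v ∈ cellPt (S.w b) '' region (S.w (b + 1)) z, S.state x y b v = some true then some true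
    else if ∃ v ∈ cellPt (S.w b) '' region (S.w (b + 1)) z, S.state x y b v = some false then
      some false
    else if S.θ (b + 1) < S.stat b x y z then some true
    else if S.stat b x y z < -S.θ (b + 1) then some false
    else none

/-- The batch to which round `t` belongs, if there are `K` batches. -/
def Schedule.batchOf (S : Schedule) (K t : ℕ) : ℕ := Nat.findGreatest (fun b => S.τ b ≤ t) K

lemma Schedule.batchOf_spec {S : Schedule} {K t : ℕ} (h0 : S.τ 0 = 0) (ht : t < S.τ K) :
    S.batchOf K t < K ∧ S.τ (S.batchOf K t) ≤ t ∧ t < S.τ (S.batchOf K t + 1) := by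
  have h1 : S.τ (S.batchOf K t) ≤ t :=
    Nat.findGreatest_spec (P := fun b => S.τ b ≤ t) (Nat.zero_le K) (by simp [h0])
  have h2 : S.batchOf K t < K := by
    refine lt_of_le_of_ne (Nat.findGreatest_le _) fun h => ?_
    rw [h] at h1; omega
  refine ⟨h2, h1, ?_⟩
  have := Nat.findGreatest_is_greatest (P := fun b => S.τ b ≤ t) (n := K)
    (k := S.batchOf K t + 1) (Nat.lt_succ_self _) h2
  omega

lemma Schedule.state_congr (S : Schedule) {d T : ℕ} {x x' : Fin T → Ctx d} {y y' : Fin T → ℝ}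
    (b : ℕ) (hτ : ∀ a < b, S.τ a ≤ S.τ (a + 1))
    (h : ∀ l : Fin T, (l : ℕ) < S.τ b → x l = x' l ∧ y l = y' l) :
    S.state x y b = S.state x' y' b := by
  induction b with
  | zero => rfl
  | succ b ih =>
    have ih' := ih (fun a ha => hτ a (by omega)) fun l hl => h l (hl.trans_le (hτ b (by omega)))
    have hst : S.stat b x y = S.stat b x' y' := by
      funext z
      refine Finset.sum_congr rfl fun l hl => ?_
      have hl' := (Finset.mem_filter.1 hl).2.2
      rw [(h l hl').1, (h l hl').2]
    funext z
    rw [Schedule.state, Schedule.state, ih', hst]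

lemma countable_range_cellPt {d : ℕ} (w : ℝ) : (range (cellPt w : Ctx d → Ctx d)).Countable := by
  refine (countable_range fun (n : Fin d → ℕ) (j : Fin d) => w * (n j : ℝ)).mono ?_
  rintro _ ⟨x, rfl⟩
  exact ⟨fun j => ⌊x j / w⌋₊, rfl⟩

lemma measurableSet_region {d : ℕ} (w : ℝ) (z : Ctx d) : MeasurableSet (region w z) :=
  Metric.isClosed_closedBall.measurableSet.inter (measurableSet_cube d)

lemma Schedule.measurable_stat (S : Schedule) {d T : ℕ} (b : ℕ) (z : Ctx d) :
    Measurable fun p : (Fin T → Ctx d) × (Fin T → ℝ) => S.stat b p.1 p.2 z := by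
  refine Finset.measurable_sum _ fun l _ => ?_
  have hA : MeasurableSet {p : (Fin T → Ctx d) × (Fin T → ℝ) | p.1 l ∈ region (S.w (b + 1)) z} :=
    ((measurable_pi_apply l).comp measurable_fst) (measurableSet_region _ _)
  have : (fun p : (Fin T → Ctx d) × (Fin T → ℝ) =>
      (region (S.w (b + 1)) z).indicator (fun _ => roundSign l * p.2 l) (p.1 l))
      = {p : (Fin T → Ctx d) × (Fin T → ℝ) | p.1 l ∈ region (S.w (b + 1)) z}.indicator
        fun p => roundSign l * p.2 l := by
    funext p
    simp only [indicator, mem_ofPred_eq]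
  rw [this]
  exact (((measurable_pi_apply l).comp measurable_snd).const_mul _).indicator hA

lemma Schedule.measurable_state (S : Schedule) {d T : ℕ} (b : ℕ) (z : Ctx d) :
    Measurable fun p : (Fin T → Ctx d) × (Fin T → ℝ) => S.state p.1 p.2 b z := by
  induction b generalizing z with
  | zero => exact measurable_const
  | succ b ih =>
    have hex : ∀ a : Arm, MeasurableSet {p : (Fin T → Ctx d) × (Fin T → ℝ) |
        ∃ v ∈ cellPt (S.w b) '' region (S.w (b + 1)) z, S.state p.1 p.2 b v = some a} := by
      intro a
      have : {p : (Fin T → Ctx d) × (Fin T → ℝ) |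
          ∃ v ∈ cellPt (S.w b) '' region (S.w (b + 1)) z, S.state p.1 p.2 b v = some a}
          = ⋃ v ∈ cellPt (S.w b) '' region (S.w (b + 1)) z,
            {p : (Fin T → Ctx d) × (Fin T → ℝ) | S.state p.1 p.2 b v = some a} := by
        ext p; simp only [mem_ofPred_eq, mem_iUnion, exists_prop]
      rw [this]
      refine MeasurableSet.biUnion
        ((countable_range_cellPt (S.w b)).mono (image_subset_range _ _)) fun v _ => ?_
      exact ih v (MeasurableSpace.measurableSet_top (s := {some a}))
    have hst := S.measurable_stat (T := T) b z
    simp only [Schedule.state]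
    refine Measurable.ite (hex true) measurable_const ?_
    refine Measurable.ite (hex false) measurable_const ?_
    refine Measurable.ite (measurableSet_lt measurable_const hst) measurable_const ?_
    exact Measurable.ite (measurableSet_lt hst measurable_const) measurable_const measurable_const

/-- The decision rule of the policy. -/
noncomputable def Schedule.rule (S : Schedule) {d T : ℕ} (K : ℕ) (t : Fin T) (i : Info d T) : Arm :=
  (S.state i.2.1 i.2.2 (S.batchOf K t) (cellPt (S.w (S.batchOf K t)) (i.2.1 t))).getD (parityArm t)

lemma Schedule.measurable_rule (S : Schedule) {d T : ℕ} (K : ℕ) (t : Fin T) :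
    Measurable (S.rule (d := d) K t) := by
  set b := S.batchOf K t
  have h1 : Measurable fun q : ((Fin T → Ctx d) × (Fin T → ℝ)) × (Fin d → ℕ) =>
      S.state q.1.1 q.1.2 b (fun j => S.w b * (q.2 j : ℝ)) :=
    measurable_from_prod_countable_left fun n =>
      S.measurable_state b fun j => S.w b * (n j : ℝ)
  have h2 : Measurable fun i : Info d T => (i.2, fun j => ⌊i.2.1 t j / S.w b⌋₊) := by
    refine measurable_snd.prodMk (measurable_pi_lambda _ fun j => Nat.measurable_floor.comp ?_)
    have h0 : Measurable fun i : Info d T => i.2.1 t j := by fun_prop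
    exact h0.div_const _
  have h3 : Measurable fun o : Option Arm => o.getD (parityArm t) := measurable_from_top
  exact h3.comp (h1.comp h2)

lemma Schedule.exists_policy (S : Schedule) {d T M K : ℕ} (hKM : K ≤ M) (hMT : M ≤ T)
    (h0 : S.τ 0 = 0) (hlt : ∀ b < K, S.τ b < S.τ (b + 1)) (hK : S.τ K = T) :
    ∃ π : BatchPolicy d T M, ∀ (t : Fin T) (ω : Path d T),
      π.arm t ω = (S.state (fun l => (ω l).1) (fun l => (ω l).2 (π.arm l ω)) (S.batchOf K t)
        (cellPt (S.w (S.batchOf K t)) (ω t).1)).getD (parityArm t) := by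
  obtain ⟨g, hg0, hg, hgM, hτg⟩ := exists_grid_refinement hKM hMT S.τ h0 hlt hK
  obtain ⟨π, hπ⟩ := exists_policy_of_rule (d := d) g hg0 (fun i hi => hg i (i + 1) (by omega) hi)
    hgM (S.rule K) (S.measurable_rule K)
  refine ⟨π, fun t ω => ?_⟩
  obtain ⟨i, hiM, hi1, hi2, hi⟩ := hπ t ω
  obtain ⟨hb1, hb2, hb3⟩ := S.batchOf_spec (K := K) (t := t) h0 (by rw [hK]; exact t.2)
  rw [hi]
  have hle : S.τ (S.batchOf K t) ≤ g i := by
    obtain ⟨j, hj, hje⟩ := hτg _ hb1.le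
    rw [← hje] at hb2 ⊢
    have hji : j ≤ i := by
      by_contra! h
      have h1 : g (i + 1) ≤ g j := by
        rcases Nat.lt_or_ge (i + 1) j with h2 | h2
        · exact (hg _ _ h2 hj).le
        · have : j = i + 1 := by omega
          rw [this]
      omega
    rcases hji.lt_or_eq with h | h
    · exact (hg _ _ h hiM.le).le
    · rw [h]
  have hx : (info ω (fun l => π.arm l ω) (t + 1) (g i)).2.1 t = (ω t).1 := by
    simp [info]
  unfold Schedule.rule
  rw [hx]
  have hst : S.state (info ω (fun l => π.arm l ω) (t + 1) (g i)).2.1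
      (info ω (fun l => π.arm l ω) (t + 1) (g i)).2.2 (S.batchOf K t)
      = S.state (fun l => (ω l).1) (fun l => (ω l).2 (π.arm l ω)) (S.batchOf K t) := by
    refine S.state_congr _ (fun a ha => (hlt a (by omega)).le) fun l hl => ?_
    have h1 : (l : ℕ) < t + 1 := by omega
    have h2 : (l : ℕ) < g i := by omega
    simp only [info, if_pos h1, if_pos h2, and_self]
  rw [hst]

/-! ### Correctness of the eliminations on the good event -/

/-- The variation of the gap on the region of a cell of side `w` is at most
`gapOsc c * w ^ β`. -/
noncomputable def gapOsc (c : ClassConstants) : ℝ := 6 * c.d * c.L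

/-- On an undecided cell of side `w` the gap is at most `gapBound c * w ^ β`. -/
noncomputable def gapBound (c : ClassConstants) : ℝ :=
  gapOsc c + 6 * gapOsc c * c.cUp * 4 ^ c.d / c.cLow

/-- The summand of the test statistic for a cell `z` of side `w` in round `l`, if both arms are
active on the region of the cell. -/
noncomputable def testVar {d : ℕ} (w : ℝ) (z : Ctx d) (l : ℕ) (o : Outcome d) : ℝ :=
  (region w z).indicator (fun _ => roundSign l * o.2 (parityArm l)) o.1

/-- The requirements on the tuning parameters of the policy, for `K` batches. -/
structure Schedule.Admissible (S : Schedule) (c : ClassConstants) (T K : ℕ) : Prop where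
  zero : S.τ 0 = 0
  lt : ∀ b < K, S.τ b < S.τ (b + 1)
  last : S.τ K = T
  even : ∀ b < K, Even (S.τ b)
  w_pos : ∀ b, 1 ≤ b → b < K → 0 < S.w b
  w_le : ∀ b, 1 ≤ b → b < K → 4 * S.w b ≤ 1
  w_ge : ∀ b, 1 ≤ b → b < K → 1 ≤ T * S.w b
  bound_le : ∀ b, 1 ≤ b → b < K → gapBound c * S.w b ^ c.β ≤ c.δ₀
  halve : ∀ b, 1 ≤ b → b + 1 < K → 2 * S.w (b + 1) ^ c.β ≤ S.w b ^ c.β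
  threshold : ∀ b, b + 1 < K → S.θ (b + 1) =
    2 * gapOsc c * c.cUp * 4 ^ c.d * ((S.τ (b + 1) : ℝ) - S.τ b) * S.w (b + 1) ^ c.β
      * S.w (b + 1) ^ c.d
  sample : ∀ b, b + 1 < K → (c.d + 4) * Real.log T ≤
    gapOsc c ^ 2 * c.cUp * 4 ^ c.d / 4 * ((S.τ (b + 1) : ℝ) - S.τ b) * (S.w (b + 1) ^ c.β) ^ 2
      * S.w (b + 1) ^ c.d

/-- The sign and range conditions on the constants. The two conditions which couple `cUp` and `D₀`
to the other constants are not included: only the lower bound needs them. -/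
structure ClassConstants.Good (c : ClassConstants) : Prop where
  d_pos : 1 ≤ c.d
  β_pos : 0 < c.β
  β_le : c.β ≤ 1
  L_pos : 0 < c.L
  cLow_pos : 0 < c.cLow
  cUp_pos : 0 < c.cUp
  δ₀_pos : 0 < c.δ₀
  δ₀_lt : c.δ₀ < 1
  D₀_pos : 0 < c.D₀

lemma gapOsc_pos {c : ClassConstants} (hc : c.Good) : 0 < gapOsc c := by
  have := hc.L_pos
  have : (0 : ℝ) < c.d := by exact_mod_cast hc.d_pos
  unfold gapOsc; positivity

lemma gapOsc_le_gapBound {c : ClassConstants} (hc : c.Good) : gapOsc c ≤ gapBound c := by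
  have := gapOsc_pos hc
  have := hc.cUp_pos
  have := hc.cLow_pos
  have : 0 ≤ 6 * gapOsc c * c.cUp * 4 ^ c.d / c.cLow := by positivity
  unfold gapBound; linarith

lemma norm_sub_cellPt_le {d : ℕ} {w : ℝ} (hw : 0 < w) {x : Ctx d} (hx : x ∈ cube d) :
    ‖x - cellPt w x‖ ≤ w := by
  rw [pi_norm_le_iff_of_nonneg hw.le]
  intro j
  have h0 : 0 ≤ x j / w := div_nonneg (hx.1 j) hw.le
  have h1 := Nat.floor_le h0
  have h2 := (Nat.lt_floor_add_one (x j / w)).le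
  rw [le_div_iff₀ hw] at h1
  rw [div_le_iff₀ hw] at h2
  simp only [Pi.sub_apply, cellPt, Real.norm_eq_abs]
  rw [abs_le]
  constructor <;> nlinarith

lemma closedBall_inter_cube_subset_region {d : ℕ} {w : ℝ} (hw : 0 < w) {x : Ctx d}
    (hx : x ∈ cube d) : Metric.closedBall x w ∩ cube d ⊆ region w (cellPt w x) := by
  intro y hy
  refine ⟨?_, hy.2⟩
  rw [Metric.mem_closedBall]
  have h1 := norm_sub_cellPt_le hw hx
  have h2 := Metric.mem_closedBall.1 hy.1
  have h3 := dist_triangle y x (cellPt w x)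
  rw [← dist_eq_norm] at h1
  linarith

lemma norm_sub_le_of_mem_region {d : ℕ} {w : ℝ} (hw : 0 < w) {x y : Ctx d} (hx : x ∈ cube d)
    (hy : y ∈ region w (cellPt w x)) : ‖x - y‖ ≤ 3 * w := by
  have h1 := norm_sub_cellPt_le hw hx
  have h2 := Metric.mem_closedBall.1 hy.1
  have h3 := dist_triangle x (cellPt w x) y
  rw [← dist_eq_norm] at h1 ⊢
  rw [dist_comm] at h2
  linarith

lemma Schedule.Admissible.mono {S : Schedule} {c : ClassConstants} {T K : ℕ}
    (h : S.Admissible c T K) {i j : ℕ} (hij : i ≤ j) (hj : j ≤ K) : S.τ i ≤ S.τ j := by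
  induction j, hij using Nat.le_induction with
  | base => exact le_rfl
  | succ j _ ih => exact (ih (by omega)).trans (h.lt j (by omega)).le

lemma Schedule.Admissible.batchOf_eq {S : Schedule} {c : ClassConstants} {T K : ℕ}
    (h : S.Admissible c T K) {b t : ℕ} (hb : b < K) (h1 : S.τ b ≤ t) (h2 : t < S.τ (b + 1)) :
    S.batchOf K t = b := by
  have ht : t < S.τ K := h2.trans_le (h.mono hb le_rfl)
  obtain ⟨h3, h4, h5⟩ := S.batchOf_spec h.zero ht
  rcases lt_trichotomy (S.batchOf K t) b with h6 | h6 | h6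
  · have := h.mono (i := S.batchOf K t + 1) h6 hb.le; omega
  · exact h6
  · have := h.mono (i := b + 1) h6 h3.le; omega

/-- The integral of the gap over the region of a cell. -/
noncomputable def Environment.gapIntegral {d : ℕ} (E : Environment d) (R : Set (Ctx d)) : ℝ :=
  ∫ z in Prod.fst ⁻¹' R, E.gap z.1 ∂E.law

lemma Environment.gap_integrable {d : ℕ} (E : Environment d) :
    Integrable (fun z : Outcome d => E.gap z.1) E.law :=
  (E.f_integrable true).sub (E.f_integrable false)

lemma Environment.integral_testVar {d : ℕ} (E : Environment d) (w : ℝ) (z : Ctx d) (l : ℕ) :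
    ∫ o, testVar w z l o ∂E.law = if Even l
      then ∫ o in Prod.fst ⁻¹' region w z, E.f true o.1 ∂E.law
      else -∫ o in Prod.fst ⁻¹' region w z, E.f false o.1 ∂E.law := by
  have h : ∀ o : Outcome d, testVar w z l o
      = (Prod.fst ⁻¹' region w z).indicator (fun o : Outcome d => roundSign l * o.2 (parityArm l)) o := by
    intro o; rfl
  simp_rw [h]
  rw [integral_indicator (measurable_fst (measurableSet_region w z)), integral_const_mul,
    E.setIntegral_reward _ (measurableSet_region w z)]
  by_cases hl : Even l
  · simp [hl, roundSign, parityArm]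
  · simp [hl, roundSign, parityArm]

lemma sum_Ico_two_mul_alternating (p q : ℝ) {a a' : ℕ} (h : a ≤ a') :
    ∑ l ∈ Finset.Ico (2 * a) (2 * a'), (if Even l then p else -q) = (a' - a : ℝ) * (p - q) := by
  induction a', h using Nat.le_induction with
  | base => simp
  | succ n hn ih =>
    rw [show 2 * (n + 1) = 2 * n + 1 + 1 by ring, Finset.sum_Ico_succ_top (by omega),
      Finset.sum_Ico_succ_top (by omega), ih]
    have h1 : Even (2 * n) := even_two_mul n
    have h2 : ¬ Even (2 * n + 1) := by simp
    rw [if_pos h1, if_neg h2]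
    push_cast; ring

lemma Schedule.sum_batch (S : Schedule) {T b : ℕ} (hT : S.τ (b + 1) ≤ T) (F : ℕ → ℝ) :
    ∑ l ∈ S.batch T b, F l = ∑ l ∈ Finset.Ico (S.τ b) (S.τ (b + 1)), F l := by
  refine Finset.sum_bij (fun l _ => (l : ℕ)) ?_ ?_ ?_ ?_
  · intro l hl
    exact Finset.mem_Ico.2 (Finset.mem_filter.1 hl).2
  · intro l _ l' _ h
    exact Fin.ext h
  · intro l hl
    have := Finset.mem_Ico.1 hl
    exact ⟨⟨l, by omega⟩, Finset.mem_filter.2 ⟨Finset.mem_univ _, this⟩, rfl⟩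
  · intros; rfl

lemma Schedule.card_batch (S : Schedule) {T b : ℕ} (hT : S.τ (b + 1) ≤ T)
    (hle : S.τ b ≤ S.τ (b + 1)) : ((S.batch T b).card : ℝ) = (S.τ (b + 1) : ℝ) - S.τ b := by
  have := S.sum_batch hT (fun _ => 1)
  simp only [Finset.sum_const, nsmul_eq_mul, mul_one, Nat.card_Ico] at this
  rw [this, Nat.cast_sub hle]

lemma Environment.sum_integral_testVar {d : ℕ} (E : Environment d) {S : Schedule} {T b : ℕ}
    (hT : S.τ (b + 1) ≤ T) (hle : S.τ b ≤ S.τ (b + 1)) (h1 : Even (S.τ b))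
    (h2 : Even (S.τ (b + 1))) (w : ℝ) (z : Ctx d) :
    ∑ l ∈ S.batch T b, ∫ o, testVar w z l o ∂E.law
      = ((S.τ (b + 1) : ℝ) - S.τ b) / 2 * E.gapIntegral (region w z) := by
  rw [S.sum_batch hT fun l => ∫ o, testVar w z l o ∂E.law]
  simp_rw [E.integral_testVar]
  obtain ⟨a, ha⟩ := h1
  obtain ⟨a', ha'⟩ := h2
  rw [ha, ha', ← two_mul, ← two_mul, sum_Ico_two_mul_alternating _ _ (by omega)]
  have : E.gapIntegral (region w z) = ∫ o in Prod.fst ⁻¹' region w z, E.f true o.1 ∂E.law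
      - ∫ o in Prod.fst ⁻¹' region w z, E.f false o.1 ∂E.law :=
    integral_sub (E.f_integrable true).integrableOn (E.f_integrable false).integrableOn
  rw [this]
  push_cast; ring

lemma Environment.abs_gapIntegral_sub_le {d : ℕ} (E : Environment d) {R : Set (Ctx d)}
    (hR : MeasurableSet R) {g ε : ℝ} (h : ∀ y ∈ R, |E.gap y - g| ≤ ε) :
    |E.gapIntegral R - g * E.ctxLaw.real R| ≤ ε * E.ctxLaw.real R := by
  have hm : MeasurableSet (Prod.fst ⁻¹' R : Set (Outcome d)) := measurable_fst hR
  have h1 : E.gapIntegral R - g * E.ctxLaw.real R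
      = ∫ z in Prod.fst ⁻¹' R, (E.gap z.1 - g) ∂E.law := by
    rw [integral_sub E.gap_integrable.integrableOn (integrable_const _), setIntegral_const,
      E.ctxLaw_real_apply hR, smul_eq_mul, mul_comm g]
    rfl
  rw [h1, E.ctxLaw_real_apply hR, ← Real.norm_eq_abs]
  exact norm_setIntegral_le_of_norm_le_const (measure_lt_top _ _) fun z hz => h z.1 hz

lemma region_mass_le {c : ClassConstants} (hc : c.Good) {E : Environment c.d}
    (hE : BoundedDensity c E) {w : ℝ} (hw : 0 < w) (hw' : 4 * w ≤ 1) (z : Ctx c.d) :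
    E.ctxLaw.real (region w z) ≤ c.cUp * 4 ^ c.d * w ^ c.d := by
  refine (measureReal_mono inter_subset_left).trans
    ((hE.closedBall_le hc.cUp_pos.le z (r := 2 * w) (by positivity) (by linarith)).trans_eq ?_)
  rw [show 2 * (2 * w) = 4 * w by ring, mul_pow]; ring

lemma region_mass_ge {c : ClassConstants} {E : Environment c.d}
    (hE : BoundedDensity c E) {w : ℝ} (hw : 0 < w) (hw' : w ≤ 1) {x : Ctx c.d}
    (hx : x ∈ cube c.d) (hxs : x ∈ E.ctxLaw.support) :
    c.cLow * w ^ c.d ≤ E.ctxLaw.real (region w (cellPt w x)) := by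
  refine ((hE x hxs w hw hw').1).trans ?_
  have h : E.ctxLaw.real (Metric.closedBall x w) = E.ctxLaw.real (Metric.closedBall x w ∩ cube c.d) := by
    refine measureReal_congr ?_
    filter_upwards [E.ctxLaw_cube] with y hy
    exact propext ⟨fun h => ⟨h, hy⟩, fun h => h.1⟩
  rw [h]
  exact measureReal_mono (closedBall_inter_cube_subset_region hw hx)

/-- The sign of an arm in the gap `f^(1) - f^(-1)`. -/
def armSign (a : Arm) : ℝ := if a then 1 else -1

/-- The paths on which all test statistics are close to their means. -/
def Environment.goodEvent {d : ℕ} (E : Environment d) (S : Schedule) (T K : ℕ) : Set (Path d T) :=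
  {ω | ∀ b, b + 1 < K → ∀ z ∈ cellPt (S.w (b + 1)) '' cube d,
    |∑ l ∈ S.batch T b, testVar (S.w (b + 1)) z l (ω l)
      - ∑ l ∈ S.batch T b, ∫ o, testVar (S.w (b + 1)) z l o ∂E.law| < S.θ (b + 1) / 2}

/-- If both arms are active on the whole region of a cell, then the observed test statistic is a
sum over independent rounds. -/
lemma Schedule.stat_eq_sum_testVar {S : Schedule} {c : ClassConstants} {T K b : ℕ}
    (hS : S.Admissible c T K) (hb : b < K) {ω : Path c.d T} {a : Fin T → Arm}
    (ha : ∀ t : Fin T, a t = (S.state (fun l => (ω l).1) (fun l => (ω l).2 (a l)) (S.batchOf K t)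
        (cellPt (S.w (S.batchOf K t)) (ω t).1)).getD (parityArm t)) {z : Ctx c.d}
    (hz : ∀ v ∈ cellPt (S.w b) '' region (S.w (b + 1)) z,
      S.state (fun l => (ω l).1) (fun l => (ω l).2 (a l)) b v = none) :
    S.stat b (fun l => (ω l).1) (fun l => (ω l).2 (a l)) z
      = ∑ l ∈ S.batch T b, testVar (S.w (b + 1)) z l (ω l) := by
  refine Finset.sum_congr rfl fun l hl => ?_
  obtain ⟨h1, h2⟩ := (Finset.mem_filter.1 hl).2
  unfold testVar indicator
  by_cases hR : (ω l).1 ∈ region (S.w (b + 1)) z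
  · have : a l = parityArm l := by
      rw [ha l, hS.batchOf_eq hb h1 h2, hz _ (mem_image_of_mem _ hR)]; rfl
    simp only [if_pos hR, this]
  · simp only [if_neg hR]

/-- The two sides of the test: a large statistic certifies a gap of at least `gapOsc c * w ^ β`,
a small statistic certifies a gap of at most `gapBound c * w ^ β`. -/
lemma gap_of_stat {c : ClassConstants} (hc : c.Good) {E : Environment c.d}
    (hE : BoundedDensity c E) (hH : HolderSmooth c E) {w n : ℝ} (hw : 0 < w) (hw' : 4 * w ≤ 1)
    (hn : 0 < n) {x : Ctx c.d} (hx : x ∈ cube c.d) {G θ : ℝ}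
    (hθ : θ = 2 * gapOsc c * c.cUp * 4 ^ c.d * n * w ^ c.β * w ^ c.d)
    (hG : |G - n / 2 * E.gapIntegral (region w (cellPt w x))| < θ / 2) :
    (θ < G → gapOsc c * w ^ c.β ≤ E.gap x) ∧ (G < -θ → gapOsc c * w ^ c.β ≤ -E.gap x) ∧
    (x ∈ E.ctxLaw.support → -θ ≤ G → G ≤ θ → |E.gap x| ≤ gapBound c * w ^ c.β) := by
  set R := region w (cellPt w x)
  set P := E.ctxLaw.real R
  set I := E.gapIntegral R
  have hΛ := gapOsc_pos hc
  have hU := hc.cUp_pos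
  have hLo := hc.cLow_pos
  have hwβ : 0 < w ^ c.β := Real.rpow_pos_of_pos hw _
  have hwd : 0 < w ^ c.d := pow_pos hw _
  have hI : |I - E.gap x * P| ≤ gapOsc c * w ^ c.β * P :=
    E.abs_gapIntegral_sub_le (measurableSet_region _ _) fun y hy =>
      (hH.abs_gap_sub_le hc.d_pos hc.β_pos hc.β_le hc.L_pos (hy.2) hx hw.le (by
        rw [norm_sub_rev]; exact norm_sub_le_of_mem_region hw hx hy))
  have hP0 : 0 ≤ P := measureReal_nonneg
  have hP : P ≤ c.cUp * 4 ^ c.d * w ^ c.d := region_mass_le hc hE hw hw' _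
  obtain ⟨hI1, hI2⟩ := abs_le.1 hI
  obtain ⟨hG1, hG2⟩ := abs_lt.1 hG
  set ε := gapOsc c * w ^ c.β with hε
  have hεpos : 0 < ε := by positivity
  set V := c.cUp * 4 ^ c.d * w ^ c.d with hV
  have hVpos : 0 < V := by positivity
  have hθ' : θ = 2 * n * (ε * V) := by rw [hθ, hε, hV]; ring
  -- `V` bounds the mass `P` of the region from above, so that a statistic above the threshold
  -- exceeds what a gap below `ε` and the oscillation `ε` can produce
  have key : ∀ g : ℝ, 2 * ε * V < (g + ε) * P → ε ≤ g := by
    intro g hg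
    have h1 : 0 < g + ε := by
      by_contra! h
      have : (g + ε) * P ≤ 0 := mul_nonpos_of_nonpos_of_nonneg h hP0
      nlinarith [mul_pos hεpos hVpos]
    have h2 : (g + ε) * P ≤ (g + ε) * V := by gcongr
    by_contra! h
    nlinarith
  refine ⟨fun h => key _ ?_, fun h => key _ ?_, fun hxs h1 h2 => ?_⟩
  · have h3 : n * (ε * V) < n / 2 * I := by linarith
    have h4 : 2 * (ε * V) < I := by nlinarith
    nlinarith
  · have h3 : n * (ε * V) < n / 2 * (-I) := by linarith
    have h4 : 2 * (ε * V) < -I := by nlinarith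
    nlinarith
  -- below the threshold, the lower bound on the mass of the region bounds the gap
  · have hPl : c.cLow * w ^ c.d ≤ P := region_mass_ge hE hw (by linarith) hx hxs
    have h3 : n / 2 * |I| ≤ 3 * n * (ε * V) := by
      have h5 : |n / 2 * I| ≤ 3 * n * (ε * V) := by
        rw [abs_le]; constructor <;> linarith
      rwa [abs_mul, abs_of_pos (by positivity : 0 < n / 2)] at h5
    have h4 : |I| ≤ 6 * (ε * V) := by
      by_contra! h
      nlinarith
    have h5 : (|E.gap x| - ε) * P ≤ 6 * (ε * V) := by
      have h6 : |E.gap x| * P ≤ |I| + ε * P := by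
        rw [← abs_of_nonneg hP0, ← abs_mul, abs_of_nonneg hP0]
        have := abs_sub_abs_le_abs_sub (E.gap x * P) I
        rw [abs_sub_comm] at this
        linarith
      linarith
    have h7 : |E.gap x| - ε ≤ 6 * gapOsc c * c.cUp * 4 ^ c.d / c.cLow * w ^ c.β := by
      by_contra! h
      have h8 : 0 < 6 * gapOsc c * c.cUp * 4 ^ c.d / c.cLow * w ^ c.β := by positivity
      have h9 : 6 * gapOsc c * c.cUp * 4 ^ c.d / c.cLow * w ^ c.β * (c.cLow * w ^ c.d)
          = 6 * (ε * V) := by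
        rw [hε, hV]; field_simp
      have h10 : 6 * gapOsc c * c.cUp * 4 ^ c.d / c.cLow * w ^ c.β * (c.cLow * w ^ c.d)
          < (|E.gap x| - ε) * P := by
        refine lt_of_lt_of_le ?_ (mul_le_mul_of_nonneg_left hPl (h8.trans h).le)
        exact mul_lt_mul_of_pos_right h (by positivity)
      linarith
    unfold gapBound
    rw [add_mul]
    linarith

/-- The induction step of `state_correct`. A selection for a coarser cell comes with a margin of
twice the oscillation of the gap, and may therefore be inherited. -/
lemma state_correct_step {c : ClassConstants} (hc : c.Good) {E : Environment c.d}
    (hE : BoundedDensity c E) (hH : HolderSmooth c E) {S : Schedule} {T K : ℕ}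
    (hS : S.Admissible c T K) {ω : Path c.d T} {a : Fin T → Arm}
    (ha : ∀ t : Fin T, a t = (S.state (fun l => (ω l).1) (fun l => (ω l).2 (a l)) (S.batchOf K t)
        (cellPt (S.w (S.batchOf K t)) (ω t).1)).getD (parityArm t))
    (hω : ω ∈ E.goodEvent S T K) {b : ℕ} (hbK : b + 1 < K)
    (hprev : ∀ y ∈ cube c.d, ∀ k,
      S.state (fun l => (ω l).1) (fun l => (ω l).2 (a l)) b (cellPt (S.w b) y) = some k →
      2 * (gapOsc c * S.w (b + 1) ^ c.β) ≤ armSign k * E.gap y)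
    {x : Ctx c.d} (hx : x ∈ cube c.d) :
    (∀ k, S.state (fun l => (ω l).1) (fun l => (ω l).2 (a l)) (b + 1) (cellPt (S.w (b + 1)) x)
        = some k → gapOsc c * S.w (b + 1) ^ c.β ≤ armSign k * E.gap x) ∧
    (S.state (fun l => (ω l).1) (fun l => (ω l).2 (a l)) (b + 1) (cellPt (S.w (b + 1)) x) = none →
      x ∈ E.ctxLaw.support → |E.gap x| ≤ gapBound c * S.w (b + 1) ^ c.β) := by
  have hw := hS.w_pos (b + 1) (by omega) hbK
  have hw' := hS.w_le (b + 1) (by omega) hbK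
  -- inherited selections
  have hinh : ∀ k, (∃ v ∈ cellPt (S.w b) '' region (S.w (b + 1)) (cellPt (S.w (b + 1)) x),
      S.state (fun l => (ω l).1) (fun l => (ω l).2 (a l)) b v = some k) →
      gapOsc c * S.w (b + 1) ^ c.β ≤ armSign k * E.gap x := by
    rintro k ⟨_, ⟨y, hy, rfl⟩, hk⟩
    have h1 := hprev y hy.2 k hk
    have h2 := abs_le.1 (hH.abs_gap_sub_le hc.d_pos hc.β_pos hc.β_le hc.L_pos hx hy.2 hw.le
      (norm_sub_le_of_mem_region hw hx hy))
    change -(gapOsc c * _) ≤ _ ∧ _ ≤ gapOsc c * _ at h2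
    cases k <;> simp only [armSign, if_true, Bool.false_eq_true, if_false] at h1 ⊢ <;> linarith
  have hτ := hS.lt b (by omega)
  have hn : (0 : ℝ) < (S.τ (b + 1) : ℝ) - S.τ b := by
    have : (S.τ b : ℝ) < S.τ (b + 1) := by exact_mod_cast hτ
    linarith
  have hT : S.τ (b + 1) ≤ T := by rw [← hS.last]; exact hS.mono (by omega) le_rfl
  rw [Schedule.state]
  by_cases h1 : ∃ v ∈ cellPt (S.w b) '' region (S.w (b + 1)) (cellPt (S.w (b + 1)) x),
      S.state (fun l => (ω l).1) (fun l => (ω l).2 (a l)) b v = some true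
  · rw [if_pos h1]
    refine ⟨fun k hk => ?_, fun h => by cases h⟩
    cases hk; exact hinh true h1
  rw [if_neg h1]
  by_cases h2 : ∃ v ∈ cellPt (S.w b) '' region (S.w (b + 1)) (cellPt (S.w (b + 1)) x),
      S.state (fun l => (ω l).1) (fun l => (ω l).2 (a l)) b v = some false
  · rw [if_pos h2]
    refine ⟨fun k hk => ?_, fun h => by cases h⟩
    cases hk; exact hinh false h2
  rw [if_neg h2]
  -- nothing is inherited: the test of the last batch is valid
  have hst := S.stat_eq_sum_testVar hS (b := b) (by omega) ha (z := cellPt (S.w (b + 1)) x)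
    (fun v hv => by
      rcases h : S.state (fun l => (ω l).1) (fun l => (ω l).2 (a l)) b v with _ | k
      · rfl
      · cases k
        · exact absurd ⟨v, hv, h⟩ h2
        · exact absurd ⟨v, hv, h⟩ h1)
  have hgood := hω b hbK _ (mem_image_of_mem _ hx)
  rw [E.sum_integral_testVar hT hτ.le (hS.even b (by omega)) (hS.even (b + 1) hbK), ← hst] at hgood
  obtain ⟨g1, g2, g3⟩ := gap_of_stat hc hE hH hw hw' hn hx (hS.threshold b hbK) hgood
  by_cases h3 : S.θ (b + 1) < S.stat b (fun l => (ω l).1) (fun l => (ω l).2 (a l))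
      (cellPt (S.w (b + 1)) x)
  · rw [if_pos h3]
    refine ⟨fun k hk => ?_, fun h => by cases h⟩
    cases hk
    simpa [armSign] using g1 h3
  rw [if_neg h3]
  by_cases h4 : S.stat b (fun l => (ω l).1) (fun l => (ω l).2 (a l))
      (cellPt (S.w (b + 1)) x) < -S.θ (b + 1)
  · rw [if_pos h4]
    refine ⟨fun k hk => ?_, fun h => by cases h⟩
    cases hk
    simpa [armSign] using g2 h4
  rw [if_neg h4]
  exact ⟨fun k hk => (by cases hk), fun _ hxs => g3 hxs (not_lt.1 h4) (not_lt.1 h3)⟩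

/-- On the good event a selected arm is better by a margin, and the gap is small on undecided
cells. -/
lemma state_correct {c : ClassConstants} (hc : c.Good) {E : Environment c.d}
    (hE : BoundedDensity c E) (hH : HolderSmooth c E) {S : Schedule} {T K : ℕ}
    (hS : S.Admissible c T K) {ω : Path c.d T} {a : Fin T → Arm}
    (ha : ∀ t : Fin T, a t = (S.state (fun l => (ω l).1) (fun l => (ω l).2 (a l)) (S.batchOf K t)
        (cellPt (S.w (S.batchOf K t)) (ω t).1)).getD (parityArm t))
    (hω : ω ∈ E.goodEvent S T K) {b : ℕ} (hb : 1 ≤ b) (hbK : b < K) {x : Ctx c.d}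
    (hx : x ∈ cube c.d) :
    (∀ k, S.state (fun l => (ω l).1) (fun l => (ω l).2 (a l)) b (cellPt (S.w b) x) = some k →
      gapOsc c * S.w b ^ c.β ≤ armSign k * E.gap x) ∧
    (S.state (fun l => (ω l).1) (fun l => (ω l).2 (a l)) b (cellPt (S.w b) x) = none →
      x ∈ E.ctxLaw.support → |E.gap x| ≤ gapBound c * S.w b ^ c.β) := by
  have hΛ := gapOsc_pos hc
  obtain ⟨b, rfl⟩ : ∃ b', b = b' + 1 := ⟨b - 1, by omega⟩
  induction b generalizing x with
  | zero =>
    exact state_correct_step hc hE hH hS ha hω hbK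
      (fun y _ k hk => absurd hk (by simp [Schedule.state])) hx
  | succ b ih =>
    refine state_correct_step hc hE hH hS ha hω hbK (fun y hy k hk => ?_) hx
    have h1 := (ih (hb := by omega) (hbK := by omega) (hx := hy)).1 k hk
    have h2 := hS.halve (b + 1) (by omega) hbK
    nlinarith

/-! ### The regret of successive elimination -/

lemma measurable_testVar {d : ℕ} (w : ℝ) (z : Ctx d) (l : ℕ) :
    Measurable (testVar w z l : Outcome d → ℝ) := by
  have : (testVar w z l : Outcome d → ℝ) = (Prod.fst ⁻¹' region w z).indicator
      (fun o : Outcome d => roundSign l * o.2 (parityArm l)) := by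
    funext o; rfl
  rw [this]
  exact ((by fun_prop : Measurable fun o : Outcome d =>
    roundSign l * o.2 (parityArm l))).indicator (measurable_fst (measurableSet_region w z))

lemma Environment.abs_testVar_le {d : ℕ} (E : Environment d) (w : ℝ) (z : Ctx d) (l : ℕ) :
    ∀ᵐ o ∂E.law, |testVar w z l o| ≤ (Prod.fst ⁻¹' region w z).indicator (fun _ => (1 : ℝ)) o := by
  filter_upwards [E.reward_mem] with o ho
  unfold testVar
  by_cases h : o.1 ∈ region w z
  · have h1 : o ∈ Prod.fst ⁻¹' region w z := h
    rw [indicator_of_mem h, indicator_of_mem h1, abs_mul]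
    have h2 : |roundSign l| = 1 := by unfold roundSign; split_ifs <;> simp
    rw [h2, one_mul, abs_of_nonneg (ho _).1]
    exact (ho _).2
  · have h1 : o ∉ Prod.fst ⁻¹' region w z := h
    rw [indicator_of_notMem h, indicator_of_notMem h1, abs_zero]

lemma exists_finset_cellPt {d T : ℕ} {w : ℝ} (hw : 0 < w) (hT : 1 ≤ T * w) :
    ∃ Z : Finset (Ctx d), (∀ x ∈ cube d, cellPt w x ∈ Z) ∧ Z.card ≤ (T + 1) ^ d := by
  refine ⟨(Fintype.piFinset fun _ : Fin d => Finset.range (T + 1)).image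
    (fun n j => w * (n j : ℝ)), ?_, ?_⟩
  · intro x hx
    refine Finset.mem_image.2 ⟨fun j => ⌊x j / w⌋₊, ?_, rfl⟩
    rw [Fintype.mem_piFinset]
    intro j
    rw [Finset.mem_range, Nat.lt_succ_iff]
    refine Nat.floor_le_of_le ?_
    rw [div_le_iff₀ hw]
    exact (hx.2 j).trans hT
  · refine Finset.card_image_le.trans ?_
    rw [Fintype.card_piFinset]
    simp

/-- The probability of a large deviation of one test statistic. -/
lemma measure_stat_deviation_le {c : ClassConstants} (hc : c.Good) {E : Environment c.d}
    (hE : BoundedDensity c E) {S : Schedule} {T K : ℕ} (hT : 1 ≤ T) (hS : S.Admissible c T K)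
    {b : ℕ} (hbK : b + 1 < K) (z : Ctx c.d) :
    (Measure.pi fun _ : Fin T => E.law).real
      {ω | S.θ (b + 1) / 2 ≤ |∑ l ∈ S.batch T b, testVar (S.w (b + 1)) z l (ω l)
        - ∑ l ∈ S.batch T b, ∫ o, testVar (S.w (b + 1)) z l o ∂E.law|}
      ≤ 2 * ((T : ℝ) ^ (c.d + 4))⁻¹ := by
  have hw := hS.w_pos (b + 1) (by omega) hbK
  have hw' := hS.w_le (b + 1) (by omega) hbK
  have hbd := hS.bound_le (b + 1) (by omega) hbK
  have hth := hS.threshold b hbK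
  have hsm := hS.sample b hbK
  have hτ := hS.lt b (by omega)
  have hTb : S.τ (b + 1) ≤ T := by rw [← hS.last]; exact hS.mono (by omega) le_rfl
  set w := S.w (b + 1)
  have hΛ := gapOsc_pos hc
  have hwβ : 0 < w ^ c.β := Real.rpow_pos_of_pos hw _
  set V := c.cUp * 4 ^ c.d * w ^ c.d with hV
  set ε := gapOsc c * w ^ c.β with hε
  have hεpos : 0 < ε := by positivity
  have hε1 : ε ≤ 1 := by
    have := gapOsc_le_gapBound hc
    have h2 : ε ≤ gapBound c * w ^ c.β := by rw [hε]; gcongr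
    linarith [hc.δ₀_lt]
  have hb1 : ∀ l : Fin T, ∀ᵐ o ∂E.law, |testVar w z l o| ≤ 1 := fun l =>
    (E.abs_testVar_le w z l).mono fun o ho => ho.trans
      (indicator_le_self' (fun _ _ => zero_le_one) _)
  have hv : ∀ l : Fin T, ∫ o, testVar w z l o ^ 2 ∂E.law ≤ V := by
    intro l
    have h1 : ∫ o, testVar w z l o ^ 2 ∂E.law
        ≤ ∫ o, (Prod.fst ⁻¹' region w z).indicator (fun _ => (1 : ℝ)) o ∂E.law := by
      refine integral_mono_of_nonneg (Filter.Eventually.of_forall fun _ => sq_nonneg _)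
        ((integrable_const 1).indicator (measurable_fst (measurableSet_region w z))) ?_
      filter_upwards [E.abs_testVar_le w z l, hb1 l] with o h1 h2
      rw [← sq_abs]
      nlinarith [abs_nonneg (testVar w z l o)]
    refine h1.trans ?_
    rw [integral_indicator (measurable_fst (measurableSet_region w z)), setIntegral_const,
      smul_eq_mul, mul_one, ← E.ctxLaw_real_apply (measurableSet_region w z)]
    exact region_mass_le hc hE hw hw' z
  -- `ε / 2` minimizes the exponent: the threshold is `2 n ε V` and the variance proxy is `n V`
  have h := bernstein_pi E.law (S.batch T b) (fun l : Fin T => measurable_testVar w z l) hb1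
    (s := S.θ (b + 1) / 2) hv (l := ε / 2) (by positivity) (by linarith)
  refine h.trans ?_
  rw [S.card_batch hTb hτ.le]
  have hTpos : (0 : ℝ) < T := by exact_mod_cast hT
  have e1 : ((T : ℝ) ^ (c.d + 4))⁻¹ = Real.exp (-((c.d + 4) * Real.log T)) := by
    rw [Real.exp_neg]
    congr 1
    rw [mul_comm, Real.exp_mul, Real.exp_log hTpos]
    have : ((c.d : ℝ) + 4) = ((c.d + 4 : ℕ) : ℝ) := by push_cast; ring
    rw [this, Real.rpow_natCast]
  rw [e1]
  refine mul_le_mul_of_nonneg_left (Real.exp_le_exp.2 ?_) zero_le_two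
  have e2 : -(ε / 2 * (S.θ (b + 1) / 2)) + ((S.τ (b + 1) : ℝ) - S.τ b) * ((ε / 2) ^ 2 * V)
      = -(gapOsc c ^ 2 * c.cUp * 4 ^ c.d / 4 * ((S.τ (b + 1) : ℝ) - S.τ b) * (w ^ c.β) ^ 2
      * w ^ c.d) := by
    rw [hth, hε, hV]; ring
  rw [e2]
  linarith

lemma Schedule.Admissible.le_horizon {S : Schedule} {c : ClassConstants} {T K : ℕ}
    (hS : S.Admissible c T K) : K ≤ T := by
  have : ∀ b ≤ K, b ≤ S.τ b := by
    intro b hb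
    induction b with
    | zero => simp
    | succ b ih => have := ih (by omega); have := hS.lt b (by omega); omega
  have := this K le_rfl
  rwa [hS.last] at this

/-- The total contribution of the bad event to the regret is bounded. -/
lemma measure_compl_goodEvent_le {c : ClassConstants} (hc : c.Good) {E : Environment c.d}
    (hE : BoundedDensity c E) {S : Schedule} {T K : ℕ} (hT : 1 ≤ T) (hS : S.Admissible c T K) :
    T * (Measure.pi fun _ : Fin T => E.law).real (E.goodEvent S T K)ᶜ ≤ 2 ^ (c.d + 1) := by
  set P := Measure.pi fun _ : Fin T => E.law
  have hTpos : (1 : ℝ) ≤ T := by exact_mod_cast hT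
  have hZ : ∀ b : ℕ, ∃ Z : Finset (Ctx c.d), b + 1 < K →
      (∀ x ∈ cube c.d, cellPt (S.w (b + 1)) x ∈ Z) ∧ Z.card ≤ (T + 1) ^ c.d := by
    intro b
    by_cases hb : b + 1 < K
    · obtain ⟨Z, h⟩ := exists_finset_cellPt (d := c.d) (T := T) (hS.w_pos (b + 1) (by omega) hb)
        (hS.w_ge (b + 1) (by omega) hb)
      exact ⟨Z, fun _ => h⟩
    · exact ⟨∅, fun h => absurd h hb⟩
  choose Z hZ using hZ
  set B : ℕ → Ctx c.d → Set (Path c.d T) := fun b z =>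
    {ω | S.θ (b + 1) / 2 ≤ |∑ l ∈ S.batch T b, testVar (S.w (b + 1)) z l (ω l)
        - ∑ l ∈ S.batch T b, ∫ o, testVar (S.w (b + 1)) z l o ∂E.law|} with hB
  have hsub : (E.goodEvent S T K)ᶜ ⊆ ⋃ b ∈ Finset.range (K - 1), ⋃ z ∈ Z b, B b z := by
    intro ω hω
    simp only [Environment.goodEvent, mem_compl_iff, mem_ofPred_eq] at hω
    push Not at hω
    obtain ⟨b, hb, _, ⟨x, hx, rfl⟩, h⟩ := hω
    simp only [mem_iUnion]
    exact ⟨b, Finset.mem_range.2 (by omega), _, (hZ b hb).1 x hx, h⟩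
  have h1 : P.real (E.goodEvent S T K)ᶜ
      ≤ ∑ b ∈ Finset.range (K - 1), ∑ z ∈ Z b, P.real (B b z) := by
    refine (measureReal_mono hsub (measure_ne_top P _)).trans ((measureReal_biUnion_finset_le _ _).trans ?_)
    exact Finset.sum_le_sum fun b _ => measureReal_biUnion_finset_le _ _
  have h2 : ∀ b ∈ Finset.range (K - 1), ∑ z ∈ Z b, P.real (B b z)
      ≤ (T + 1) ^ c.d * (2 * ((T : ℝ) ^ (c.d + 4))⁻¹) := by
    intro b hb
    have hb' : b + 1 < K := by have := Finset.mem_range.1 hb; omega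
    refine (Finset.sum_le_sum fun z _ => measure_stat_deviation_le hc hE hT hS hb' z).trans ?_
    rw [Finset.sum_const, nsmul_eq_mul]
    have : ((Z b).card : ℝ) ≤ (T + 1) ^ c.d := by exact_mod_cast (hZ b hb').2
    gcongr
  have h3 : P.real (E.goodEvent S T K)ᶜ ≤ T * ((T + 1) ^ c.d * (2 * ((T : ℝ) ^ (c.d + 4))⁻¹)) := by
    refine h1.trans ((Finset.sum_le_sum h2).trans ?_)
    rw [Finset.sum_const, nsmul_eq_mul, Finset.card_range]
    have : ((K - 1 : ℕ) : ℝ) ≤ T := by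
      exact_mod_cast (Nat.sub_le _ _).trans hS.le_horizon
    gcongr
  calc T * P.real (E.goodEvent S T K)ᶜ
      ≤ T * (T * ((T + 1) ^ c.d * (2 * ((T : ℝ) ^ (c.d + 4))⁻¹))) := by gcongr
    _ ≤ T * (T * ((2 * T) ^ c.d * (2 * ((T : ℝ) ^ (c.d + 4))⁻¹))) := by
        gcongr; linarith
    _ = 2 ^ (c.d + 1) * (1 / (T : ℝ) ^ 2) := by
        have : (T : ℝ) ≠ 0 := by positivity
        rw [mul_pow]; field_simp; ring
    _ ≤ 2 ^ (c.d + 1) * 1 := by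
        gcongr
        rw [div_le_one (by positivity)]
        exact one_le_pow₀ hTpos
    _ = _ := mul_one _

/-- The contexts at which an undecided cell of batch `b` causes regret. -/
def Environment.smallGap {d : ℕ} (E : Environment d) (δ : ℝ) : Set (Ctx d) :=
  {x | x ∈ cube d ∧ 0 < |E.gap x| ∧ |E.gap x| ≤ δ}

lemma measurableSet_smallGap {c : ClassConstants} (hc : c.Good) {E : Environment c.d}
    (hH : HolderSmooth c E) (δ : ℝ) : MeasurableSet (E.smallGap δ) := by
  have hcont := hH.continuousOn_gap hc.d_pos hc.β_pos hc.β_le hc.L_pos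
  have hm : Measurable ((cube c.d).domRestrict E.gap) :=
    (continuousOn_iff_continuous_domRestrict.1 hcont).measurable
  have h1 : MeasurableSet {y : cube c.d | 0 < |(cube c.d).domRestrict E.gap y| ∧
      |(cube c.d).domRestrict E.gap y| ≤ δ} := by
    have := hm.abs
    exact (measurableSet_lt measurable_const this).inter (measurableSet_le this measurable_const)
  have h2 : E.smallGap δ = Subtype.val '' {y : cube c.d | 0 < |(cube c.d).domRestrict E.gap y| ∧
      |(cube c.d).domRestrict E.gap y| ≤ δ} := by
    ext x
    constructor
    · rintro ⟨h, h'⟩; exact ⟨⟨x, h⟩, h', rfl⟩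
    · rintro ⟨y, h, rfl⟩; exact ⟨y.2, h⟩
  rw [h2]
  exact (MeasurableEmbedding.subtype_coe (measurableSet_cube c.d)).measurableSet_image.2 h1

lemma Environment.instant_regret_le {d : ℕ} (E : Environment d) (x : Ctx d) (k : Arm) :
    max (E.f true x) (E.f false x) - E.f k x ≤ |E.gap x| ∧
    (0 ≤ armSign k * E.gap x → max (E.f true x) (E.f false x) - E.f k x ≤ 0) := by
  unfold Environment.gap armSign
  constructor
  · rw [sub_le_iff_le_add]
    refine max_le ?_ ?_ <;> cases k <;>
      linarith [le_abs_self (E.f true x - E.f false x), neg_le_abs (E.f true x - E.f false x),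
        abs_nonneg (E.f true x - E.f false x)]
  · intro h
    cases k
    · simp only [Bool.false_eq_true, if_false] at h
      rw [sub_nonpos]; exact max_le (by linarith) le_rfl
    · simp only [if_true] at h
      rw [sub_nonpos]; exact max_le le_rfl (by linarith)

/-- A bound on the expected regret in a round of batch `b`, on the good event. -/
noncomputable def roundBound (c : ClassConstants) (S : Schedule) (α : ℝ≥0∞) (b : ℕ) : ℝ :=
  if b = 0 then 1 else gapBound c * S.w b ^ c.β * (c.D₀ * marginPow (gapBound c * S.w b ^ c.β) α)

lemma marginPow_nonneg {δ : ℝ} (hδ : 0 ≤ δ) (α : ℝ≥0∞) : 0 ≤ marginPow δ α := by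
  unfold marginPow; split_ifs
  · exact le_rfl
  · positivity

lemma roundBound_nonneg {c : ClassConstants} (hc : c.Good) {S : Schedule} {T K : ℕ}
    (hS : S.Admissible c T K) (α : ℝ≥0∞) {b : ℕ} (hb : b < K) : 0 ≤ roundBound c S α b := by
  unfold roundBound
  split_ifs with h
  · exact zero_le_one
  · have h1 := hS.w_pos b (by omega) hb
    have h2 := (gapOsc_pos hc).trans_le (gapOsc_le_gapBound hc)
    have h3 : 0 ≤ gapBound c * S.w b ^ c.β := by positivity
    have h4 := marginPow_nonneg h3 α
    have := hc.D₀_pos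
    positivity

/-- The regret of the elimination rule. On the good event, a round causes regret only if its batch is
the first one, or if its context lies in an undecided cell and has a small nonzero gap. -/
lemma regret_le_sum_roundBound {c : ClassConstants} (hc : c.Good) {α : ℝ≥0∞} {E : Environment c.d}
    (hE : E ∈ envClass c α) {S : Schedule} {T M K : ℕ} (hT : 1 ≤ T) (hS : S.Admissible c T K)
    (π : BatchPolicy c.d T M)
    (hπ : ∀ (t : Fin T) (ω : Path c.d T),
      π.arm t ω = (S.state (fun l => (ω l).1) (fun l => (ω l).2 (π.arm l ω)) (S.batchOf K t)
        (cellPt (S.w (S.batchOf K t)) (ω t).1)).getD (parityArm t)) :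
    regret π E ≤ ENNReal.ofReal (2 ^ (c.d + 1) +
      ∑ b ∈ Finset.range K, ((S.τ (b + 1) : ℝ) - S.τ b) * roundBound c S α b) := by
  obtain ⟨hD, hH, hM⟩ := hE
  set P := Measure.pi fun _ : Fin T => E.law with hP
  -- a measurable superset, because the good event concerns uncountably many contexts
  set bad := toMeasurable P (E.goodEvent S T K)ᶜ with hbad
  set ε : ℕ → ℝ := fun b => gapBound c * S.w b ^ c.β with hε
  have hΛ := (gapOsc_pos hc).trans_le (gapOsc_le_gapBound hc)
  have hb : ∀ t : Fin T, S.batchOf K t < K := fun t =>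
    (S.batchOf_spec hS.zero (by rw [hS.last]; exact t.2)).1
  have hεpos : ∀ b, 1 ≤ b → b < K → 0 < ε b := fun b h1 h2 => by
    have := hS.w_pos b h1 h2
    simp only [hε]; positivity
  -- the pointwise bound in round `t`
  set h : Fin T → Outcome c.d → ℝ≥0∞ := fun t o =>
    if S.batchOf K t = 0 then 1 else
      (Prod.fst ⁻¹' E.smallGap (ε (S.batchOf K t))).indicator
        (fun _ => ENNReal.ofReal (ε (S.batchOf K t))) o with hh
  have hmeas : ∀ t, Measurable (h t) := by
    intro t
    simp only [hh]
    split_ifs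
    · exact measurable_const
    · exact measurable_const.indicator (measurable_fst (measurableSet_smallGap hc hH _))
  have hae : ∀ᵐ ω ∂P, ∀ t : Fin T, (ω t).1 ∈ cube c.d ∧ (ω t).1 ∈ E.ctxLaw.support ∧
      ∀ k, E.f k (ω t).1 ∈ Icc (0 : ℝ) 1 := by
    rw [ae_all_iff]
    intro t
    have h1 : ∀ᵐ o ∂E.law, o.1 ∈ cube c.d ∧ o.1 ∈ E.ctxLaw.support ∧
        ∀ k, E.f k o.1 ∈ Icc (0 : ℝ) 1 := by
      filter_upwards [E.ctx_mem, E.ctxLaw_ae (Measure.support_mem_ae (μ := E.ctxLaw)), E.f_mem]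
        with o a b c using ⟨a, b, c⟩
    exact (measurePreserving_eval (fun _ : Fin T => E.law) t).quasiMeasurePreserving.ae h1
  have hpt : ∀ᵐ ω ∂P, ∀ t : Fin T,
      ENNReal.ofReal (max (E.f true (ω t).1) (E.f false (ω t).1) - E.f (π.arm t ω) (ω t).1)
        ≤ bad.indicator (fun _ => 1) ω + h t (ω t) := by
    filter_upwards [hae] with ω hω t
    obtain ⟨hx, hxs, hf⟩ := hω t
    have hle1 : ENNReal.ofReal
        (max (E.f true (ω t).1) (E.f false (ω t).1) - E.f (π.arm t ω) (ω t).1) ≤ 1 := by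
      rw [← ENNReal.ofReal_one]
      refine ENNReal.ofReal_le_ofReal ?_
      have := max_le (hf true).2 (hf false).2
      linarith [(hf (π.arm t ω)).1]
    by_cases hg : ω ∈ E.goodEvent S T K
    · refine le_add_left ?_
      by_cases hb0 : S.batchOf K t = 0
      · simp only [hh, if_pos hb0]; exact hle1
      · obtain ⟨c1, c2⟩ := state_correct hc hD hH hS (fun t => hπ t ω) hg
          (b := S.batchOf K t) (by omega) (hb t) hx
        simp only [hh, if_neg hb0]
        obtain ⟨r1, r2⟩ := E.instant_regret_le (ω t).1 (π.arm t ω)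
        rcases hst : S.state (fun l => (ω l).1) (fun l => (ω l).2 (π.arm l ω)) (S.batchOf K t)
          (cellPt (S.w (S.batchOf K t)) (ω t).1) with _ | k
        · have hgap := c2 hst hxs
          by_cases h0 : |E.gap (ω t).1| = 0
          · rw [ENNReal.ofReal_eq_zero.2 (by linarith)]; exact zero_le
          · have hmem : ω t ∈ Prod.fst ⁻¹' E.smallGap (ε (S.batchOf K t)) :=
              ⟨hx, lt_of_le_of_ne (abs_nonneg _) (Ne.symm h0), hgap⟩
            rw [indicator_of_mem hmem]
            exact ENNReal.ofReal_le_ofReal (r1.trans hgap)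
        · have hk : π.arm t ω = k := by rw [hπ t ω, hst]; rfl
          have h3 := c1 k hst
          have h4 := hS.w_pos _ (by omega) (hb t)
          have h5 := gapOsc_pos hc
          have h6 : 0 ≤ gapOsc c * S.w (S.batchOf K t) ^ c.β := by positivity
          rw [ENNReal.ofReal_eq_zero.2 (r2 (by rw [hk]; linarith))]; exact zero_le
    · refine le_add_right ?_
      rw [indicator_of_mem (subset_toMeasurable P _ hg)]
      exact hle1
  have hint : ∀ t, ∫⁻ ω, h t (ω t) ∂P ≤ ENNReal.ofReal (roundBound c S α (S.batchOf K t)) := by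
    intro t
    have h1 : ∫⁻ ω, h t (ω t) ∂P = ∫⁻ o, h t o ∂E.law :=
      (measurePreserving_eval (fun _ : Fin T => E.law) t).lintegral_comp (hmeas t)
    rw [h1]
    unfold roundBound
    by_cases hb0 : S.batchOf K t = 0
    · simp [hh, hb0]
    · simp only [hh, if_neg hb0]
      rw [lintegral_indicator (measurable_fst (measurableSet_smallGap hc hH _)),
        setLIntegral_const, ENNReal.ofReal_mul (hεpos _ (by omega) (hb t)).le]
      refine mul_le_mul_right ?_ _
      rw [← ENNReal.ofReal_toReal (measure_ne_top E.law _)]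
      refine ENNReal.ofReal_le_ofReal ?_
      change E.law.real _ ≤ _
      rw [← E.ctxLaw_real_apply (measurableSet_smallGap hc hH _)]
      refine le_trans ?_ (hM (ε (S.batchOf K t)) (hεpos _ (by omega) (hb t)).le
        (hS.bound_le _ (by omega) (hb t)))
      exact measureReal_mono fun x hx => hx.2
  have hreg : regret π E ≤ ∑ t : Fin T, (P bad + ENNReal.ofReal (roundBound c S α (S.batchOf K t))) := by
    unfold regret
    calc _ ≤ ∫⁻ ω, ∑ t : Fin T, (bad.indicator (fun _ => 1) ω + h t (ω t)) ∂P :=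
          lintegral_mono_ae (hpt.mono fun ω hω => Finset.sum_le_sum fun t _ => hω t)
      _ = ∑ t : Fin T, ∫⁻ ω, (bad.indicator (fun _ => 1) ω + h t (ω t)) ∂P :=
          lintegral_finsetSum _ fun t _ =>
            (measurable_const.indicator (measurableSet_toMeasurable _ _)).add
              ((hmeas t).comp (measurable_pi_apply t))
      _ ≤ _ := by
          refine Finset.sum_le_sum fun t _ => ?_
          rw [lintegral_add_left (measurable_const.indicator (measurableSet_toMeasurable _ _)),
            lintegral_indicator (measurableSet_toMeasurable _ _), setLIntegral_const, one_mul]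
          gcongr
          exact hint t
  refine hreg.trans ?_
  have hPbad : P bad = ENNReal.ofReal (P.real (E.goodEvent S T K)ᶜ) := by
    rw [hbad, measure_toMeasurable, measureReal_def, ENNReal.ofReal_toReal (measure_ne_top P _)]
  have hnn : ∀ t : Fin T, 0 ≤ roundBound c S α (S.batchOf K t) :=
    fun t => roundBound_nonneg hc hS α (hb t)
  rw [hPbad]
  simp_rw [← ENNReal.ofReal_add measureReal_nonneg (hnn _)]
  rw [← ENNReal.ofReal_sum_of_nonneg fun t _ => add_nonneg measureReal_nonneg (hnn t)]
  refine ENNReal.ofReal_le_ofReal ?_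
  rw [Finset.sum_add_distrib]
  refine add_le_add ?_ ?_
  · simp only [Finset.sum_const, Finset.card_univ, Fintype.card_fin, nsmul_eq_mul]
    exact measure_compl_goodEvent_le hc hD hT hS
  · rw [← Finset.sum_fiberwise_of_maps_to (g := fun t : Fin T => S.batchOf K t)
      (t := Finset.range K) (fun t _ => Finset.mem_range.2 (hb t))]
    refine le_of_eq (Finset.sum_congr rfl fun b hbK => ?_)
    have hbK' := Finset.mem_range.1 hbK
    have hfil : (Finset.univ.filter fun t : Fin T => S.batchOf K t = b) = S.batch T b := by
      ext t
      simp only [Schedule.batch, Finset.mem_filter, Finset.mem_univ, true_and]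
      constructor
      · rintro rfl
        exact (S.batchOf_spec hS.zero (by rw [hS.last]; exact t.2)).2
      · rintro ⟨h1, h2⟩
        exact hS.batchOf_eq hbK' h1 h2
    rw [Finset.sum_congr rfl (fun t ht => by rw [(Finset.mem_filter.1 ht).2]), Finset.sum_const,
      hfil, nsmul_eq_mul, S.card_batch (by rw [← hS.last]; exact hS.mono hbK' le_rfl)
      (hS.lt b hbK').le]

/-! ### The batch grid -/

/-- The points `r b = κ log T · T ^ (1 - g ^ b)` satisfy `r (b + 1) ≲ (log T · T) ^ (1 - g) * r b ^ g`,
and come within a factor of order `(log T) ^ (1 / g)` of `T` after `O(log log T)` steps. -/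
lemma exists_real_grid {g A κ : ℝ} (hg0 : 0 < g) (hg1 : g < 1) (hA : 2 ≤ A) (hκ : 1 ≤ κ) :
    ∃ B : ℝ, 1 ≤ B ∧ ∀ T : ℕ, 1 ≤ Real.log (Real.log T) → B * Real.log T ≤ T →
      ∃ (J : ℕ) (r : ℕ → ℝ), (J : ℝ) ≤ 1 / Real.log (1 / g) * Real.log (Real.log T) ∧
        r 0 = κ * Real.log T ∧ (∀ b, 1 ≤ r b) ∧ (∀ b ≤ J, 2 * A * r b ≤ r (b + 1)) ∧
        4 * r J < T ∧
        (∀ b, 4 * r (b + 1) ≤ B * (Real.log T) ^ (1 - g) * (T : ℝ) ^ (1 - g) * (r b) ^ g) ∧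
        T ≤ B * (Real.log T) ^ (1 - g) * (T : ℝ) ^ (1 - g) * (r J) ^ g := by
  set B := max (5 * κ) ((2 * A) ^ (1 / (1 - g))) with hB
  have hB5 : 5 * κ ≤ B := le_max_left _ _
  have hB1 : 1 ≤ B := by linarith
  refine ⟨B, hB1, fun T hT hBT => ?_⟩
  set ℓ := Real.log T with hℓ
  have h1g : 0 < 1 - g := by linarith
  have hℓe : 1 < ℓ := by
    by_contra! h
    rcases le_or_gt 0 ℓ with h0 | h0
    · have := Real.log_nonpos h0 h; linarith
    · have : 0 ≤ ℓ := Real.log_natCast_nonneg T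
      linarith
  have hℓ0 : 0 < ℓ := by linarith
  have hT1 : (1 : ℝ) < T := by nlinarith
  have hT0 : (0 : ℝ) < T := by linarith
  have hTexp : ∀ x : ℝ, (T : ℝ) ^ x = Real.exp (ℓ * x) := fun x => Real.rpow_def_of_pos hT0 x
  have hBℓ : 1 < B * ℓ := by nlinarith
  have hlogB : Real.log ℓ ≤ Real.log (B * ℓ) := Real.log_le_log hℓ0 (by nlinarith)
  have hx0 : 0 < Real.log (B * ℓ) / ℓ := div_pos (Real.log_pos hBℓ) hℓ0
  have hx1 : Real.log (B * ℓ) / ℓ ≤ 1 := by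
    rw [div_le_one hℓ0]; exact Real.log_le_log (by linarith) hBT
  obtain ⟨J, hJ1, hJ2⟩ := exists_nat_pow_near_of_lt_one hx0 hx1 hg0 hg1
  rw [lt_div_iff₀ hℓ0] at hJ1
  rw [div_le_iff₀ hℓ0] at hJ2
  have hgB : ∀ b ≤ J, B * ℓ ≤ (T : ℝ) ^ (g ^ b) := by
    intro b hb
    rw [hTexp, ← Real.log_le_iff_le_exp (by linarith)]
    have : g ^ J ≤ g ^ b := pow_le_pow_of_le_one hg0.le hg1.le hb
    nlinarith
  have hgB' : (T : ℝ) ^ (g ^ (J + 1)) ≤ B * ℓ := by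
    rw [hTexp, ← Real.le_log_iff_exp_le (by linarith)]
    linarith
  set r : ℕ → ℝ := fun b => κ * ℓ * (T : ℝ) ^ (1 - g ^ b) with hr
  have hr1 : ∀ b, 1 ≤ r b := by
    intro b
    have h1 : (1 : ℝ) ≤ (T : ℝ) ^ (1 - g ^ b) :=
      Real.one_le_rpow hT1.le (by have := pow_le_one₀ (n := b) hg0.le hg1.le; linarith)
    have h2 : 1 ≤ κ * ℓ := by nlinarith
    calc (1 : ℝ) = 1 * 1 := by ring
      _ ≤ _ := mul_le_mul h2 h1 zero_le_one (by linarith)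
  -- consecutive end points of the grid grow by a factor `T ^ (g ^ b * (1 - g)) ≥ 2 * A`
  have hratio : ∀ b ≤ J, 2 * A * r b ≤ r (b + 1) := by
    intro b hb
    have e : r (b + 1) = ((T : ℝ) ^ (g ^ b)) ^ (1 - g) * r b := by
      simp only [hr]
      rw [← Real.rpow_mul hT0.le, mul_left_comm, ← Real.rpow_add hT0]
      congr 2; rw [pow_succ]; ring
    rw [e]
    refine mul_le_mul_of_nonneg_right ?_ (by linarith [hr1 b])
    calc 2 * A = ((2 * A) ^ (1 / (1 - g))) ^ (1 - g) := by
          rw [← Real.rpow_mul (by linarith), one_div_mul_cancel h1g.ne', Real.rpow_one]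
      _ ≤ ((T : ℝ) ^ (g ^ b)) ^ (1 - g) := by
          refine Real.rpow_le_rpow (by positivity) ?_ h1g.le
          refine (le_max_right (5 * κ) _).trans (le_trans ?_ (hgB b hb))
          show B ≤ B * ℓ
          nlinarith
  have hrg : ∀ b, (T : ℝ) ^ (1 - g) * (r b) ^ g = (κ * ℓ) ^ g * (T : ℝ) ^ (1 - g ^ (b + 1)) := by
    intro b
    simp only [hr]
    rw [Real.mul_rpow (by positivity) (by positivity), ← Real.rpow_mul hT0.le, mul_left_comm,
      ← Real.rpow_add hT0]
    congr 2; rw [pow_succ]; ring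
  have hκg : κ * ℓ ≤ κ * ℓ ^ (1 - g) * (κ * ℓ) ^ g := by
    have h1 : ℓ ^ (1 - g) * ℓ ^ g = ℓ := by
      rw [← Real.rpow_add hℓ0]; simp
    rw [Real.mul_rpow (by linarith) hℓ0.le]
    calc κ * ℓ = κ * (ℓ ^ (1 - g) * ℓ ^ g) * 1 := by rw [h1]; ring
      _ ≤ κ * (ℓ ^ (1 - g) * ℓ ^ g) * κ ^ g := by
          gcongr; exact Real.one_le_rpow hκ hg0.le
      _ = _ := by ring
  have hrw : ∀ b, B * ℓ ^ (1 - g) * (T : ℝ) ^ (1 - g) * (r b) ^ g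
      = B * ℓ ^ (1 - g) * (κ * ℓ) ^ g * (T : ℝ) ^ (1 - g ^ (b + 1)) := by
    intro b
    rw [mul_assoc (B * ℓ ^ (1 - g)), hrg]; ring
  refine ⟨J, r, ?_, ?_, hr1, hratio, ?_, ?_, ?_⟩
  · have hlog : 0 < Real.log (1 / g) := Real.log_pos (by rw [lt_div_iff₀ hg0]; linarith)
    have h1 : J * Real.log (1 / g) ≤ Real.log ℓ := by
      have h2 : (1 / g) ^ J ≤ ℓ := by
        rw [one_div, inv_pow, inv_le_iff_one_le_mul₀ (pow_pos hg0 J)]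
        nlinarith
      have := Real.log_le_log (by positivity) h2
      rwa [Real.log_pow] at this
    rw [one_div, inv_mul_eq_div, le_div_iff₀ hlog]; exact h1
  · simp [hr]
  · have e : r J * (T : ℝ) ^ (g ^ J) = κ * ℓ * T := by
      simp only [hr]
      rw [mul_assoc, ← Real.rpow_add hT0]; simp
    have h5 := hgB J le_rfl
    have h0 := hr1 J
    have h6 : r J * (B * ℓ) ≤ κ * ℓ * T := by rw [← e]; gcongr
    have h7 : r J * (5 * κ) * ℓ ≤ κ * T * ℓ := by
      have : r J * (5 * κ) * ℓ ≤ r J * B * ℓ := by gcongr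
      linarith
    have h8 : r J * (5 * κ) ≤ κ * T := le_of_mul_le_mul_right h7 hℓ0
    have h9 : r J * 5 ≤ T := by
      refine le_of_mul_le_mul_left (a := κ) ?_ (by linarith)
      linarith
    linarith
  · intro b
    rw [hrw]
    have h5 : 4 * (κ * ℓ) ≤ B * ℓ ^ (1 - g) * (κ * ℓ) ^ g := by
      have h6 : 0 ≤ ℓ ^ (1 - g) * (κ * ℓ) ^ g := by positivity
      have h7 : 4 * κ * (ℓ ^ (1 - g) * (κ * ℓ) ^ g) ≤ B * (ℓ ^ (1 - g) * (κ * ℓ) ^ g) := by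
        gcongr; linarith
      linarith
    simp only [hr]
    rw [← mul_assoc]
    gcongr
  · rw [hrw]
    have e : (T : ℝ) = (T : ℝ) ^ (g ^ (J + 1)) * (T : ℝ) ^ (1 - g ^ (J + 1)) := by
      rw [← Real.rpow_add hT0]; simp
    have h5 : (T : ℝ) ^ (g ^ (J + 1)) ≤ B * ℓ ^ (1 - g) * (κ * ℓ) ^ g := by
      refine hgB'.trans ?_
      have h6 : ℓ ≤ ℓ ^ (1 - g) * (κ * ℓ) ^ g := by
        have : κ * ℓ ≤ κ * (ℓ ^ (1 - g) * (κ * ℓ) ^ g) := by linarith [hκg]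
        exact le_of_mul_le_mul_left this (by linarith)
      calc B * ℓ ≤ B * (ℓ ^ (1 - g) * (κ * ℓ) ^ g) := by gcongr
        _ = _ := by ring
    conv_lhs => rw [e]
    gcongr

/-- The grid of the policy: it has `O(log log T)` batches with
`τ (b + 1) ≲ (log T · T) ^ (1 - g) * τ b ^ g`. -/
lemma exists_base_grid {g A κ : ℝ} (hg0 : 0 < g) (hg1 : g < 1) (hA : 2 ≤ A) (hκ : 1 ≤ κ) :
    ∃ B : ℝ, 1 ≤ B ∧ ∀ T : ℕ, 1 ≤ Real.log (Real.log T) → B * Real.log T ≤ T →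
      ∃ (K : ℕ) (τ : ℕ → ℕ), 1 ≤ K ∧ (K : ℝ) ≤ (2 + 1 / Real.log (1 / g)) * Real.log (Real.log T) ∧
        τ 0 = 0 ∧ τ K = T ∧ (∀ b < K, τ b < τ (b + 1)) ∧ (∀ b < K, Even (τ b)) ∧
        2 * κ * Real.log T ≤ τ 1 ∧ (τ 1 : ℝ) ≤ 4 * κ * Real.log T ∧
        (∀ b, 1 ≤ b → b + 1 < K → A * τ b ≤ τ (b + 1)) ∧
        (∀ b, 1 ≤ b → b < K → (τ (b + 1) : ℝ) ≤
          B * (Real.log T) ^ (1 - g) * (T : ℝ) ^ (1 - g) * (τ b : ℝ) ^ g) := by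
  obtain ⟨B, hB1, H⟩ := exists_real_grid hg0 hg1 hA hκ
  refine ⟨B, hB1, fun T hT hBT => ?_⟩
  obtain ⟨J, r, hJ, hr0, hr1, hratio, hlast, hrec, hrecT⟩ := H T hT hBT
  have hℓ0 : 0 ≤ Real.log T := Real.log_natCast_nonneg T
  have hc1 : ∀ b, 2 * r b ≤ ((2 * ⌈r b⌉₊ : ℕ) : ℝ) := by
    intro b; push_cast; linarith [Nat.le_ceil (r b)]
  have hc2 : ∀ b, ((2 * ⌈r b⌉₊ : ℕ) : ℝ) ≤ 4 * r b := by
    intro b; push_cast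
    linarith [Nat.ceil_lt_add_one (by linarith [hr1 b] : 0 ≤ r b), hr1 b]
  set τ : ℕ → ℕ := fun b => if b = 0 then 0 else if b ≤ J + 1 then 2 * ⌈r (b - 1)⌉₊ else T with hτ
  have hτ0 : τ 0 = 0 := by simp [hτ]
  have hτs : ∀ b ≤ J, τ (b + 1) = 2 * ⌈r b⌉₊ := by
    intro b hb
    simp only [hτ, Nat.succ_ne_zero, if_false, if_pos (show b + 1 ≤ J + 1 by omega),
      Nat.add_sub_cancel]
  have hτT : τ (J + 2) = T := by simp [hτ]
  refine ⟨J + 2, τ, by omega, ?_, hτ0, hτT, ?_, ?_, ?_, ?_, ?_, ?_⟩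
  · push_cast
    linarith
  · intro b hb
    rcases Nat.eq_zero_or_pos b with rfl | hb0
    · rw [hτ0, hτs 0 (by omega)]
      have := Nat.ceil_pos.2 (by linarith [hr1 0] : 0 < r 0)
      omega
    obtain ⟨b, rfl⟩ : ∃ b', b = b' + 1 := ⟨b - 1, by omega⟩
    have h0 := hr1 b
    rw [hτs b (by omega)]
    by_cases h2 : b + 1 ≤ J
    · rw [hτs (b + 1) h2]
      have h3 := hratio b (by omega)
      have h4 : ((2 * ⌈r b⌉₊ : ℕ) : ℝ) < ((2 * ⌈r (b + 1)⌉₊ : ℕ) : ℝ) := by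
        have := hc1 (b + 1); have := hc2 b; nlinarith
      exact_mod_cast h4
    · have hbJ : b = J := by omega
      subst hbJ
      rw [hτT]
      have h5 : ((2 * ⌈r b⌉₊ : ℕ) : ℝ) < T := (hc2 b).trans_lt hlast
      exact_mod_cast h5
  · intro b hb
    rcases Nat.eq_zero_or_pos b with rfl | hb0
    · rw [hτ0]; exact Even.zero
    obtain ⟨b, rfl⟩ : ∃ b', b = b' + 1 := ⟨b - 1, by omega⟩
    rw [hτs b (by omega)]
    exact even_two_mul _
  · rw [hτs 0 (by omega)]
    refine le_trans (le_of_eq ?_) (hc1 0)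
    rw [hr0]; ring
  · rw [hτs 0 (by omega)]
    refine (hc2 0).trans (le_of_eq ?_)
    rw [hr0]; ring
  · intro b hb1 hb2
    obtain ⟨b, rfl⟩ : ∃ b', b = b' + 1 := ⟨b - 1, by omega⟩
    rw [hτs b (by omega), hτs (b + 1) (by omega)]
    have h1 := hratio b (by omega)
    have h2 := hc1 (b + 1)
    have h3 : A * ((2 * ⌈r b⌉₊ : ℕ) : ℝ) ≤ A * (4 * r b) := by
      gcongr; exact hc2 b
    linarith
  · intro b hb1 hb2
    obtain ⟨b, rfl⟩ : ∃ b', b = b' + 1 := ⟨b - 1, by omega⟩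
    rw [hτs b (by omega)]
    have h3 : (r b) ^ g ≤ ((2 * ⌈r b⌉₊ : ℕ) : ℝ) ^ g :=
      Real.rpow_le_rpow (by linarith [hr1 b]) (by linarith [hc1 b, hr1 b]) hg0.le
    have h4 : B * (Real.log T) ^ (1 - g) * (T : ℝ) ^ (1 - g) * (r b) ^ g
        ≤ B * (Real.log T) ^ (1 - g) * (T : ℝ) ^ (1 - g) * ((2 * ⌈r b⌉₊ : ℕ) : ℝ) ^ g := by
      gcongr
    refine le_trans ?_ h4
    by_cases h2 : b + 1 ≤ J
    · rw [hτs (b + 1) h2]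
      exact (hc2 _).trans (hrec b)
    · have hbJ : b = J := by omega
      subst hbJ
      rw [hτT]
      exact hrecT

/-! ### The rate of successive elimination -/

/-- The exponent `γ` of the minimax rate `T ^ (1 - γ)` for the margin parameter `a`. -/
noncomputable def rateExp (c : ClassConstants) (a : ℝ) : ℝ := c.β * (1 + a) / (2 * c.β + c.d)

/-- The multiple of `log T / n` which is `w ^ (2 β + d)` for the cell side `w` that belongs to a
batch of size `n`. -/
noncomputable def sideConst (c : ClassConstants) : ℝ :=
  max ((c.d + 4) / (gapOsc c ^ 2 * c.cUp * 4 ^ c.d / 4)) 1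

/-- The schedule on the grid `τ`: the cell side of batch `b + 1` balances the oscillation of the gap
on a cell against the statistical error of batch `b`. -/
noncomputable def gridSchedule (c : ClassConstants) (T : ℕ) (τ : ℕ → ℕ) : Schedule where
  τ := τ
  w b := (sideConst c * Real.log T / ((τ b : ℝ) - τ (b - 1))) ^ (1 / (2 * c.β + c.d))
  θ b := 2 * gapOsc c * c.cUp * 4 ^ c.d * ((τ b : ℝ) - τ (b - 1)) *
    ((sideConst c * Real.log T / ((τ b : ℝ) - τ (b - 1))) ^ (1 / (2 * c.β + c.d))) ^ c.β *
    ((sideConst c * Real.log T / ((τ b : ℝ) - τ (b - 1))) ^ (1 / (2 * c.β + c.d))) ^ c.d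

lemma ClassConstants.Good.exponent_pos {c : ClassConstants} (hc : c.Good) :
    1 ≤ 2 * c.β + c.d := by
  have : (1 : ℝ) ≤ c.d := by exact_mod_cast hc.d_pos
  linarith [hc.β_pos]

/-- An upper bound on the cell sides which keeps the balls in the range of the density condition and
the gaps of undecided cells in the range of the margin condition. -/
noncomputable def maxSide (c : ClassConstants) : ℝ :=
  min (1 / 4) ((c.δ₀ / gapBound c) ^ (1 / c.β))

lemma gapBound_pos {c : ClassConstants} (hc : c.Good) : 0 < gapBound c :=
  (gapOsc_pos hc).trans_le (gapOsc_le_gapBound hc)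

lemma maxSide_pos {c : ClassConstants} (hc : c.Good) : 0 < maxSide c := by
  have := gapBound_pos hc
  have := hc.δ₀_pos
  unfold maxSide
  exact lt_min (by norm_num) (by positivity)

lemma gridSchedule_admissible {c : ClassConstants} (hc : c.Good) {T K : ℕ} {τ : ℕ → ℕ}
    (hT : 1 ≤ Real.log T) (h0 : τ 0 = 0) (hK : τ K = T) (hlt : ∀ b < K, τ b < τ (b + 1))
    (heven : ∀ b < K, Even (τ b))
    (h1 : 2 * (sideConst c / maxSide c ^ (2 * c.β + c.d)) * Real.log T ≤ τ 1)
    (hA : ∀ b, 1 ≤ b → b + 1 < K →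
      (1 + 2 ^ ((2 * c.β + c.d) / c.β)) * (τ b : ℝ) ≤ τ (b + 1)) :
    (gridSchedule c T τ).Admissible c T K := by
  have hp := hc.exponent_pos
  have hβ := hc.β_pos
  have hΛ := gapOsc_pos hc
  have hU := hc.cUp_pos
  set p := 2 * c.β + c.d with hpdef
  set ℓ := Real.log T with hℓ
  have hT0 : (1 : ℝ) ≤ T := by
    rcases Nat.eq_zero_or_pos T with rfl | h
    · simp [hℓ] at hT; linarith
    · exact_mod_cast h
  have hmono : ∀ j ≤ K, ∀ i ≤ j, τ i ≤ τ j := by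
    intro j hj i hij
    induction j, hij using Nat.le_induction with
    | base => exact le_rfl
    | succ j _ ih => exact (ih (by omega)).trans (hlt j (by omega)).le
  have hS1 : 1 ≤ sideConst c := le_max_right _ _
  set n : ℕ → ℝ := fun b => (τ b : ℝ) - τ (b - 1) with hn
  have hn0 : ∀ b, 1 ≤ b → b ≤ K → 0 < n b := by
    intro b hb hbK
    obtain ⟨b, rfl⟩ : ∃ b', b = b' + 1 := ⟨b - 1, by omega⟩
    have : (τ b : ℝ) < τ (b + 1) := by exact_mod_cast hlt b (by omega)
    simp only [hn, Nat.add_sub_cancel]; linarith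
  have hnT : ∀ b, b ≤ K → n b ≤ T := by
    intro b hbK
    have h1 : (τ b : ℝ) ≤ T := by rw [← hK]; exact_mod_cast hmono K le_rfl b hbK
    have h2 : (0 : ℝ) ≤ τ (b - 1) := Nat.cast_nonneg _
    simp only [hn]; linarith
  -- consecutive batches grow by the factor which halves `w ^ β`
  have hgrow : ∀ b, 1 ≤ b → b + 1 < K → 2 ^ (p / c.β) * n b ≤ n (b + 1) := by
    intro b hb hbK
    have h2 := hA b hb hbK
    have h3 : n b ≤ τ b := by
      have : (0 : ℝ) ≤ τ (b - 1) := Nat.cast_nonneg _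
      simp only [hn]; linarith
    have h4 : (0 : ℝ) < 2 ^ (p / c.β) := by positivity
    have h5 : n (b + 1) = τ (b + 1) - τ b := by simp only [hn, Nat.add_sub_cancel]
    rw [h5]
    nlinarith
  have hge : ∀ b, 1 ≤ b → b < K → 2 * (sideConst c / maxSide c ^ p) * ℓ ≤ n b := by
    intro b hb
    induction b, hb using Nat.le_induction with
    | base => intro _; simpa [hn, h0] using h1
    | succ b hb ih =>
      intro hbK
      have h2 := hgrow b hb hbK
      have h3 := ih (by omega)
      have h4 : (1 : ℝ) ≤ 2 ^ (p / c.β) := Real.one_le_rpow one_le_two (by positivity)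
      have h5 := hn0 b hb (by omega)
      nlinarith
  set w : ℕ → ℝ := fun b => (sideConst c * ℓ / n b) ^ (1 / p) with hw
  have hbase : ∀ b, 1 ≤ b → b < K → 0 < sideConst c * ℓ / n b := fun b hb hbK =>
    div_pos (by positivity) (hn0 b hb hbK.le)
  have hw0 : ∀ b, 1 ≤ b → b < K → 0 < w b := fun b hb hbK =>
    Real.rpow_pos_of_pos (hbase b hb hbK) _
  have hms := maxSide_pos hc
  have hwle : ∀ b, 1 ≤ b → b < K → w b ≤ maxSide c := by
    intro b hb hbK
    have h2 : sideConst c * ℓ / n b ≤ maxSide c ^ p := by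
      have h3 := hge b hb hbK
      have h4 : 0 < maxSide c ^ p := by positivity
      rw [div_le_iff₀ (hn0 b hb hbK.le)]
      have h5 : maxSide c ^ p * (2 * (sideConst c / maxSide c ^ p) * ℓ) = 2 * (sideConst c * ℓ) := by
        field_simp
      have h6 := mul_le_mul_of_nonneg_left h3 h4.le
      have h7 : 0 ≤ sideConst c * ℓ := by positivity
      linarith
    calc w b ≤ (maxSide c ^ p) ^ (1 / p) :=
          Real.rpow_le_rpow (hbase b hb hbK).le h2 (by positivity)
      _ = maxSide c := by
          rw [← Real.rpow_mul hms.le, mul_one_div_cancel (by linarith), Real.rpow_one]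
  have hwp : ∀ b, 1 ≤ b → b < K → (w b ^ c.β) ^ 2 * w b ^ c.d = sideConst c * ℓ / n b := by
    intro b hb hbK
    have h2 := hw0 b hb hbK
    rw [← Real.rpow_natCast (w b) c.d, ← Real.rpow_natCast (w b ^ c.β) 2, ← Real.rpow_mul h2.le,
      ← Real.rpow_add h2]
    have : c.β * ((2 : ℕ) : ℝ) + c.d = p := by rw [hpdef]; push_cast; ring
    rw [this, hw, ← Real.rpow_mul (hbase b hb hbK).le, one_div_mul_cancel (by linarith),
      Real.rpow_one]
  exact
    { zero := h0
      lt := hlt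
      last := hK
      even := heven
      w_pos := hw0
      w_le := fun b hb hbK => by
        have h2 : w b ≤ 1 / 4 := (hwle b hb hbK).trans (min_le_left _ _)
        show 4 * w b ≤ 1
        linarith
      w_ge := fun b hb hbK => by
        show 1 ≤ T * w b
        have h2 : 1 / (T : ℝ) ≤ sideConst c * ℓ / n b := by
          have h3 : (1 : ℝ) ≤ sideConst c * ℓ := by nlinarith
          exact div_le_div₀ (by positivity) h3 (hn0 b hb hbK.le) (hnT b hbK.le)
        have h3 : 1 / (T : ℝ) ≤ w b := by
          calc 1 / (T : ℝ) = (1 / (T : ℝ)) ^ (1 : ℝ) := (Real.rpow_one _).symm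
            _ ≤ (1 / (T : ℝ)) ^ (1 / p) := by
                refine Real.rpow_le_rpow_of_exponent_ge (by positivity) ?_ ?_
                · rw [div_le_one (by linarith)]; exact hT0
                · rw [div_le_one (by linarith)]; exact hp
            _ ≤ w b := Real.rpow_le_rpow (by positivity) h2 (by positivity)
        rw [div_le_iff₀ (by linarith)] at h3
        linarith
      bound_le := fun b hb hbK => by
        show gapBound c * w b ^ c.β ≤ c.δ₀
        have hG := gapBound_pos hc
        have hδ := hc.δ₀_pos
        have h2 : w b ≤ (c.δ₀ / gapBound c) ^ (1 / c.β) :=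
          (hwle b hb hbK).trans (min_le_right _ _)
        have h3 : w b ^ c.β ≤ c.δ₀ / gapBound c := by
          calc w b ^ c.β ≤ ((c.δ₀ / gapBound c) ^ (1 / c.β)) ^ c.β :=
                Real.rpow_le_rpow (hw0 b hb hbK).le h2 hβ.le
            _ = _ := by
                rw [← Real.rpow_mul (by positivity), one_div_mul_cancel hβ.ne', Real.rpow_one]
        rw [le_div_iff₀ hG] at h3
        linarith
      halve := fun b hb hbK => by
        show 2 * w (b + 1) ^ c.β ≤ w b ^ c.β
        have h2 := hgrow b hb hbK
        have h3 := hbase (b + 1) (by omega) hbK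
        have h4 : 2 ^ (p / c.β) * (sideConst c * ℓ / n (b + 1)) ≤ sideConst c * ℓ / n b := by
          rw [mul_div_assoc', div_le_div_iff₀ (hn0 _ (by omega) hbK.le) (hn0 b hb (by omega))]
          have : 0 ≤ sideConst c * ℓ := by positivity
          nlinarith
        have h5 : w b ^ c.β = (sideConst c * ℓ / n b) ^ (c.β / p) := by
          rw [hw, ← Real.rpow_mul (hbase b hb (by omega)).le]; congr 1; ring
        have h6 : w (b + 1) ^ c.β = (sideConst c * ℓ / n (b + 1)) ^ (c.β / p) := by
          rw [hw, ← Real.rpow_mul h3.le]; congr 1; ring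
        rw [h5, h6]
        calc 2 * (sideConst c * ℓ / n (b + 1)) ^ (c.β / p)
            = (2 ^ (p / c.β) * (sideConst c * ℓ / n (b + 1))) ^ (c.β / p) := by
              rw [Real.mul_rpow (by positivity) h3.le, ← Real.rpow_mul zero_le_two,
                div_mul_div_cancel₀ hβ.ne', div_self (by linarith), Real.rpow_one]
          _ ≤ _ := Real.rpow_le_rpow (by positivity) h4 (by positivity)
      threshold := fun b hbK => rfl
      sample := fun b hbK => by
        have h2 := hwp (b + 1) (by omega) hbK
        have h3 := hn0 (b + 1) (by omega) hbK.le
        show (c.d + 4) * ℓ ≤ gapOsc c ^ 2 * c.cUp * 4 ^ c.d / 4 * n (b + 1) *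
          (w (b + 1) ^ c.β) ^ 2 * w (b + 1) ^ c.d
        rw [mul_assoc, h2]
        have h4 : 0 < gapOsc c ^ 2 * c.cUp * 4 ^ c.d / 4 := by positivity
        have h5 : (c.d + 4) / (gapOsc c ^ 2 * c.cUp * 4 ^ c.d / 4) ≤ sideConst c := le_max_left _ _
        rw [div_le_iff₀ h4] at h5
        have h6 : gapOsc c ^ 2 * c.cUp * 4 ^ c.d / 4 * n (b + 1) * (sideConst c * ℓ / n (b + 1))
            = sideConst c * (gapOsc c ^ 2 * c.cUp * 4 ^ c.d / 4) * ℓ := by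
          field_simp
        rw [h6]
        gcongr }

lemma rateExp_le {c : ClassConstants} (hc : c.Good) {a : ℝ} (ha : a ≤ c.d / c.β) :
    rateExp c a ≤ (c.β + c.d) / (2 * c.β + c.d) := by
  have hp := hc.exponent_pos
  have hβ := hc.β_pos
  rw [le_div_iff₀ hβ] at ha
  unfold rateExp
  gcongr
  linarith

lemma rateExp_pos {c : ClassConstants} (hc : c.Good) {a : ℝ} (ha : 0 ≤ a) : 0 < rateExp c a := by
  have hp := hc.exponent_pos
  have hβ := hc.β_pos
  unfold rateExp; positivity

lemma maxRateExp_lt_one {c : ClassConstants} (hc : c.Good) :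
    (c.β + c.d) / (2 * c.β + c.d) < 1 := by
  rw [div_lt_one (by linarith [hc.exponent_pos])]
  linarith [hc.β_pos]

/-- The constant in `mul_roundBound_le`. -/
noncomputable def rateConst (c : ClassConstants) : ℝ :=
  c.D₀ * (max 1 (gapBound c)) ^ (1 + (c.d : ℝ) / c.β) * (2 * sideConst c)

/-- A batch which satisfies the growth condition of the grid has regret of the order of the minimax
rate, up to a factor `log T`. The exponent `1 - g` of `log T` in the growth condition and the
exponent `γ ≤ g` of `log T` in the error of the previous batch add up to at most one. -/
lemma mul_roundBound_le {c : ClassConstants} (hc : c.Good) {T : ℕ} {τ : ℕ → ℕ}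
    {B : ℝ} (hB : 0 ≤ B) (hT : 1 ≤ Real.log T) {a : ℝ} (ha0 : 0 ≤ a) (ha : a ≤ c.d / c.β) {b : ℕ}
    (hb : 1 ≤ b) (hn : (τ b : ℝ) / 2 ≤ (τ b : ℝ) - τ (b - 1)) (hτ : 0 < τ b) (hτT : τ b ≤ T)
    (hgrid : (τ (b + 1) : ℝ) ≤ B * (Real.log T) ^ (1 - (c.β + c.d) / (2 * c.β + c.d)) *
      (T : ℝ) ^ (1 - (c.β + c.d) / (2 * c.β + c.d)) *
      (τ b : ℝ) ^ ((c.β + c.d) / (2 * c.β + c.d))) {α : ℝ≥0∞} (hα : α ≠ ∞) (hαa : α.toReal = a) :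
    ((τ (b + 1) : ℝ) - τ b) * roundBound c (gridSchedule c T τ) α b
      ≤ B * rateConst c * Real.log T * (T : ℝ) ^ (1 - rateExp c a) := by
  have hp := hc.exponent_pos
  have hβ := hc.β_pos
  have hG := gapBound_pos hc
  have hD := hc.D₀_pos
  have hγg := rateExp_le hc ha
  have hγ0 := rateExp_pos hc ha0
  have hg1 := maxRateExp_lt_one hc
  set p := 2 * c.β + c.d with hpdef
  set g := (c.β + c.d) / p with hg
  set γ := rateExp c a with hγ
  set ℓ := Real.log T with hℓ
  have hS1 : 1 ≤ sideConst c := le_max_right _ _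
  have hτ0 : (0 : ℝ) < τ b := by exact_mod_cast hτ
  have hT0 : (0 : ℝ) < T := hτ0.trans_le (by exact_mod_cast hτT)
  set n := (τ b : ℝ) - τ (b - 1) with hndef
  have hn0 : 0 < n := by linarith
  have hℓ0 : 0 < ℓ := by linarith
  have hbase : 0 < sideConst c * ℓ / n := by positivity
  have hw : (gridSchedule c T τ).w b = (sideConst c * ℓ / n) ^ (1 / p) := rfl
  have hrb : roundBound c (gridSchedule c T τ) α b
      = c.D₀ * gapBound c ^ (1 + a) * (sideConst c * ℓ / n) ^ γ := by
    unfold roundBound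
    have e1 : ((sideConst c * ℓ / n) ^ (1 / p)) ^ c.β = (sideConst c * ℓ / n) ^ (c.β / p) := by
      rw [← Real.rpow_mul hbase.le]; congr 1; ring
    rw [if_neg (by omega), hw, e1, marginPow, if_neg hα, hαa]
    set y := (sideConst c * ℓ / n) ^ (c.β / p) with hy
    have hy0 : 0 < y := by positivity
    have e2 : (sideConst c * ℓ / n) ^ γ = y ^ (1 + a) := by
      rw [hy, ← Real.rpow_mul hbase.le]; congr 1; rw [hγ, rateExp]; ring
    rw [e2, mul_left_comm, mul_assoc c.D₀, ← Real.mul_rpow hG.le hy0.le]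
    congr 1
    rw [Real.rpow_add (by positivity), Real.rpow_one]
  rw [hrb]
  have h1 : gapBound c ^ (1 + a) ≤ (max 1 (gapBound c)) ^ (1 + (c.d : ℝ) / c.β) :=
    calc gapBound c ^ (1 + a) ≤ (max 1 (gapBound c)) ^ (1 + a) :=
          Real.rpow_le_rpow hG.le (le_max_right _ _) (by linarith)
      _ ≤ _ := Real.rpow_le_rpow_of_exponent_le (le_max_left _ _) (by linarith)
  have h2 : (sideConst c * ℓ / n) ^ γ ≤ 2 * sideConst c * ℓ ^ γ * (τ b : ℝ) ^ (-γ) := by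
    calc (sideConst c * ℓ / n) ^ γ ≤ (2 * sideConst c * ℓ / τ b) ^ γ := by
          refine Real.rpow_le_rpow hbase.le ?_ hγ0.le
          rw [div_le_div_iff₀ hn0 hτ0]
          have : 0 ≤ sideConst c * ℓ := by positivity
          nlinarith
      _ = (2 * sideConst c) ^ γ * ℓ ^ γ * (τ b : ℝ) ^ (-γ) := by
          rw [Real.div_rpow (by positivity) hτ0.le, Real.mul_rpow (by positivity) hℓ0.le,
            Real.rpow_neg hτ0.le]
          rfl
      _ ≤ _ := by
          gcongr
          calc (2 * sideConst c) ^ γ ≤ (2 * sideConst c) ^ (1 : ℝ) :=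
                Real.rpow_le_rpow_of_exponent_le (by linarith) (by linarith)
            _ = _ := Real.rpow_one _
  have h3 : (τ (b + 1) : ℝ) - τ b ≤ B * ℓ ^ (1 - g) * (T : ℝ) ^ (1 - g) * (τ b : ℝ) ^ g := by
    linarith
  have h4 : ℓ ^ (1 - g) * ℓ ^ γ ≤ ℓ := by
    rw [← Real.rpow_add hℓ0]
    calc ℓ ^ (1 - g + γ) ≤ ℓ ^ (1 : ℝ) := Real.rpow_le_rpow_of_exponent_le hT (by linarith)
      _ = ℓ := Real.rpow_one _
  have h5 : (T : ℝ) ^ (1 - g) * ((τ b : ℝ) ^ g * (τ b : ℝ) ^ (-γ)) ≤ (T : ℝ) ^ (1 - γ) := by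
    rw [← Real.rpow_add hτ0]
    calc (T : ℝ) ^ (1 - g) * (τ b : ℝ) ^ (g + -γ) ≤ (T : ℝ) ^ (1 - g) * (T : ℝ) ^ (g + -γ) := by
          gcongr
          · linarith
      _ = _ := by rw [← Real.rpow_add hT0]; congr 1; ring
  set Q := (max 1 (gapBound c)) ^ (1 + (c.d : ℝ) / c.β) with hQ
  have hQ0 : 0 < Q := by positivity
  calc ((τ (b + 1) : ℝ) - τ b) * (c.D₀ * gapBound c ^ (1 + a) * (sideConst c * ℓ / n) ^ γ)
      ≤ (B * ℓ ^ (1 - g) * (T : ℝ) ^ (1 - g) * (τ b : ℝ) ^ g) *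
        (c.D₀ * Q * (2 * sideConst c * ℓ ^ γ * (τ b : ℝ) ^ (-γ))) := by
        refine mul_le_mul h3 ?_ (by positivity) (by positivity)
        gcongr
    _ = B * (c.D₀ * Q * (2 * sideConst c)) * (ℓ ^ (1 - g) * ℓ ^ γ) *
        ((T : ℝ) ^ (1 - g) * ((τ b : ℝ) ^ g * (τ b : ℝ) ^ (-γ))) := by ring
    _ ≤ B * (c.D₀ * Q * (2 * sideConst c)) * ℓ * (T : ℝ) ^ (1 - γ) := by
        gcongr
    _ = _ := rfl

/-- Successive elimination attains the minimax rates for all margin parameters at once, up to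
logarithmic factors. -/
theorem exists_adaptive_policy {c : ClassConstants} (hc : c.Good) :
    ∃ c₁ C B : ℝ, 0 < c₁ ∧ 0 < C ∧ 1 ≤ B ∧ ∀ T M : ℕ, 1 ≤ Real.log (Real.log T) →
      B * Real.log T ≤ T → M ≤ T → c₁ * Real.log (Real.log T) ≤ M →
      ∃ π : BatchPolicy c.d T M,
        (∀ E ∈ envClass c ∞, regret π E ≤ ENNReal.ofReal (C * Real.log T)) ∧
        ∀ α : ℝ≥0∞, α ≤ ENNReal.ofReal (c.d / c.β) → ∀ E ∈ envClass c α,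
          regret π E ≤ ENNReal.ofReal (C * Real.log (Real.log T) * Real.log T *
            (T : ℝ) ^ (1 - rateExp c α.toReal)) := by
  have hp := hc.exponent_pos
  have hβ := hc.β_pos
  have hd : (1 : ℝ) ≤ c.d := by exact_mod_cast hc.d_pos
  have hms := maxSide_pos hc
  have hg1 := maxRateExp_lt_one hc
  set p := 2 * c.β + c.d with hpdef
  set g := (c.β + c.d) / p with hg
  have hg0 : 0 < g := by positivity
  have hS1 : 1 ≤ sideConst c := le_max_right _ _
  set κ := max 1 (sideConst c / maxSide c ^ p) with hκ
  have hκ1 : 1 ≤ κ := le_max_left _ _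
  set A : ℝ := 1 + 2 ^ (p / c.β) with hA
  have hA2 : 2 ≤ A := by
    have : (1 : ℝ) ≤ 2 ^ (p / c.β) := Real.one_le_rpow one_le_two (by positivity)
    linarith
  obtain ⟨B, hB1, HB⟩ := exists_base_grid hg0 hg1 hA2 hκ1
  have hlogg : 0 < Real.log (1 / g) := Real.log_pos (by rw [lt_div_iff₀ hg0]; linarith)
  set c₁ := 2 + 1 / Real.log (1 / g) with hc₁
  have hc₁0 : 0 < c₁ := by positivity
  have hrc : 0 ≤ rateConst c := by
    have := hc.D₀_pos
    unfold rateConst; positivity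
  -- the regret of each batch is at most `Q * log T * T ^ (1 - γ)`
  set Q := B * rateConst c + 4 * κ with hQ
  have hQ0 : 0 < Q := by have := mul_nonneg (by linarith : 0 ≤ B) hrc; linarith
  refine ⟨c₁, 2 ^ (c.d + 1) + 4 * κ + c₁ * Q, B, hc₁0, by positivity, hB1,
    fun T M hT hBT hMT hM => ?_⟩
  obtain ⟨K, τ, hK1, hK, hτ0, hτK, hlt, heven, hτ1, hτ1', hgrow, hrate⟩ := HB T hT hBT
  set ℓ := Real.log T with hℓ
  have hℓ1 : 1 ≤ ℓ := by
    by_contra! h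
    rcases le_or_gt 0 ℓ with h0 | h0
    · have := Real.log_nonpos h0 h.le; linarith
    · have : 0 ≤ ℓ := Real.log_natCast_nonneg T
      linarith
  have hT1 : (1 : ℝ) ≤ T := by nlinarith
  have hadm : (gridSchedule c T τ).Admissible c T K := by
    refine gridSchedule_admissible hc hℓ1 hτ0 hτK hlt heven ?_ hgrow
    refine le_trans ?_ hτ1
    have : sideConst c / maxSide c ^ p ≤ κ := le_max_right _ _
    gcongr
  have hKM : K ≤ M := by exact_mod_cast hK.trans hM
  obtain ⟨π, hπ⟩ := (gridSchedule c T τ).exists_policy (d := c.d) hKM hMT hτ0 hlt hτK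
  have hmain : ∀ α E, E ∈ envClass c α → regret π E ≤ ENNReal.ofReal (2 ^ (c.d + 1) +
      ∑ b ∈ Finset.range K, ((τ (b + 1) : ℝ) - τ b) * roundBound c (gridSchedule c T τ) α b) :=
    fun α E hE => regret_le_sum_roundBound hc hE (by exact_mod_cast hT1) hadm π hπ
  have hr0 : ∀ α, roundBound c (gridSchedule c T τ) α 0 = 1 := fun α => by simp [roundBound]
  have hp2 : (0 : ℝ) < 2 ^ (c.d + 1) := by positivity
  refine ⟨π, fun E hE => ?_, fun α hα E hE => ?_⟩
  -- for `α = ∞` only the first batch and the bad event cause regret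
  · refine (hmain ∞ E hE).trans (ENNReal.ofReal_le_ofReal ?_)
    obtain ⟨K, rfl⟩ : ∃ K', K = K' + 1 := ⟨K - 1, by omega⟩
    rw [Finset.sum_range_succ', hr0]
    have h1 : ∑ b ∈ Finset.range K, ((τ (b + 1 + 1) : ℝ) - τ (b + 1)) *
        roundBound c (gridSchedule c T τ) ∞ (b + 1) = 0 := by
      refine Finset.sum_eq_zero fun b _ => ?_
      simp [roundBound, marginPow]
    rw [h1, hτ0]
    simp only [Nat.zero_add, Nat.cast_zero]
    have h2 : (2 : ℝ) ^ (c.d + 1) ≤ 2 ^ (c.d + 1) * ℓ := by nlinarith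
    have h3 : 0 ≤ c₁ * Q * ℓ := by positivity
    nlinarith
  · have hαt : α ≠ ∞ := ne_top_of_le_ne_top ENNReal.ofReal_ne_top hα
    have ha : α.toReal ≤ c.d / c.β := ENNReal.toReal_le_of_le_ofReal (by positivity) hα
    have ha0 : 0 ≤ α.toReal := ENNReal.toReal_nonneg
    refine (hmain α E hE).trans (ENNReal.ofReal_le_ofReal ?_)
    set R := (T : ℝ) ^ (1 - rateExp c α.toReal) with hR
    have hR1 : 1 ≤ R := Real.one_le_rpow hT1 (by linarith [rateExp_le hc ha])
    have hterm : ∀ b ∈ Finset.range K, ((τ (b + 1) : ℝ) - τ b) *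
        roundBound c (gridSchedule c T τ) α b ≤ Q * ℓ * R := by
      intro b hbK
      have hbK' := Finset.mem_range.1 hbK
      have hBr := mul_nonneg (by linarith : 0 ≤ B) hrc
      have hℓR : 1 * 1 ≤ ℓ * R := mul_le_mul hℓ1 hR1 zero_le_one (by linarith)
      rcases Nat.eq_zero_or_pos b with rfl | hb0
      · rw [hr0, hτ0, mul_one]
        simp only [Nat.zero_add, Nat.cast_zero, sub_zero]
        have : 4 * κ * ℓ * 1 ≤ 4 * κ * ℓ * R := by gcongr
        have : 0 ≤ B * rateConst c * (ℓ * R) := by positivity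
        rw [hQ]; linarith
      · have hn : (τ b : ℝ) / 2 ≤ (τ b : ℝ) - τ (b - 1) := by
          obtain ⟨b, rfl⟩ : ∃ b', b = b' + 1 := ⟨b - 1, by omega⟩
          rw [Nat.add_sub_cancel]
          rcases Nat.eq_zero_or_pos b with rfl | hb1
          · rw [hτ0]; simp
          · have h1 := hgrow b hb1 hbK'
            have h2 : (0 : ℝ) ≤ τ b := Nat.cast_nonneg _
            nlinarith
        have hpos : 0 < τ b := by
          obtain ⟨b, rfl⟩ : ∃ b', b = b' + 1 := ⟨b - 1, by omega⟩
          have := hlt b (by omega); omega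
        have hle : τ b ≤ T := by rw [← hτK]; exact hadm.mono hbK'.le le_rfl
        have := mul_roundBound_le hc (by linarith : 0 ≤ B) hℓ1 ha0 ha hb0 hn hpos hle
          (hrate b hb0 hbK') hαt rfl
        have h4 : 0 ≤ 4 * κ * (ℓ * R) := by positivity
        rw [hQ]; linarith
    have hsum := Finset.sum_le_sum hterm
    rw [Finset.sum_const, Finset.card_range, nsmul_eq_mul] at hsum
    have h1 : (K : ℝ) * (Q * ℓ * R) ≤ c₁ * Real.log ℓ * (Q * ℓ * R) := by
      have : 0 ≤ Q * ℓ * R := by positivity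
      gcongr
    have h2 : (1 : ℝ) ≤ Real.log ℓ * ℓ * R := by
      calc (1 : ℝ) = 1 * 1 * 1 := by ring
        _ ≤ _ := by gcongr
    have h3 : (2 ^ (c.d + 1) + 4 * κ + c₁ * Q) * Real.log ℓ * ℓ * R
        = 2 ^ (c.d + 1) * (Real.log ℓ * ℓ * R) + 4 * κ * (Real.log ℓ * ℓ * R) +
          c₁ * Real.log ℓ * (Q * ℓ * R) := by ring
    rw [h3]
    have h4 : (2 : ℝ) ^ (c.d + 1) * 1 ≤ 2 ^ (c.d + 1) * (Real.log ℓ * ℓ * R) := by gcongr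
    have h5 : 0 ≤ 4 * κ * (Real.log ℓ * ℓ * R) := by positivity
    linarith

/-! ### Measurability of the pulled arms -/

lemma measurable_info {d T : ℕ} {n s : Path d T → ℕ} {a : Fin T → Path d T → Arm}
    (hn : Measurable n) (hs : Measurable s) (ha : ∀ l, Measurable (a l)) :
    Measurable fun ω => info ω (fun l => a l ω) (n ω) (s ω) := by
  refine hs.prodMk (Measurable.prodMk (measurable_pi_lambda _ fun l => ?_)
    (measurable_pi_lambda _ fun l => ?_))
  · exact Measurable.ite (measurableSet_lt measurable_const hn)
      (measurable_fst.comp (measurable_pi_apply l)) measurable_const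
  · refine Measurable.ite (measurableSet_lt measurable_const hs) ?_ measurable_const
    have h1 : (fun ω : Path d T => (ω l).2 (a l ω))
        = fun ω => if a l ω = true then (ω l).2 true else (ω l).2 false := by
      funext ω; cases a l ω <;> rfl
    rw [h1]
    refine Measurable.ite (ha l (MeasurableSpace.measurableSet_top (s := {true}))) ?_ ?_ <;> fun_prop

/-- The arms depend measurably on the path: the grid is adaptive, and each batch is determined by the
previous ones through measurable rules. -/
lemma BatchPolicy.measurable_arm {d T M : ℕ} (π : BatchPolicy d T M) (t : Fin T) :
    Measurable (π.arm t) := by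
  -- the arms of the first `i` batches, extended by an arbitrary constant
  have key : ∀ i ≤ M, Measurable (π.grid i) ∧
      ∀ t : Fin T, Measurable fun ω => if (t : ℕ) < π.grid i ω then π.arm t ω else true := by
    intro i hi
    induction i with
    | zero =>
      have h0 : π.grid 0 = fun _ => 0 := funext π.grid_zero
      rw [h0]
      exact ⟨measurable_const, fun t => by simp only [Nat.not_lt_zero, if_false]; exact measurable_const⟩
    | succ i ih =>
      obtain ⟨h1, h2⟩ := ih (by omega)
      have hcong : ∀ (n : ℕ) (ω : Path d T), info ω (fun l => π.arm l ω) n (π.grid i ω) = info ω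
          (fun l : Fin T => if (l : ℕ) < π.grid i ω then π.arm l ω else true) n (π.grid i ω) :=
        fun n ω => info_congr ω _ _ fun l hl => by simp only [if_pos hl]
      have h3 : Measurable (π.grid (i + 1)) := by
        have e : π.grid (i + 1) = fun ω => π.gridRule i (info ω
            (fun l : Fin T => if (l : ℕ) < π.grid i ω then π.arm l ω else true)
            (π.grid i ω) (π.grid i ω)) := by
          funext ω; rw [π.grid_eq i (by omega) ω, hcong]
        rw [e]
        exact (π.measurable_gridRule i).comp (measurable_info h1 h1 h2)
      refine ⟨h3, fun t => ?_⟩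
      have e : (fun ω => if (t : ℕ) < π.grid (i + 1) ω then π.arm t ω else true) = fun ω =>
          if (t : ℕ) < π.grid i ω then (if (t : ℕ) < π.grid i ω then π.arm t ω else true)
          else if (t : ℕ) < π.grid (i + 1) ω then π.armRule t (info ω
            (fun l : Fin T => if (l : ℕ) < π.grid i ω then π.arm l ω else true) (t + 1)
            (π.grid i ω)) else true := by
        funext ω
        by_cases h4 : (t : ℕ) < π.grid i ω
        · simp only [if_pos h4, if_pos (h4.trans (π.grid_lt i (by omega) ω))]
        · by_cases h5 : (t : ℕ) < π.grid (i + 1) ω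
          · simp only [if_neg h4, if_pos h5]
            rw [π.arm_eq t ω i (by omega) (not_lt.1 h4) h5, hcong]
          · simp only [if_neg h4, if_neg h5]
      rw [e]
      refine Measurable.ite (measurableSet_lt measurable_const h1) (h2 t) ?_
      refine Measurable.ite (measurableSet_lt measurable_const h3) ?_ measurable_const
      exact (π.measurable_armRule t).comp (measurable_info measurable_const h1 h2)
  have h := (key M le_rfl).2 t
  have e : (fun ω => if (t : ℕ) < π.grid M ω then π.arm t ω else true) = π.arm t := by
    funext ω
    rw [π.grid_last ω, if_pos t.2]
  rwa [e] at h

/-- The arm of the first round depends only on the first context. -/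
lemma BatchPolicy.arm_zero_eq {d T M : ℕ} (π : BatchPolicy d T M) (hT : 0 < T) :
    ∃ r : Ctx d → Arm, Measurable r ∧ ∀ ω, π.arm ⟨0, hT⟩ ω = r (ω ⟨0, hT⟩).1 := by
  have hM : 0 < M := by
    rcases Nat.eq_zero_or_pos M with rfl | h
    · have h1 := π.grid_zero 0
      have h2 := π.grid_last 0
      omega
    · exact h
  refine ⟨fun x => π.armRule ⟨0, hT⟩ (0, fun l => if (l : ℕ) < 1 then x else 0, 0),
    (π.measurable_armRule _).comp (measurable_const.prodMk
      (Measurable.prodMk (measurable_pi_lambda _ fun l => ?_) measurable_const)), fun ω => ?_⟩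
  · by_cases h : (l : ℕ) < 1
    · simp only [if_pos h]; exact measurable_id
    · simp only [if_neg h]; exact measurable_const
  · have h := π.grid_lt 0 hM ω
    rw [π.grid_zero] at h
    rw [π.arm_eq ⟨0, hT⟩ ω 0 hM (by rw [π.grid_zero]) h, π.grid_zero]
    congr 1
    unfold info
    refine Prod.ext rfl (Prod.ext ?_ ?_)
    · funext l
      by_cases hl : (l : ℕ) < 1
      · have : l = ⟨0, hT⟩ := Fin.ext (by simpa using hl)
        subst this; simp
      · simp [hl]
    · funext l; simp

/-! ### Environments with coin-flip rewards -/

/-- The rewards in which exactly one arm wins: arm `b` has reward `1`, the other arm `0`. -/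
def winReward (b : Arm) : Arm → ℝ := fun k => if k = b then 1 else 0

lemma abs_winReward_le (b k : Arm) : |winReward b k| ≤ 1 := by
  unfold winReward; split_ifs <;> simp

/-- Exactly one arm wins, each with probability `1 / 2`. -/
noncomputable def coin : Measure (Arm → ℝ) :=
  (2⁻¹ : ℝ≥0∞) • Measure.dirac (winReward true) + (2⁻¹ : ℝ≥0∞) • Measure.dirac (winReward false)

instance : IsProbabilityMeasure coin := by
  refine ⟨?_⟩
  simp [coin, ENNReal.inv_two_add_inv_two]

/-- The difference of the two rewards. -/
def rewardDiff (y : Arm → ℝ) : ℝ := y true - y false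

lemma measurable_rewardDiff : Measurable rewardDiff := by unfold rewardDiff; fun_prop

@[simp] lemma rewardDiff_true : rewardDiff (winReward true) = 1 := by
  simp [rewardDiff, winReward]

@[simp] lemma rewardDiff_false : rewardDiff (winReward false) = -1 := by
  simp [rewardDiff, winReward]

/-- Contexts from `μ`, and arm `1` wins in context `x` with probability `(1 + v x) / 2`. -/
noncomputable def biasedLaw {d : ℕ} (μ : Measure (Ctx d)) (v : Ctx d → ℝ) : Measure (Outcome d) :=
  (μ.prod coin).withDensity fun o => ENNReal.ofReal (1 + v o.1 * rewardDiff o.2)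

lemma lintegral_coin {φ : (Arm → ℝ) → ℝ≥0∞} (hφ : Measurable φ) :
    ∫⁻ y, φ y ∂coin = 2⁻¹ * φ (winReward true) + 2⁻¹ * φ (winReward false) := by
  unfold coin
  rw [lintegral_add_measure, lintegral_smul_measure, lintegral_smul_measure,
    lintegral_dirac' _ hφ, lintegral_dirac' _ hφ]
  rfl

lemma measurable_density {d : ℕ} {v : Ctx d → ℝ} (hv : Measurable v) :
    Measurable fun o : Outcome d => ENNReal.ofReal (1 + v o.1 * rewardDiff o.2) :=
  (measurable_const.add ((hv.comp measurable_fst).mul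
    (measurable_rewardDiff.comp measurable_snd))).ennreal_ofReal

lemma ofReal_two_inv_mul (a : ℝ) : (2⁻¹ : ℝ≥0∞) * ENNReal.ofReal a = ENNReal.ofReal (a / 2) := by
  rw [show a / 2 = 2⁻¹ * a by ring, ENNReal.ofReal_mul (by norm_num),
    ENNReal.ofReal_inv_of_pos two_pos, ENNReal.ofReal_ofNat]

/-- In context `x` the rewards are drawn from the two wins with weights `(1 ± v x) / 2`. -/
lemma lintegral_biasedLaw {d : ℕ} (μ : Measure (Ctx d)) [IsProbabilityMeasure μ] {v : Ctx d → ℝ}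
    (hv : Measurable v) {φ : Outcome d → ℝ≥0∞} (hφ : Measurable φ) :
    ∫⁻ o, φ o ∂biasedLaw μ v = ∫⁻ x, (ENNReal.ofReal ((1 + v x) / 2) * φ (x, winReward true)
      + ENNReal.ofReal ((1 - v x) / 2) * φ (x, winReward false)) ∂μ := by
  unfold biasedLaw
  rw [lintegral_withDensity_eq_lintegral_mul _ (measurable_density hv) hφ,
    lintegral_prod _ ((measurable_density hv).mul hφ).aemeasurable]
  refine lintegral_congr fun x => ?_
  have hx : Measurable fun y : Arm → ℝ =>
      ((fun o : Outcome d => ENNReal.ofReal (1 + v o.1 * rewardDiff o.2)) * φ) (x, y) :=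
    ((measurable_density hv).mul hφ).comp measurable_prodMk_left
  rw [lintegral_coin hx]
  simp only [Pi.mul_apply, rewardDiff_true, rewardDiff_false, ← mul_assoc, ofReal_two_inv_mul]
  congr 3 <;> ring_nf

lemma isProbabilityMeasure_biasedLaw {d : ℕ} (μ : Measure (Ctx d)) [IsProbabilityMeasure μ]
    {v : Ctx d → ℝ} (hv : Measurable v) (hv1 : ∀ x, |v x| ≤ 1) :
    IsProbabilityMeasure (biasedLaw μ v) := by
  refine ⟨?_⟩
  rw [← lintegral_one, lintegral_biasedLaw μ hv measurable_const]
  have : ∀ x, ENNReal.ofReal ((1 + v x) / 2) * 1 + ENNReal.ofReal ((1 - v x) / 2) * 1 = 1 := by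
    intro x
    have := abs_le.1 (hv1 x)
    rw [mul_one, mul_one, ← ENNReal.ofReal_add (by linarith) (by linarith)]
    rw [show (1 + v x) / 2 + (1 - v x) / 2 = 1 by ring, ENNReal.ofReal_one]
  simp_rw [this]
  simp

lemma map_fst_biasedLaw {d : ℕ} (μ : Measure (Ctx d)) [IsProbabilityMeasure μ]
    {v : Ctx d → ℝ} (hv : Measurable v) (hv1 : ∀ x, |v x| ≤ 1) :
    (biasedLaw μ v).map Prod.fst = μ := by
  ext A hA
  rw [Measure.map_apply measurable_fst hA, ← lintegral_indicator_one (measurable_fst hA),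
    lintegral_biasedLaw μ hv (measurable_one.indicator (measurable_fst hA)),
    ← lintegral_indicator_one hA]
  refine lintegral_congr fun x => ?_
  have := abs_le.1 (hv1 x)
  have h1 : ∀ y, (Prod.fst ⁻¹' A : Set (Outcome d)).indicator (1 : Outcome d → ℝ≥0∞) (x, y)
      = A.indicator (1 : Ctx d → ℝ≥0∞) x := fun y => rfl
  rw [h1, h1, ← add_mul, ← ENNReal.ofReal_add (by linarith) (by linarith),
    show (1 + v x) / 2 + (1 - v x) / 2 = 1 by ring, ENNReal.ofReal_one, one_mul]

lemma ae_biasedLaw {d : ℕ} (μ : Measure (Ctx d)) [IsProbabilityMeasure μ] (v : Ctx d → ℝ) :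
    ∀ᵐ o ∂biasedLaw μ v, o.2 = winReward true ∨ o.2 = winReward false := by
  refine (withDensity_absolutelyContinuous _ _).ae_le ?_
  have h : ∀ᵐ y ∂coin, y = winReward true ∨ y = winReward false := by
    unfold coin
    rw [ae_add_measure_iff]
    constructor <;> refine Measure.ae_smul_measure ?_ _
    · exact (ae_dirac_iff (by measurability)).2 (Or.inl rfl)
    · exact (ae_dirac_iff (by measurability)).2 (Or.inr rfl)
  exact Measure.quasiMeasurePreserving_snd.ae h

lemma integral_biasedLaw {d : ℕ} (μ : Measure (Ctx d)) [IsProbabilityMeasure μ] {v : Ctx d → ℝ}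
    (hv : Measurable v) (hv1 : ∀ x, |v x| ≤ 1) {φ : Outcome d → ℝ} (hφ : Measurable φ) {C : ℝ}
    (hC : ∀ x b, |φ (x, winReward b)| ≤ C) :
    ∫ o, φ o ∂biasedLaw μ v = ∫ x, ((1 + v x) / 2 * φ (x, winReward true)
      + (1 - v x) / 2 * φ (x, winReward false)) ∂μ := by
  have h1 : ∀ b, Measurable fun x => φ (x, winReward b) := fun b =>
    hφ.comp measurable_prodMk_right
  have := isProbabilityMeasure_biasedLaw μ hv hv1
  -- reduction to nonnegative functions
  have hpos : ∀ ψ : Outcome d → ℝ, Measurable ψ → (∀ x b, 0 ≤ ψ (x, winReward b)) →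
      ∫ o, ψ o ∂biasedLaw μ v = ∫ x, ((1 + v x) / 2 * ψ (x, winReward true)
      + (1 - v x) / 2 * ψ (x, winReward false)) ∂μ := by
    intro ψ hψ h0
    have hψ1 : ∀ b, Measurable fun x => ψ (x, winReward b) := fun b =>
      hψ.comp measurable_prodMk_right
    rw [integral_eq_lintegral_of_nonneg_ae, integral_eq_lintegral_of_nonneg_ae,
      lintegral_biasedLaw μ hv hψ.ennreal_ofReal]
    · congr 1
      refine lintegral_congr fun x => ?_
      have := abs_le.1 (hv1 x)
      rw [ENNReal.ofReal_add (mul_nonneg (by linarith) (h0 _ _))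
        (mul_nonneg (by linarith) (h0 _ _)), ENNReal.ofReal_mul (by linarith),
        ENNReal.ofReal_mul (by linarith)]
    · refine Filter.Eventually.of_forall fun x => ?_
      have := abs_le.1 (hv1 x)
      exact add_nonneg (mul_nonneg (by linarith) (h0 _ _)) (mul_nonneg (by linarith) (h0 _ _))
    · exact (((measurable_const.add hv).div_const 2 |>.mul (hψ1 true)).add
        ((measurable_const.sub hv).div_const 2 |>.mul (hψ1 false))).aestronglyMeasurable
    · filter_upwards [ae_biasedLaw μ v] with o ho
      rcases ho with h | h <;> [have := h0 o.1 true; have := h0 o.1 false] <;>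
        simpa [← h] using this
    · exact hψ.aestronglyMeasurable
  have h2 := hpos (fun o => φ o + C) (hφ.add_const C) fun x b => by
    have := abs_le.1 (hC x b); linarith
  have hint : Integrable φ (biasedLaw μ v) := by
    refine Integrable.of_bound (C := C) hφ.aestronglyMeasurable ?_
    filter_upwards [ae_biasedLaw μ v] with o ho
    rcases ho with h | h <;> [have := hC o.1 true; have := hC o.1 false] <;>
      simpa [← h] using this
  have hint2 : Integrable (fun x => (1 + v x) / 2 * φ (x, winReward true)
      + (1 - v x) / 2 * φ (x, winReward false)) μ := by
    refine Integrable.of_bound (C := C)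
      (((measurable_const.add hv).div_const 2 |>.mul (h1 true)).add
        ((measurable_const.sub hv).div_const 2 |>.mul (h1 false))).aestronglyMeasurable
      (Filter.Eventually.of_forall fun x => ?_)
    have h3 := abs_le.1 (hv1 x)
    have h4 := abs_le.1 (hC x true)
    have h5 := abs_le.1 (hC x false)
    rw [Real.norm_eq_abs, abs_le]
    constructor <;> nlinarith
  rw [integral_add hint (integrable_const C)] at h2
  have h3 : ∀ x, (1 + v x) / 2 * (φ (x, winReward true) + C) + (1 - v x) / 2 *
      (φ (x, winReward false) + C) = ((1 + v x) / 2 * φ (x, winReward true)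
      + (1 - v x) / 2 * φ (x, winReward false)) + C := fun x => by ring
  simp_rw [h3] at h2
  rw [integral_add hint2 (integrable_const C)] at h2
  simpa using h2

/-- The environment with contexts from `μ` and gap `v`. The version `f` of the gap may differ from
`v` on a `μ`-null set. -/
noncomputable def biasedEnv {d : ℕ} (μ : Measure (Ctx d)) [IsProbabilityMeasure μ]
    (hμ : ∀ᵐ x ∂μ, x ∈ cube d) (v : Ctx d → ℝ) (hv : Measurable v) (hv1 : ∀ x, |v x| ≤ 1)
    (f : Ctx d → ℝ) (hf : ∀ᵐ x ∂μ, f x = v x) : Environment d where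
  law := biasedLaw μ v
  isProb := isProbabilityMeasure_biasedLaw μ hv hv1
  f k x := if k then (1 + f x) / 2 else (1 - f x) / 2
  ctx_mem := by
    have := map_fst_biasedLaw μ hv hv1
    exact ae_of_ae_map measurable_fst.aemeasurable (by rwa [this])
  reward_mem := by
    filter_upwards [ae_biasedLaw μ v] with o ho k
    rcases ho with h | h <;> rw [h] <;> unfold winReward <;> split_ifs <;> simp
  condMean := by
    intro k
    have := isProbabilityMeasure_biasedLaw μ hv hv1
    have hm : MeasurableSpace.comap (Prod.fst : Outcome d → Ctx d) inferInstance ≤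
      (inferInstance : MeasurableSpace (Outcome d)) := measurable_fst.comap_le
    set q : Ctx d → ℝ := fun x => if k then (1 + v x) / 2 else (1 - v x) / 2 with hq
    have hqm : Measurable q := by
      cases k
      · simp only [hq, Bool.false_eq_true, if_false]; fun_prop
      · simp only [hq, if_true]; fun_prop
    have hq1 : ∀ x, |q x| ≤ 1 := by
      intro x
      have := abs_le.1 (hv1 x)
      rw [abs_le]
      cases k <;> simp only [hq, Bool.false_eq_true, if_false, if_true] <;> constructor <;> linarith
    have hymeas : Measurable fun o : Outcome d => o.2 k := by fun_prop
    have hyint : Integrable (fun o : Outcome d => o.2 k) (biasedLaw μ v) := by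
      refine Integrable.of_bound (C := 1) hymeas.aestronglyMeasurable ?_
      filter_upwards [ae_biasedLaw μ v] with o ho
      rcases ho with h | h <;> rw [h] <;> unfold winReward <;> split_ifs <;> simp
    have hqm1 : Measurable fun o : Outcome d => q o.1 := hqm.comp measurable_fst
    have hqint : Integrable (fun o : Outcome d => q o.1) (biasedLaw μ v) :=
      Integrable.of_bound (C := 1) (hqm.comp measurable_fst).aestronglyMeasurable
        (Filter.Eventually.of_forall fun o => hq1 o.1)
    have h1 : (fun o : Outcome d => q o.1) =ᵐ[biasedLaw μ v]
        condExp (MeasurableSpace.comap Prod.fst inferInstance) (biasedLaw μ v) fun o => o.2 k := by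
      refine ae_eq_condExp_of_forall_setIntegral_eq hm hyint (fun _ _ _ => hqint.integrableOn) ?_
        (hqm.comp (comap_measurable Prod.fst)).aestronglyMeasurable
      rintro _ ⟨A, hA, rfl⟩ _
      rw [← integral_indicator (measurable_fst hA), ← integral_indicator (measurable_fst hA)]
      have hA' : MeasurableSet (Prod.fst ⁻¹' A : Set (Outcome d)) := measurable_fst hA
      rw [integral_biasedLaw μ hv hv1 (hqm1.indicator hA') (C := 1),
        integral_biasedLaw μ hv hv1 (hymeas.indicator hA') (C := 1)]
      · refine integral_congr_ae (Filter.Eventually.of_forall fun x => ?_)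
        by_cases hx : x ∈ A
        · have hx' : ∀ y, ((x, y) : Outcome d) ∈ Prod.fst ⁻¹' A := fun y => hx
          simp only [indicator_of_mem (hx' _)]
          cases k <;> simp [hq, winReward] <;> ring
        · have hx' : ∀ y, ((x, y) : Outcome d) ∉ Prod.fst ⁻¹' A := fun y => hx
          simp only [indicator_of_notMem (hx' _)]
      · intro x b
        by_cases hx : ((x, winReward b) : Outcome d) ∈ Prod.fst ⁻¹' A
        · rw [indicator_of_mem hx]; exact abs_winReward_le b k
        · rw [indicator_of_notMem hx]; simp
      · intro x b
        by_cases hx : ((x, winReward b) : Outcome d) ∈ Prod.fst ⁻¹' A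
        · rw [indicator_of_mem hx]; exact hq1 x
        · rw [indicator_of_notMem hx]; simp
    refine h1.symm.trans ?_
    have h2 : ∀ᵐ o ∂biasedLaw μ v, f o.1 = v o.1 := by
      have := map_fst_biasedLaw μ hv hv1
      exact ae_of_ae_map measurable_fst.aemeasurable (by rwa [this])
    filter_upwards [h2] with o ho
    simp only [hq, ho]

lemma biasedEnv_ctxLaw {d : ℕ} (μ : Measure (Ctx d)) [IsProbabilityMeasure μ]
    (hμ : ∀ᵐ x ∂μ, x ∈ cube d) (v : Ctx d → ℝ) (hv : Measurable v) (hv1 : ∀ x, |v x| ≤ 1)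
    (f : Ctx d → ℝ) (hf : ∀ᵐ x ∂μ, f x = v x) : (biasedEnv μ hμ v hv hv1 f hf).ctxLaw = μ :=
  map_fst_biasedLaw μ hv hv1

lemma biasedEnv_gap {d : ℕ} (μ : Measure (Ctx d)) [IsProbabilityMeasure μ]
    (hμ : ∀ᵐ x ∂μ, x ∈ cube d) (v : Ctx d → ℝ) (hv : Measurable v) (hv1 : ∀ x, |v x| ≤ 1)
    (f : Ctx d → ℝ) (hf : ∀ᵐ x ∂μ, f x = v x) (x : Ctx d) :
    (biasedEnv μ hμ v hv hv1 f hf).gap x = f x := by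
  simp only [Environment.gap, biasedEnv, if_true, Bool.false_eq_true, if_false]; ring

/-- Pulling the wrong arm costs the absolute value of the gap. -/
lemma Environment.instant_regret_eq {d : ℕ} (E : Environment d) (x : Ctx d) (k : Arm)
    (h : armSign k * E.gap x ≤ 0) : max (E.f true x) (E.f false x) - E.f k x = |E.gap x| := by
  unfold Environment.gap armSign at *
  cases k
  · simp only [Bool.false_eq_true, if_false] at h
    rw [abs_of_nonneg (by linarith), max_eq_left (by linarith)]
  · simp only [if_true] at h
    rw [abs_of_nonpos (by linarith), max_eq_right (by linarith)]; ring

/-! ### The two-point bound -/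

lemma ofReal_integral_le_lintegral_ofReal {Ω : Type*} [MeasurableSpace Ω] {μ : Measure Ω}
    {F : Ω → ℝ} (hF : Integrable F μ) :
    ENNReal.ofReal (∫ z, F z ∂μ) ≤ ∫⁻ z, ENNReal.ofReal (F z) ∂μ := by
  have h : ∀ z, ENNReal.ofReal (F z) = ENNReal.ofReal (max (F z) 0) := fun z => by
    rw [ENNReal.ofReal_max, ENNReal.ofReal_zero, max_eq_left zero_le]
  simp_rw [h]
  rw [← ofReal_integral_eq_lintegral_ofReal hF.pos_part
    (Filter.Eventually.of_forall fun z => le_max_right _ _)]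
  exact ENNReal.ofReal_le_ofReal (integral_mono hF hF.pos_part fun z => le_max_left _ _)

lemma lintegral_prod_eval_pi {ι Ω : Type*} [Fintype ι] [MeasurableSpace Ω] (μ : Measure Ω)
    [IsProbabilityMeasure μ] {φ : ι → Ω → ℝ≥0∞} (hφ : ∀ i, Measurable (φ i)) :
    ∫⁻ ω, ∏ i, φ i (ω i) ∂(Measure.pi fun _ : ι => μ) = ∏ i, ∫⁻ z, φ i z ∂μ := by
  have hind : iIndepFun (fun i (ω : ι → Ω) => φ i (ω i)) (Measure.pi fun _ : ι => μ) :=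
    iIndepFun_pi fun i => (hφ i).aemeasurable
  have h := lintegral_prod_eq_prod_lintegral_of_indepFun Finset.univ _ hind
    fun i => (hφ i).comp (measurable_pi_apply i)
  refine Eq.trans ?_ (h.trans (Finset.prod_congr rfl fun i _ => ?_))
  · rfl
  · exact (measurePreserving_eval (fun _ : ι => μ) i).lintegral_comp (hφ i)

lemma pi_withDensity {ι Ω : Type*} [Fintype ι] [MeasurableSpace Ω] (μ : Measure Ω)
    [IsProbabilityMeasure μ] {g : Ω → ℝ≥0∞} (hg : Measurable g)
    [IsProbabilityMeasure (μ.withDensity g)] :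
    (Measure.pi fun _ : ι => μ.withDensity g)
      = (Measure.pi fun _ : ι => μ).withDensity fun ω => ∏ i, g (ω i) := by
  refine Measure.pi_eq fun s hs => ?_
  have hbox : MeasurableSet (Set.univ.pi s) := MeasurableSet.univ_pi hs
  rw [withDensity_apply _ hbox, ← lintegral_indicator hbox]
  have h1 : ∀ ω : ι → Ω, (Set.univ.pi s).indicator (fun ω => ∏ i, g (ω i)) ω
      = ∏ i, (s i).indicator g (ω i) := by
    intro ω
    by_cases hω : ω ∈ Set.univ.pi s
    · rw [indicator_of_mem hω]
      exact Finset.prod_congr rfl fun i _ => (indicator_of_mem (hω i (mem_univ i)) _).symm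
    · rw [indicator_of_notMem hω]
      simp only [mem_univ_pi, not_forall] at hω
      obtain ⟨i, hi⟩ := hω
      exact (Finset.prod_eq_zero (Finset.mem_univ i) (indicator_of_notMem hi _)).symm
  simp_rw [h1]
  rw [lintegral_prod_eval_pi μ fun i => hg.indicator (hs i)]
  exact Finset.prod_congr rfl fun i _ => by
    rw [lintegral_indicator (hs i), withDensity_apply _ (hs i)]

lemma integral_indicator_mul_prod {Ω : Type*} [MeasurableSpace Ω] (μ : Measure Ω)
    [IsProbabilityMeasure μ] {T : ℕ} (t : Fin T) {B : Set Ω} (hB : MeasurableSet B)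
    (φ : Ω → ℝ) :
    ∫ ω in {ω : Fin T → Ω | ω t ∈ B}, ∏ s, φ (ω s) ∂(Measure.pi fun _ : Fin T => μ)
      = (∫ z in B, φ z ∂μ) * (∫ z, φ z ∂μ) ^ (T - 1) := by
  have hBt : MeasurableSet {ω : Fin T → Ω | ω t ∈ B} := measurable_pi_apply t hB
  rw [← integral_indicator hBt]
  have h1 : ∀ ω : Fin T → Ω, ({ω : Fin T → Ω | ω t ∈ B}).indicator (fun ω => ∏ s, φ (ω s)) ω
      = ∏ s, (if s = t then B.indicator φ else φ) (ω s) := by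
    intro ω
    by_cases hω : ω t ∈ B
    · have hω' : ω ∈ {ω : Fin T → Ω | ω t ∈ B} := hω
      rw [indicator_of_mem hω']
      refine Finset.prod_congr rfl fun s _ => ?_
      by_cases hs : s = t
      · subst hs; rw [if_pos rfl, indicator_of_mem hω]
      · rw [if_neg hs]
    · have hω' : ω ∉ {ω : Fin T → Ω | ω t ∈ B} := hω
      rw [indicator_of_notMem hω']
      refine (Finset.prod_eq_zero (Finset.mem_univ t) ?_).symm
      rw [if_pos rfl, indicator_of_notMem hω]
  simp_rw [h1]
  rw [integral_fintype_prod_eq_prod (fun (s : Fin T) z => (if s = t then B.indicator φ else φ) z),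
    ← Finset.mul_prod_erase _ _ (Finset.mem_univ t), if_pos rfl, integral_indicator hB]
  congr 1
  rw [Finset.prod_congr rfl (fun s hs => by rw [if_neg (Finset.ne_of_mem_erase hs)]),
    Finset.prod_const, Finset.card_erase_of_mem (Finset.mem_univ t), Finset.card_univ,
    Fintype.card_fin]

/-- Two laws of one round with densities `1 + u` and `1 - u`, where `|u| = h` on `B` and `u = 0`
elsewhere. If `T` rounds carry little information, then no event of the path separates the two
laws on the paths with `ω t ∈ B`.

The proof bounds the minimum of the two densities `a`, `b` of the paths from below by
`(a + b) / 2 - (a - b) ^ 2 / 2 - 1 / 8`, whose integral factorizes over the rounds. -/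
lemma two_point_bound {Ω : Type*} [MeasurableSpace Ω] (μ : Measure Ω) [IsProbabilityMeasure μ]
    {T : ℕ} (t : Fin T) {B : Set Ω} (hB : MeasurableSet B) {u : Ω → ℝ} (hu : Measurable u)
    {h : ℝ} (hsq : ∀ᵐ z ∂μ, u z ^ 2 = B.indicator (fun _ => h ^ 2) z) (h1 : |h| ≤ 1)
    (hmean : ∫ z, u z ∂μ = 0) (hsmall : h ^ 2 + T * (μ.real B * h ^ 2) ≤ 1 / 8)
    {A : Set (Fin T → Ω)} (hA : MeasurableSet A) :
    ENNReal.ofReal (μ.real B / 2) ≤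
      (Measure.pi fun _ : Fin T => μ.withDensity fun z => ENNReal.ofReal (1 + u z))
        ({ω | ω t ∈ B} ∩ A) +
      (Measure.pi fun _ : Fin T => μ.withDensity fun z => ENNReal.ofReal (1 - u z))
        ({ω | ω t ∈ B} ∩ Aᶜ) := by
  set p := μ.real B with hp
  set P := Measure.pi fun _ : Fin T => μ with hP
  have hp0 : 0 ≤ p := measureReal_nonneg
  have habs : ∀ᵐ z ∂μ, |u z| ≤ 1 := by
    filter_upwards [hsq] with z hz
    rw [← sq_le_one_iff_abs_le_one, hz]
    refine (indicator_le_self' (fun _ _ => sq_nonneg h) z).trans ?_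
    rwa [sq_le_one_iff_abs_le_one]
  have hui : Integrable u μ := Integrable.of_bound (C := 1) hu.aestronglyMeasurable
    (by simpa [Real.norm_eq_abs] using habs)
  have hu2 : Integrable (fun z => u z ^ 2) μ :=
    Integrable.of_bound (C := 1) (hu.pow_const 2).aestronglyMeasurable (by
      filter_upwards [habs] with z hz
      rw [Real.norm_eq_abs, abs_pow]; exact pow_le_one₀ (abs_nonneg _) hz)
  have hBu : ∫ z in B, u z ∂μ = 0 := by
    rw [← integral_indicator hB, ← hmean]
    refine integral_congr_ae ?_
    filter_upwards [hsq] with z hz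
    by_cases hzB : z ∈ B
    · rw [indicator_of_mem hzB]
    · rw [indicator_of_notMem hzB] at hz ⊢
      exact (pow_eq_zero_iff two_ne_zero).1 hz |>.symm
  have hu2int : ∫ z, u z ^ 2 ∂μ = p * h ^ 2 := by
    rw [integral_congr_ae hsq, integral_indicator hB, setIntegral_const, smul_eq_mul]
  have hBu2 : ∫ z in B, u z ^ 2 ∂μ = p * h ^ 2 := by
    rw [← integral_indicator hB, ← hu2int]
    refine integral_congr_ae ?_
    filter_upwards [hsq] with z hz
    by_cases hzB : z ∈ B
    · rw [indicator_of_mem hzB]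
    · rw [indicator_of_notMem hzB] at hz ⊢
      exact hz.symm
  -- first and second moments of the densities of one round
  have m1 : ∀ σ : ℝ, ∫ z, (1 + σ * u z) ∂μ = 1 := by
    intro σ
    rw [integral_add (integrable_const 1) (hui.const_mul σ), integral_const_mul, hmean]; simp
  have m1B : ∀ σ : ℝ, ∫ z in B, (1 + σ * u z) ∂μ = p := by
    intro σ
    rw [integral_add (integrable_const 1) (hui.const_mul σ).integrableOn, integral_const_mul, hBu]
    simp [hp]
  have m2 : ∀ a b : ℝ, ∫ z, (1 + a * u z + b * u z ^ 2) ∂μ = 1 + b * (p * h ^ 2) := by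
    intro a b
    have e1 : Integrable (fun z => 1 + a * u z) μ := (integrable_const 1).add (hui.const_mul a)
    rw [integral_add e1 (hu2.const_mul b), m1, integral_const_mul, hu2int]
  have m2B : ∀ a b : ℝ, ∫ z in B, (1 + a * u z + b * u z ^ 2) ∂μ = p + b * (p * h ^ 2) := by
    intro a b
    have e1 : Integrable (fun z => 1 + a * u z) μ := (integrable_const 1).add (hui.const_mul a)
    rw [integral_add e1.integrableOn (hu2.const_mul b).integrableOn, m1B, integral_const_mul, hBu2]
  have hprob : ∀ σ : ℝ, |σ| = 1 →
      IsProbabilityMeasure (μ.withDensity fun z => ENNReal.ofReal (1 + σ * u z)) := by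
    intro σ hσ
    have hi : Integrable (fun z => 1 + σ * u z) μ := (integrable_const 1).add (hui.const_mul σ)
    refine ⟨?_⟩
    rw [withDensity_apply _ MeasurableSet.univ, Measure.restrict_univ,
      ← ofReal_integral_eq_lintegral_ofReal hi, m1, ENNReal.ofReal_one]
    filter_upwards [habs] with z hz
    have h2 : |σ * u z| ≤ 1 := by rw [abs_mul, hσ, one_mul]; exact hz
    have := (abs_le.1 h2).1
    show 0 ≤ 1 + σ * u z
    linarith
  have hpm : IsProbabilityMeasure (μ.withDensity fun z => ENNReal.ofReal (1 + u z)) := by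
    simpa using hprob 1 (by simp)
  have hpm' : IsProbabilityMeasure (μ.withDensity fun z => ENNReal.ofReal (1 - u z)) := by
    simpa [sub_eq_add_neg] using hprob (-1) (by simp)
  have hg : Measurable fun z => ENNReal.ofReal (1 + u z) := (measurable_const.add hu).ennreal_ofReal
  have hg' : Measurable fun z => ENNReal.ofReal (1 - u z) := (measurable_const.sub hu).ennreal_ofReal
  have hBt : MeasurableSet {ω : Fin T → Ω | ω t ∈ B} := measurable_pi_apply t hB
  rw [pi_withDensity μ hg, pi_withDensity μ hg', withDensity_apply _ (hBt.inter hA),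
    withDensity_apply _ (hBt.inter hA.compl)]
  set a : (Fin T → Ω) → ℝ := fun ω => ∏ s, (1 + u (ω s)) with ha
  set b : (Fin T → Ω) → ℝ := fun ω => ∏ s, (1 - u (ω s)) with hb
  set F : (Fin T → Ω) → ℝ := fun ω => (a ω + b ω) / 2 - (a ω - b ω) ^ 2 / 2 - 1 / 8 with hF
  have hum : ∀ s : Fin T, Measurable fun ω : Fin T → Ω => u (ω s) := fun s =>
    hu.comp (measurable_pi_apply s)
  have ham : Measurable a := Finset.measurable_fun_prod _ fun s _ => measurable_const.add (hum s)
  have hbm : Measurable b := Finset.measurable_fun_prod _ fun s _ => measurable_const.sub (hum s)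
  have hFm : Measurable F := by simp only [hF]; fun_prop
  have hωabs : ∀ᵐ ω ∂P, ∀ s : Fin T, |u (ω s)| ≤ 1 := by
    rw [ae_all_iff]
    exact fun s => (measurePreserving_eval (fun _ : Fin T => μ) s).quasiMeasurePreserving.ae habs
  have hFa : ∀ᵐ ω ∂P, ENNReal.ofReal (F ω) ≤ ∏ s, ENNReal.ofReal (1 + u (ω s)) := by
    filter_upwards [hωabs] with ω hω
    rw [← ENNReal.ofReal_prod_of_nonneg fun s _ => by linarith [(abs_le.1 (hω s)).1]]
    refine ENNReal.ofReal_le_ofReal ?_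
    show F ω ≤ a ω
    simp only [hF]
    nlinarith [sq_nonneg (b ω - a ω - 1 / 2)]
  have hFb : ∀ᵐ ω ∂P, ENNReal.ofReal (F ω) ≤ ∏ s, ENNReal.ofReal (1 - u (ω s)) := by
    filter_upwards [hωabs] with ω hω
    rw [← ENNReal.ofReal_prod_of_nonneg fun s _ => by linarith [(abs_le.1 (hω s)).2]]
    refine ENNReal.ofReal_le_ofReal ?_
    show F ω ≤ b ω
    simp only [hF]
    nlinarith [sq_nonneg (a ω - b ω - 1 / 2)]
  have hsplit : ∫⁻ ω in {ω : Fin T → Ω | ω t ∈ B}, ENNReal.ofReal (F ω) ∂P ≤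
      ∫⁻ ω in {ω | ω t ∈ B} ∩ A, ∏ s, ENNReal.ofReal (1 + u (ω s)) ∂P +
      ∫⁻ ω in {ω | ω t ∈ B} ∩ Aᶜ, ∏ s, ENNReal.ofReal (1 - u (ω s)) ∂P := by
    rw [← lintegral_inter_add_sdiff _ {ω : Fin T → Ω | ω t ∈ B} hA, sdiff_eq]
    exact add_le_add (lintegral_mono_ae (ae_restrict_of_ae hFa))
      (lintegral_mono_ae (ae_restrict_of_ae hFb))
  refine le_trans ?_ hsplit
  -- the integral of `F`
  have hTb : ∀ φ : Ω → ℝ, Measurable φ → (∀ᵐ z ∂μ, |φ z| ≤ 4) →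
      Integrable (fun ω : Fin T → Ω => ∏ s, φ (ω s)) P := by
    intro φ hφ hφ4
    exact Integrable.fintype_prod (f := fun _ : Fin T => φ) (μ := fun _ => μ) fun _ =>
      Integrable.of_bound (C := 4) hφ.aestronglyMeasurable (by simpa [Real.norm_eq_abs] using hφ4)
  have ia : Integrable a P := hTb (fun z => 1 + u z) (measurable_const.add hu) (by
    filter_upwards [habs] with z hz
    have := abs_le.1 hz
    rw [abs_le]; constructor <;> linarith)
  have ib : Integrable b P := hTb (fun z => 1 - u z) (measurable_const.sub hu) (by
    filter_upwards [habs] with z hz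
    have := abs_le.1 hz
    rw [abs_le]; constructor <;> linarith)
  set aa : (Fin T → Ω) → ℝ := fun ω => ∏ s, (1 + 2 * u (ω s) + 1 * u (ω s) ^ 2) with haa
  set bb : (Fin T → Ω) → ℝ := fun ω => ∏ s, (1 + (-2) * u (ω s) + 1 * u (ω s) ^ 2) with hbb
  set ab : (Fin T → Ω) → ℝ := fun ω => ∏ s, (1 + 0 * u (ω s) + (-1) * u (ω s) ^ 2) with hab
  have eaa : ∀ ω, a ω ^ 2 = aa ω := fun ω => by
    simp only [ha, haa, ← Finset.prod_pow]; exact Finset.prod_congr rfl fun s _ => by ring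
  have ebb : ∀ ω, b ω ^ 2 = bb ω := fun ω => by
    simp only [hb, hbb, ← Finset.prod_pow]; exact Finset.prod_congr rfl fun s _ => by ring
  have eab : ∀ ω, a ω * b ω = ab ω := fun ω => by
    simp only [ha, hb, hab, ← Finset.prod_mul_distrib]
    exact Finset.prod_congr rfl fun s _ => by ring
  have hq4 : ∀ c e : ℝ, |c| ≤ 2 → |e| ≤ 1 → ∀ᵐ z ∂μ, |1 + c * u z + e * u z ^ 2| ≤ 4 := by
    intro c e hc he
    filter_upwards [habs] with z hz
    have e1 : |c * u z| ≤ 2 := by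
      rw [abs_mul]
      calc |c| * |u z| ≤ 2 * 1 := mul_le_mul hc hz (abs_nonneg _) (by norm_num)
        _ = 2 := by norm_num
    have e2 : |e * u z ^ 2| ≤ 1 := by
      rw [abs_mul, abs_pow]
      exact mul_le_one₀ he (by positivity) (pow_le_one₀ (abs_nonneg _) hz)
    have e1' := abs_le.1 e1
    have e2' := abs_le.1 e2
    rw [abs_le]; constructor <;> linarith
  have hqm : ∀ c e : ℝ, Measurable fun z => 1 + c * u z + e * u z ^ 2 := fun c e => by fun_prop
  have iaa : Integrable aa P := hTb _ (hqm 2 1) (hq4 _ _ (by norm_num) (by norm_num))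
  have ibb : Integrable bb P := hTb _ (hqm (-2) 1) (hq4 _ _ (by norm_num) (by norm_num))
  have iab : Integrable ab P := hTb _ (hqm 0 (-1)) (hq4 _ _ (by norm_num) (by norm_num))
  have hFe : F = fun ω => (1 / 2) * a ω + (1 / 2) * b ω - (1 / 2) * aa ω - (1 / 2) * bb ω + ab ω
      - 1 / 8 := by
    funext ω
    rw [← eaa, ← ebb, ← eab]; simp only [hF]; ring
  have hFi : Integrable F P := by
    rw [hFe]
    exact (((((ia.const_mul _).add (ib.const_mul _)).sub (iaa.const_mul _)).sub
      (ibb.const_mul _)).add iab).sub (integrable_const _)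
  set S := {ω : Fin T → Ω | ω t ∈ B} with hS
  have va : ∫ ω in S, a ω ∂P = p := by
    have := integral_indicator_mul_prod μ t hB (fun z => 1 + u z)
    have q1 := m1 1
    have q2 := m1B 1
    simp only [one_mul] at q1 q2
    rw [q1, q2, one_pow, mul_one] at this
    exact this
  have vb : ∫ ω in S, b ω ∂P = p := by
    have := integral_indicator_mul_prod μ t hB (fun z => 1 - u z)
    have q1 := m1 (-1)
    have q2 := m1B (-1)
    simp only [neg_mul, one_mul, ← sub_eq_add_neg] at q1 q2
    rw [q1, q2, one_pow, mul_one] at this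
    exact this
  have vaa : ∫ ω in S, aa ω ∂P = (p + 1 * (p * h ^ 2)) * (1 + 1 * (p * h ^ 2)) ^ (T - 1) := by
    have := integral_indicator_mul_prod μ t hB (fun z => 1 + 2 * u z + 1 * u z ^ 2)
    rw [m2, m2B] at this; exact this
  have vbb : ∫ ω in S, bb ω ∂P = (p + 1 * (p * h ^ 2)) * (1 + 1 * (p * h ^ 2)) ^ (T - 1) := by
    have := integral_indicator_mul_prod μ t hB (fun z => 1 + (-2) * u z + 1 * u z ^ 2)
    rw [m2, m2B] at this; exact this
  have vab : ∫ ω in S, ab ω ∂P = (p + (-1) * (p * h ^ 2)) * (1 + (-1) * (p * h ^ 2)) ^ (T - 1) := by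
    have := integral_indicator_mul_prod μ t hB (fun z => 1 + 0 * u z + (-1) * u z ^ 2)
    rw [m2, m2B] at this; exact this
  have vS : P.real S = p := by
    rw [hS, hp, measureReal_def, measureReal_def]
    congr 1
    exact (measurePreserving_eval (fun _ : Fin T => μ) t).measure_preimage hB.nullMeasurableSet
  have vF : ∫ ω in S, F ω ∂P = p - (p + 1 * (p * h ^ 2)) * (1 + 1 * (p * h ^ 2)) ^ (T - 1)
      + (p + (-1) * (p * h ^ 2)) * (1 + (-1) * (p * h ^ 2)) ^ (T - 1) - p / 8 := by
    have j1 : Integrable (fun ω => (1 / 2) * a ω + (1 / 2) * b ω) (P.restrict S) :=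
      ((ia.const_mul _).add (ib.const_mul _)).integrableOn
    have j2 : Integrable (fun ω => (1 / 2) * a ω + (1 / 2) * b ω - (1 / 2) * aa ω)
      (P.restrict S) := j1.sub (iaa.const_mul _).integrableOn
    have j3 : Integrable (fun ω => (1 / 2) * a ω + (1 / 2) * b ω - (1 / 2) * aa ω
      - (1 / 2) * bb ω) (P.restrict S) := j2.sub (ibb.const_mul _).integrableOn
    have j4 : Integrable (fun ω => (1 / 2) * a ω + (1 / 2) * b ω - (1 / 2) * aa ω
      - (1 / 2) * bb ω + ab ω) (P.restrict S) := j3.add iab.integrableOn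
    rw [hFe, integral_sub j4 (integrable_const _), integral_add j3 iab.integrableOn,
      integral_sub j2 (ibb.const_mul _).integrableOn,
      integral_sub j1 (iaa.const_mul _).integrableOn,
      integral_add (ia.const_mul _).integrableOn (ib.const_mul _).integrableOn,
      integral_const_mul, integral_const_mul, integral_const_mul, integral_const_mul, va, vb,
      vaa, vbb, vab, setIntegral_const, vS, smul_eq_mul]
    ring
  have hfin : p / 2 ≤ ∫ ω in S, F ω ∂P := by
    rw [vF]
    have hT : 1 ≤ T := by have := t.2; omega
    obtain ⟨m, rfl⟩ : ∃ m, T = m + 1 := ⟨T - 1, by omega⟩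
    simp only [Nat.add_sub_cancel]
    push_cast at hsmall
    set e := p * h ^ 2 with he
    have hh0 : 0 ≤ h ^ 2 := sq_nonneg h
    have he0 : 0 ≤ e := by positivity
    have hm0 : (0 : ℝ) ≤ m := Nat.cast_nonneg m
    have hme : 0 ≤ m * e := by positivity
    have hp1 : p ≤ 1 := measureReal_le_one
    have up : (1 + h ^ 2) * (1 + e) ^ m ≤ 1 + 1 / 4 := by
      calc (1 + h ^ 2) * (1 + e) ^ m ≤ Real.exp (h ^ 2) * Real.exp e ^ m := by
            gcongr
            · linarith [Real.add_one_le_exp (h ^ 2)]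
            · linarith [Real.add_one_le_exp e]
        _ = Real.exp (h ^ 2 + m * e) := by rw [← Real.exp_nat_mul, ← Real.exp_add]
        _ ≤ 1 + 2 * (h ^ 2 + m * e) := by
            have hx0 : 0 ≤ h ^ 2 + m * e := by positivity
            have hx : h ^ 2 + m * e ≤ 1 / 8 := by linarith
            have h3 := Real.abs_exp_sub_one_le (x := h ^ 2 + m * e)
              (by rw [abs_of_nonneg hx0]; linarith)
            rw [abs_of_nonneg hx0] at h3
            linarith [(abs_le.1 h3).2]
        _ ≤ _ := by linarith
    have low : 1 - 1 / 8 ≤ (1 - h ^ 2) * (1 - e) ^ m := by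
      have hb1 : 1 + (m : ℝ) * (-e) ≤ (1 + -e) ^ m := one_add_mul_le_pow (by linarith) m
      have h4 : 0 ≤ 1 - h ^ 2 := by linarith
      calc (1 : ℝ) - 1 / 8 ≤ (1 - h ^ 2) * (1 + m * (-e)) := by nlinarith
        _ ≤ (1 - h ^ 2) * (1 + -e) ^ m := by gcongr
        _ = _ := by rw [← sub_eq_add_neg]
    have e1 : (p + 1 * e) * (1 + 1 * e) ^ m = p * ((1 + h ^ 2) * (1 + e) ^ m) := by
      rw [he]; ring
    have e2 : (p + (-1) * e) * (1 + (-1) * e) ^ m = p * ((1 - h ^ 2) * (1 - e) ^ m) := by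
      rw [he]; ring
    rw [e1, e2]
    have q1 := mul_le_mul_of_nonneg_left up hp0
    have q2 := mul_le_mul_of_nonneg_left low hp0
    linarith
  refine (ENNReal.ofReal_le_ofReal hfin).trans ?_
  exact ofReal_integral_le_lintegral_ofReal hFi.integrableOn

/-! ### Regret over a hypercube of environments -/

/-- The function with value `a κ * h` on `B κ`, and `0` outside all of these disjoint sets. -/
noncomputable def stepFun {ι X : Type*} [Fintype ι] (B : ι → Set X) (h : ℝ) (a : ι → ℝ) (x : X) :
    ℝ :=
  ∑ κ, a κ * (B κ).indicator (fun _ => h) x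

lemma measurable_stepFun {ι X : Type*} [Fintype ι] [MeasurableSpace X] {B : ι → Set X}
    (hB : ∀ κ, MeasurableSet (B κ)) (h : ℝ) (a : ι → ℝ) : Measurable (stepFun B h a) :=
  Finset.measurable_fun_sum _ fun κ _ => (measurable_const.indicator (hB κ)).const_mul _

lemma stepFun_of_mem {ι X : Type*} [Fintype ι] {B : ι → Set X}
    (hdisj : Pairwise fun i j => Disjoint (B i) (B j)) (h : ℝ) (a : ι → ℝ) {κ : ι} {x : X}
    (hx : x ∈ B κ) : stepFun B h a x = a κ * h := by
  unfold stepFun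
  rw [Finset.sum_eq_single κ, indicator_of_mem hx]
  · intro j _ hj
    rw [indicator_of_notMem (disjoint_left.1 (hdisj hj.symm) hx), mul_zero]
  · simp

lemma stepFun_of_notMem {ι X : Type*} [Fintype ι] {B : ι → Set X} (h : ℝ) (a : ι → ℝ) {x : X}
    (hx : ∀ κ, x ∉ B κ) : stepFun B h a x = 0 :=
  Finset.sum_eq_zero fun κ _ => by rw [indicator_of_notMem (hx κ), mul_zero]

lemma abs_stepFun_le {ι X : Type*} [Fintype ι] {B : ι → Set X}
    (hdisj : Pairwise fun i j => Disjoint (B i) (B j)) {h : ℝ} (h0 : 0 ≤ h) {a : ι → ℝ}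
    (ha : ∀ κ, |a κ| ≤ 1) (x : X) : |stepFun B h a x| ≤ h := by
  by_cases hx : ∃ κ, x ∈ B κ
  · obtain ⟨κ, hκ⟩ := hx
    rw [stepFun_of_mem hdisj h a hκ, abs_mul, abs_of_nonneg h0]
    exact mul_le_of_le_one_left h0 (ha κ)
  · push Not at hx
    rwa [stepFun_of_notMem h a hx, abs_zero]

/-- Gaps with disjoint supports tilt the law one after the other. -/
lemma biasedLaw_add {d : ℕ} (μ : Measure (Ctx d)) {v u : Ctx d → ℝ}
    (hv : Measurable v) (hu : Measurable u) (hvu : ∀ x, v x = 0 ∨ u x = 0) :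
    biasedLaw μ (fun x => v x + u x) = (biasedLaw μ v).withDensity
      fun o => ENNReal.ofReal (1 + u o.1 * rewardDiff o.2) := by
  unfold biasedLaw
  rw [← withDensity_mul _ (measurable_density hv) (measurable_density hu)]
  congr 1
  funext o
  rcases hvu o.1 with h | h <;> simp [h]

lemma abs_armSign_le (k : Arm) : |armSign k| ≤ 1 := by
  cases k <;> simp [armSign]

/-- Flipping the sign of the gap on one of the sets `B κ` makes a policy err there in one of the two
environments. -/
lemma error_add_error_ge {d T : ℕ} (μ : Measure (Ctx d)) [IsProbabilityMeasure μ]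
    {ι : Type*} [Fintype ι] [DecidableEq ι] {B : ι → Set (Ctx d)}
    (hB : ∀ κ, MeasurableSet (B κ)) (hdisj : Pairwise fun i j => Disjoint (B i) (B j))
    {p h : ℝ} (h0 : 0 ≤ h) (h1 : h ≤ 1) (hsmall : h ^ 2 + T * (p * h ^ 2) ≤ 1 / 8)
    (κ : ι) (hp : μ.real (B κ) = p) (t : Fin T) {arm : Path d T → Arm} (harm : Measurable arm)
    (σ : ι → Arm) :
    ENNReal.ofReal (p / 2) ≤
      (Measure.pi fun _ : Fin T => biasedLaw μ (stepFun B h fun j => armSign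
        (Function.update σ κ true j))) ({ω | (ω t).1 ∈ B κ} ∩ {ω | arm ω = false}) +
      (Measure.pi fun _ : Fin T => biasedLaw μ (stepFun B h fun j => armSign
        (Function.update σ κ false j))) ({ω | (ω t).1 ∈ B κ} ∩ {ω | arm ω = true}) := by
  -- the common law of the two environments, without a gap on `B κ`
  set a : ι → ℝ := Function.update (fun j => armSign (σ j)) κ 0 with ha
  have ha1 : ∀ j, |a j| ≤ 1 := by
    intro j
    by_cases hj : j = κ
    · subst hj; simp [ha]
    · simp only [ha, Function.update_of_ne hj]; exact abs_armSign_le _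
  set v := stepFun B h a with hv
  have hvm : Measurable v := measurable_stepFun hB h a
  have hv1 : ∀ x, |v x| ≤ 1 := fun x => (abs_stepFun_le hdisj h0 ha1 x).trans h1
  set w : Ctx d → ℝ := (B κ).indicator fun _ => h with hw
  have hwm : Measurable w := measurable_const.indicator (hB κ)
  have hvw : ∀ x, v x = 0 ∨ w x = 0 := by
    intro x
    by_cases hx : x ∈ B κ
    · left
      rw [hv, stepFun_of_mem hdisj h a hx, ha, Function.update_self, zero_mul]
    · right; exact indicator_of_notMem hx _
  have hstep : ∀ b : Arm, (stepFun B h fun j => armSign (Function.update σ κ b j))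
      = fun x => v x + armSign b * w x := by
    intro b
    funext x
    by_cases hx : ∃ j, x ∈ B j
    · obtain ⟨j, hj⟩ := hx
      rw [stepFun_of_mem hdisj h _ hj, hv, stepFun_of_mem hdisj h _ hj]
      by_cases hjκ : j = κ
      · subst hjκ
        simp [ha, hw, indicator_of_mem hj]
      · have hxκ : x ∉ B κ := disjoint_left.1 (hdisj hjκ) hj
        simp [ha, hw, Function.update_of_ne hjκ, indicator_of_notMem hxκ]
    · push Not at hx
      rw [stepFun_of_notMem h _ hx, hv, stepFun_of_notMem h _ hx, hw,
        indicator_of_notMem (hx κ), mul_zero, add_zero]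
  have hlaw : ∀ b : Arm, biasedLaw μ (stepFun B h fun j => armSign (Function.update σ κ b j))
      = (biasedLaw μ v).withDensity
        fun o => ENNReal.ofReal (1 + armSign b * w o.1 * rewardDiff o.2) := by
    intro b
    rw [hstep b]
    exact biasedLaw_add μ hvm (hwm.const_mul _) fun x =>
      (hvw x).imp_right fun h => by rw [h, mul_zero]
  have hprob := isProbabilityMeasure_biasedLaw μ hvm hv1
  set u : Outcome d → ℝ := fun o => w o.1 * rewardDiff o.2 with hu
  have hum : Measurable u :=
    (hwm.comp measurable_fst).mul (measurable_rewardDiff.comp measurable_snd)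
  have hBm : MeasurableSet (Prod.fst ⁻¹' B κ : Set (Outcome d)) := measurable_fst (hB κ)
  have hBp : (biasedLaw μ v).real (Prod.fst ⁻¹' B κ) = p := by
    rw [← hp, measureReal_def, measureReal_def, ← Measure.map_apply measurable_fst (hB κ),
      map_fst_biasedLaw μ hvm hv1]
  have hsq : ∀ᵐ o ∂biasedLaw μ v,
      u o ^ 2 = (Prod.fst ⁻¹' B κ : Set (Outcome d)).indicator (fun _ => h ^ 2) o := by
    filter_upwards [ae_biasedLaw μ v] with o ho
    have hr : rewardDiff o.2 ^ 2 = 1 := by rcases ho with h | h <;> rw [h] <;> simp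
    simp only [hu, mul_pow, hr, mul_one]
    by_cases hx : o.1 ∈ B κ
    · rw [hw, indicator_of_mem hx, indicator_of_mem (show o ∈ Prod.fst ⁻¹' B κ from hx)]
    · rw [hw, indicator_of_notMem hx, indicator_of_notMem (show o ∉ Prod.fst ⁻¹' B κ from hx)]
      norm_num
  have hw1 : ∀ x, |w x| ≤ 1 := by
    intro x
    rw [hw, abs_of_nonneg (indicator_nonneg (fun _ _ => h0) x)]
    exact (indicator_le_self' (fun _ _ => h0) x).trans h1
  have hmean : ∫ o, u o ∂biasedLaw μ v = 0 := by
    rw [integral_biasedLaw μ hvm hv1 hum (C := 1)]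
    · refine integral_eq_zero_of_ae (Filter.Eventually.of_forall fun x => ?_)
      simp only [hu, rewardDiff_true, rewardDiff_false, Pi.zero_apply]
      rcases hvw x with h | h <;> rw [h] <;> ring
    · intro x b
      cases b <;> simpa [hu] using hw1 x
  have key := two_point_bound (biasedLaw μ v) t hBm hum hsq (by rwa [abs_of_nonneg h0]) hmean
    (by rwa [hBp]) (A := {ω | arm ω = false})
    (harm (MeasurableSpace.measurableSet_top (s := {false})))
  rw [hBp] at key
  have hcompl : ({ω | arm ω = false} : Set (Path d T))ᶜ = {ω | arm ω = true} := by
    ext ω; simp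
  rw [hcompl] at key
  rw [hlaw true, hlaw false]
  simpa [armSign, hu, ← sub_eq_add_neg] using key

/-- Every policy has large regret in one of the environments whose gap is `± h` on the sets `B κ`,
with independent signs, if the rounds in a single set do not reveal its sign. -/
lemma exists_regret_ge {d T M : ℕ} (μ : Measure (Ctx d)) [IsProbabilityMeasure μ]
    {ι : Type*} [Fintype ι] {B : ι → Set (Ctx d)}
    (hB : ∀ κ, MeasurableSet (B κ)) (hdisj : Pairwise fun i j => Disjoint (B i) (B j))
    {p h : ℝ} (h0 : 0 ≤ h) (h1 : h ≤ 1) (hsmall : h ^ 2 + T * (p * h ^ 2) ≤ 1 / 8)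
    (hp : ∀ κ, μ.real (B κ) = p) (E : (ι → Arm) → Environment d)
    (hlaw : ∀ σ, (E σ).law = biasedLaw μ (stepFun B h fun κ => armSign (σ κ)))
    (hgap : ∀ σ κ, ∀ x ∈ B κ, (E σ).gap x = armSign (σ κ) * h) (π : BatchPolicy d T M) :
    ∃ σ, ENNReal.ofReal (T * Fintype.card ι * (h * p) / 4) ≤ regret π (E σ) := by
  classical
  set q : Fin T → ι → (ι → Arm) → ℝ≥0∞ := fun t κ σ =>
    (Measure.pi fun _ : Fin T => (E σ).law) ({ω | (ω t).1 ∈ B κ} ∩ {ω | π.arm t ω = !(σ κ)}) with hq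
  have hmeas : ∀ t κ b, MeasurableSet ({ω : Path d T | (ω t).1 ∈ B κ} ∩ {ω | π.arm t ω = b}) :=
    fun t κ b => (measurable_fst.comp (measurable_pi_apply t) (hB κ)).inter
      (π.measurable_arm t (MeasurableSpace.measurableSet_top (s := {b})))
  -- the regret counts the errors
  have hreg : ∀ σ, ∑ t, ∑ κ, ENNReal.ofReal h * q t κ σ ≤ regret π (E σ) := by
    intro σ
    have e : ∑ t, ∑ κ, ENNReal.ofReal h * q t κ σ = ∫⁻ ω, ∑ t, ∑ κ, ENNReal.ofReal h *
        ({ω : Path d T | (ω t).1 ∈ B κ} ∩ {ω | π.arm t ω = !(σ κ)}).indicator 1 ω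
        ∂(Measure.pi fun _ : Fin T => (E σ).law) := by
      rw [lintegral_finsetSum _ fun t _ => Finset.measurable_fun_sum _ fun κ _ =>
        (measurable_one.indicator (hmeas t κ _)).const_mul _]
      refine Finset.sum_congr rfl fun t _ => ?_
      rw [lintegral_finsetSum _ fun κ _ => (measurable_one.indicator (hmeas t κ _)).const_mul _]
      refine Finset.sum_congr rfl fun κ _ => ?_
      rw [lintegral_const_mul _ (measurable_one.indicator (hmeas t κ _)),
        lintegral_indicator_one (hmeas t κ _)]
    rw [e]
    refine lintegral_mono fun ω => Finset.sum_le_sum fun t _ => ?_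
    by_cases hx : ∃ κ, (ω t).1 ∈ B κ
    · obtain ⟨κ, hκ⟩ := hx
      rw [Finset.sum_eq_single κ]
      · by_cases harm : π.arm t ω = !(σ κ)
        · rw [(E σ).instant_regret_eq (ω t).1 (π.arm t ω), hgap σ κ _ hκ, abs_mul,
            abs_of_nonneg h0]
          · have : |armSign (σ κ)| = 1 := by cases σ κ <;> simp [armSign]
            rw [this, one_mul]
            exact mul_le_of_le_one_right zero_le (indicator_le_self' (fun _ _ => zero_le) _)
          · rw [hgap σ κ _ hκ, harm]
            cases σ κ <;> simp [armSign, h0]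
        · rw [indicator_of_notMem fun h => harm h.2, mul_zero]; exact zero_le
      · intro j _ hj
        rw [indicator_of_notMem fun h => disjoint_left.1 (hdisj hj.symm) hκ h.1, mul_zero]
      · simp
    · push Not at hx
      refine le_trans (le_of_eq (Finset.sum_eq_zero fun κ _ => ?_)) zero_le
      rw [indicator_of_notMem fun h => hx κ h.1, mul_zero]
  -- flipping one sign
  have hpair : ∀ t κ σ, ENNReal.ofReal (p / 2) ≤
      q t κ σ + q t κ (Function.update σ κ (!(σ κ))) := by
    intro t κ σ
    have key := error_add_error_ge μ hB hdisj h0 h1 hsmall κ (hp κ) t (π.measurable_arm t) σ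
    have e : Function.update σ κ (σ κ) = σ := Function.update_eq_self κ σ
    simp only [hq, hlaw, Function.update_self, Bool.not_not]
    cases hσ : σ κ
    · rw [hσ] at e
      rw [e, add_comm] at key
      simpa using key
    · rw [hσ] at e
      rw [e] at key
      simpa using key
  have hsum : ∀ t κ, Fintype.card (ι → Arm) * ENNReal.ofReal (p / 2) ≤ 2 * ∑ σ, q t κ σ := by
    intro t κ
    have hinv : Function.Involutive fun σ : ι → Arm => Function.update σ κ (!(σ κ)) := by
      intro σ; simp
    have e : ∑ σ, q t κ (Function.update σ κ (!(σ κ))) = ∑ σ, q t κ σ :=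
      Equiv.sum_comp hinv.toPerm (q t κ)
    calc Fintype.card (ι → Arm) * ENNReal.ofReal (p / 2)
        = ∑ _σ : ι → Arm, ENNReal.ofReal (p / 2) := by
          rw [Finset.sum_const, Finset.card_univ, nsmul_eq_mul]
      _ ≤ ∑ σ, (q t κ σ + q t κ (Function.update σ κ (!(σ κ)))) :=
          Finset.sum_le_sum fun σ _ => hpair t κ σ
      _ = 2 * ∑ σ, q t κ σ := by rw [Finset.sum_add_distrib, e, two_mul]
  suffices hs : ∑ _σ : ι → Arm, ENNReal.ofReal (T * Fintype.card ι * (h * p) / 4)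
      ≤ ∑ σ, regret π (E σ) by
    obtain ⟨σ, -, hσ⟩ := ENNReal.exists_le_of_sum_le Finset.univ_nonempty hs
    exact ⟨σ, hσ⟩
  rw [← ENNReal.mul_le_mul_iff_right two_ne_zero ENNReal.ofNat_ne_top]
  calc 2 * ∑ _σ : ι → Arm, ENNReal.ofReal (T * Fintype.card ι * (h * p) / 4)
      = ∑ _t : Fin T, ∑ _κ : ι, ENNReal.ofReal h *
          (Fintype.card (ι → Arm) * ENNReal.ofReal (p / 2)) := by
        simp only [Finset.sum_const, Finset.card_univ, nsmul_eq_mul, Fintype.card_fin]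
        rw [show (T : ℝ) * Fintype.card ι * (h * p) / 4
            = T * (Fintype.card ι * (h * (p / 2))) / 2 by ring,
          ENNReal.ofReal_div_of_pos two_pos, ENNReal.ofReal_mul (by positivity),
          ENNReal.ofReal_mul (by positivity), ENNReal.ofReal_mul h0, ENNReal.ofReal_natCast,
          ENNReal.ofReal_natCast, ENNReal.ofReal_ofNat, mul_left_comm,
          ENNReal.mul_div_cancel two_ne_zero ENNReal.ofNat_ne_top]
        ring
    _ ≤ ∑ t : Fin T, ∑ κ : ι, ENNReal.ofReal h * (2 * ∑ σ, q t κ σ) := by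
        refine Finset.sum_le_sum fun t _ => Finset.sum_le_sum fun κ _ => ?_
        exact mul_le_mul_right (hsum t κ) _
    _ = ∑ σ, 2 * ∑ t, ∑ κ, ENNReal.ofReal h * q t κ σ := by
        simp only [Finset.mul_sum]
        rw [Finset.sum_congr rfl fun t _ => Finset.sum_comm, Finset.sum_comm]
        refine Finset.sum_congr rfl fun σ _ => Finset.sum_congr rfl fun t _ =>
          Finset.sum_congr rfl fun κ _ => by ring
    _ ≤ ∑ σ, 2 * regret π (E σ) := by
        gcongr with σ _
        exact hreg σ
    _ = _ := (Finset.mul_sum _ _ _).symm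

/-! ### An interval with periodic holes -/

/-- The centre of the `k`-th period of length `p`. -/
noncomputable def centre (p : ℝ) (k : ℕ) : ℝ := (k + 1 / 2) * p

/-- The two holes around the centre of the `k`-th period: they separate the bump of diameter `s`
around the centre from the rest of the period. -/
def holes (p s : ℝ) (k : ℕ) : Set ℝ := {y | s / 2 < |y - centre p k| ∧ |y - centre p k| < s}

/-- The interval `[0, N p]` without the holes of its `N` periods. -/
def holedInterval (N : ℕ) (p s : ℝ) : Set ℝ := Icc 0 (N * p) \ ⋃ k ∈ Finset.range N, holes p s k

lemma isOpen_holes (p s : ℝ) (k : ℕ) : IsOpen (holes p s k) := by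
  have h : Continuous fun y => |y - centre p k| := by fun_prop
  exact (isOpen_lt continuous_const h).inter (isOpen_lt h continuous_const)

lemma isClosed_holedInterval (N : ℕ) (p s : ℝ) : IsClosed (holedInterval N p s) :=
  isClosed_Icc.sdiff (isOpen_biUnion fun k _ => isOpen_holes p s k)

lemma measurableSet_holedInterval (N : ℕ) (p s : ℝ) : MeasurableSet (holedInterval N p s) :=
  (isClosed_holedInterval N p s).measurableSet

lemma holedInterval_subset (N : ℕ) (p s : ℝ) : holedInterval N p s ⊆ Icc 0 (N * p) := sdiff_subset

lemma volume_holes_le {p s : ℝ} (hs : 0 ≤ s) (k : ℕ) : volume.real (holes p s k) ≤ s := by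
  have h : holes p s k ⊆ Ioo (centre p k - s) (centre p k - s / 2)
      ∪ Ioo (centre p k + s / 2) (centre p k + s) := by
    rintro y ⟨h1, h2⟩
    rw [abs_lt] at h2
    rcases lt_abs.1 h1 with h | h
    · exact Or.inr ⟨by linarith, by linarith⟩
    · exact Or.inl ⟨by linarith, by linarith⟩
  refine (measureReal_mono h (measure_union_lt_top measure_Ioo_lt_top measure_Ioo_lt_top).ne).trans ?_
  refine (measureReal_union_le _ _).trans ?_
  rw [Real.volume_real_Ioo_of_le (by linarith), Real.volume_real_Ioo_of_le (by linarith)]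
  linarith

lemma volume_biUnion_holes_le {p s : ℝ} (hs : 0 ≤ s) (K : Finset ℕ) :
    volume.real (⋃ k ∈ K, holes p s k) ≤ K.card * s := by
  refine (measureReal_biUnion_finset_le K _).trans ?_
  refine (Finset.sum_le_sum fun k _ => volume_holes_le hs k).trans ?_
  rw [Finset.sum_const, nsmul_eq_mul]

lemma volume_biUnion_holes_ne_top (p s : ℝ) (K : Finset ℕ) :
    volume (⋃ k ∈ K, holes p s k) ≠ ∞ := by
  refine ((measure_biUnion_lt_top K.finite_toSet fun k _ => ?_)).ne
  refine (measure_mono (t := Icc (centre p k - s) (centre p k + s)) ?_).trans_lt measure_Icc_lt_top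
  rintro y ⟨-, h2⟩
  rw [abs_lt] at h2
  exact ⟨by linarith, by linarith⟩

lemma volume_holedInterval_le {N : ℕ} {p s : ℝ} (hp : 0 ≤ p) :
    volume.real (holedInterval N p s) ≤ N * p := by
  refine (measureReal_mono (holedInterval_subset N p s) measure_Icc_lt_top.ne).trans ?_
  rw [Real.volume_real_Icc_of_le (by positivity), sub_zero]

/-- The part of a set outside the holes loses at most the holes which it meets. -/
lemma volume_inter_holedInterval_ge {N : ℕ} {p s : ℝ} (hs : 0 ≤ s) {A : Set ℝ}
    (hA : A ⊆ Icc 0 (N * p)) {K : Finset ℕ}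
    (hK : ∀ k < N, ∀ y ∈ A, y ∈ holes p s k → k ∈ K) :
    volume.real A - K.card * s ≤ volume.real (holedInterval N p s ∩ A) := by
  have hAfin : volume A ≠ ∞ := ((measure_mono hA).trans_lt measure_Icc_lt_top).ne
  have h1 : A ⊆ (holedInterval N p s ∩ A) ∪ ⋃ k ∈ K, holes p s k := by
    intro y hy
    by_cases h : y ∈ ⋃ k ∈ Finset.range N, holes p s k
    · right
      simp only [mem_iUnion, Finset.mem_range, exists_prop] at h ⊢
      obtain ⟨k, hk, hyk⟩ := h
      exact ⟨k, hK k hk y hy hyk, hyk⟩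
    · exact Or.inl ⟨⟨hA hy, h⟩, hy⟩
  have h2 : volume (holedInterval N p s ∩ A) ≠ ∞ :=
    ((measure_mono inter_subset_right).trans_lt hAfin.lt_top).ne
  have h3 := (measureReal_mono h1 (measure_union_ne_top h2
    (volume_biUnion_holes_ne_top p s K))).trans (measureReal_union_le _ _)
  linarith [volume_biUnion_holes_le (p := p) hs K]

lemma volume_holedInterval_ge {N : ℕ} {p s : ℝ} (hp : 0 ≤ p) (hs : 0 ≤ s) :
    N * p - N * s ≤ volume.real (holedInterval N p s) := by
  have h := volume_inter_holedInterval_ge (N := N) (p := p) hs Subset.rfl (K := Finset.range N)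
    fun k hk _ _ _ => Finset.mem_range.2 hk
  rwa [Real.volume_real_Icc_of_le (by positivity), sub_zero, Finset.card_range,
    inter_eq_self_of_subset_left (holedInterval_subset N p s)] at h

lemma exists_period {N : ℕ} (hN : 0 < N) {p : ℝ} (hp : 0 < p) {x : ℝ} (hx : x ∈ Icc 0 (N * p)) :
    ∃ k < N, |x - centre p k| ≤ p / 2 := by
  have h0 : 0 ≤ x / p := div_nonneg hx.1 hp.le
  have key : ∀ k : ℕ, (k : ℝ) ≤ x / p → x / p ≤ k + 1 → |x - centre p k| ≤ p / 2 := by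
    intro k h1 h2
    rw [le_div_iff₀ hp] at h1
    rw [div_le_iff₀ hp] at h2
    unfold centre
    rw [abs_le]
    constructor <;> nlinarith
  by_cases h : ⌊x / p⌋₊ < N
  · exact ⟨_, h, key _ (Nat.floor_le h0) (Nat.lt_floor_add_one _).le⟩
  · have h1 : x / p ≤ N := by rw [div_le_iff₀ hp]; exact hx.2
    have h2 : (N : ℝ) ≤ x / p := (Nat.le_floor_iff h0).1 (not_lt.1 h)
    refine ⟨N - 1, by omega, key _ ?_ ?_⟩ <;>
      rw [Nat.cast_sub (by omega : 1 ≤ N), Nat.cast_one] <;> linarith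

lemma le_abs_centre_sub {p : ℝ} (hp : 0 ≤ p) {j k : ℕ} (hjk : j ≠ k) :
    p ≤ |centre p j - centre p k| := by
  have h : centre p j - centre p k = ((j : ℤ) - (k : ℤ) : ℤ) * p := by
    unfold centre; push_cast; ring
  have h1 : (1 : ℝ) ≤ |(((j : ℤ) - (k : ℤ) : ℤ) : ℝ)| := by
    rw [← Int.cast_abs]
    have h2 : (1 : ℤ) ≤ |(j : ℤ) - k| := Int.one_le_abs (sub_ne_zero.2 (Nat.cast_injective.ne hjk))
    exact_mod_cast h2
  rw [h, abs_mul, abs_of_nonneg hp]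
  nlinarith

lemma mem_holedInterval {N : ℕ} {p s : ℝ} (hp : 0 < p) (hsp : s ≤ p / 4)
    {k : ℕ} (hk : k < N) {y : ℝ} (hy : |y - centre p k| ≤ p / 2)
    (hyk : |y - centre p k| ≤ s / 2 ∨ s ≤ |y - centre p k|) : y ∈ holedInterval N p s := by
  refine ⟨?_, ?_⟩
  · have h1 : (0 : ℝ) ≤ k * p := by positivity
    have h2 : ((k : ℝ) + 1) * p ≤ N * p := by
      have : (k : ℝ) + 1 ≤ N := by exact_mod_cast hk
      gcongr
    rw [abs_le] at hy
    unfold centre at hy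
    constructor <;> linarith
  · simp only [mem_iUnion, Finset.mem_range, exists_prop, not_exists, not_and]
    rintro j - ⟨h1, h2⟩
    by_cases hjk : j = k
    · subst hjk
      rcases hyk with h | h <;> linarith
    · have h3 := le_abs_centre_sub hp.le hjk
      have h4 := abs_sub_le (centre p j) y (centre p k)
      rw [abs_sub_comm (centre p j) y] at h4
      linarith

/-- A ball of radius `r` around a point of an interval of length at least `r` contains a
subinterval of length `r`. -/
lemma exists_subinterval {a b x r : ℝ} (hx : x ∈ Icc a b) (hr : 0 ≤ r) (hrb : r ≤ b - a) :
    ∃ u, Icc u (u + r) ⊆ Icc a b ∧ Icc u (u + r) ⊆ Icc (x - r) (x + r) := by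
  refine ⟨max a (x - r), ?_, ?_⟩ <;> refine Icc_subset_Icc ?_ ?_
  · exact le_max_left _ _
  · rcases max_cases a (x - r) with ⟨h, _⟩ | ⟨h, _⟩ <;> rw [h] <;> linarith [hx.2]
  · exact le_max_right _ _
  · rcases max_cases a (x - r) with ⟨h, _⟩ | ⟨h, _⟩ <;> rw [h] <;> linarith [hx.1]

lemma volume_ball_inter_ge_of_component {S : Set ℝ} {a b x r : ℝ} (hS : Icc a b ⊆ S)
    (hx : x ∈ Icc a b) (hr : 0 ≤ r) (hrb : r ≤ b - a) :
    r ≤ volume.real (S ∩ Icc (x - r) (x + r)) := by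
  obtain ⟨u, h1, h2⟩ := exists_subinterval hx hr hrb
  calc r = volume.real (Icc u (u + r)) := by rw [Real.volume_real_Icc_of_le (by linarith)]; ring
    _ ≤ _ := measureReal_mono (subset_inter (h1.trans hS) h2)
      ((measure_mono inter_subset_right).trans_lt measure_Icc_lt_top).ne

lemma card_Ico_floor_ceil_le {a b : ℝ} (ha : 0 ≤ a) (hab : a ≤ b) :
    ((Finset.Ico ⌊a⌋₊ ⌈b⌉₊).card : ℝ) ≤ b - a + 2 := by
  have h1 : ⌊a⌋₊ ≤ ⌈b⌉₊ := (Nat.floor_le_floor hab).trans (Nat.floor_le_ceil b)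
  rw [Nat.card_Ico, Nat.cast_sub h1]
  linarith [Nat.ceil_lt_add_one (ha.trans hab), Nat.lt_floor_add_one a]

/-- Around its points, the holed interval has almost the density of a half line at its endpoint.
The holes are short compared to the period, so only balls with radius below a quarter of the period
can see a single component; these contain enough of the bump or of the rest of the period. -/
lemma volume_holedInterval_inter_ball_ge {N : ℕ} (hN : 0 < N) {p ε : ℝ} (hp : 0 < p) (hε : 0 ≤ ε)
    (hε4 : ε ≤ 1 / 4) {x : ℝ} (hx : x ∈ holedInterval N p (ε * p)) {r : ℝ} (hr : 0 < r)
    (hrN : r ≤ N * p) :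
    (1 - 9 * ε) * r ≤ volume.real (holedInterval N p (ε * p) ∩ Icc (x - r) (x + r)) := by
  set s := ε * p with hs
  have hs0 : 0 ≤ s := by positivity
  have hsp : s ≤ p / 4 := by nlinarith
  by_cases hrp : r ≤ p / 4
  · refine le_trans (b := r) (by nlinarith [mul_nonneg hε hr.le]) ?_
    obtain ⟨k, hk, hxk⟩ := exists_period hN hp hx.1
    have hhole : ¬ (s / 2 < |x - centre p k| ∧ |x - centre p k| < s) := fun h =>
      hx.2 (mem_biUnion (Finset.mem_coe.2 (Finset.mem_range.2 hk)) h)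
    set z := centre p k with hz
    have hbump : Icc (z - s / 2) (z + s / 2) ⊆ holedInterval N p s := by
      intro y hy
      have h : |y - z| ≤ s / 2 := abs_le.2 ⟨by linarith [hy.1], by linarith [hy.2]⟩
      exact mem_holedInterval hp hsp hk (by rw [← hz]; linarith) (Or.inl h)
    have hright : Icc (z + s) (z + p / 2) ⊆ holedInterval N p s := by
      intro y hy
      have h : |y - z| = y - z := abs_of_nonneg (by linarith [hy.1])
      exact mem_holedInterval hp hsp hk (by rw [← hz, h]; linarith [hy.2])
        (Or.inr (by rw [← hz, h]; linarith [hy.1]))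
    have hleft : Icc (z - p / 2) (z - s) ⊆ holedInterval N p s := by
      intro y hy
      have h : |y - z| = z - y := by rw [abs_sub_comm]; exact abs_of_nonneg (by linarith [hy.2])
      exact mem_holedInterval hp hsp hk (by rw [← hz, h]; linarith [hy.1])
        (Or.inr (by rw [← hz, h]; linarith [hy.2]))
    have hfin : volume (holedInterval N p s ∩ Icc (x - r) (x + r)) ≠ ∞ :=
      ((measure_mono inter_subset_right).trans_lt measure_Icc_lt_top).ne
    by_cases hxs : |x - z| ≤ s / 2
    · rw [abs_le] at hxs
      rcases le_or_gt r s with hrs | hrs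
      · exact volume_ball_inter_ge_of_component hbump ⟨by linarith, by linarith⟩ hr.le (by linarith)
      -- the ball contains the bump, and a part of length `r - s` on one of its sides
      have hsub : Icc (z - s / 2) (z + s / 2) ⊆ holedInterval N p s ∩ Icc (x - r) (x + r) :=
        subset_inter hbump (Icc_subset_Icc (by linarith) (by linarith))
      rcases le_total z x with hzx | hzx
      · have hsub2 : Icc (z + s) (z + r) ⊆ holedInterval N p s ∩ Icc (x - r) (x + r) :=
          subset_inter ((Icc_subset_Icc le_rfl (by linarith)).trans hright)
            (Icc_subset_Icc (by linarith) (by linarith))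
        rcases hs0.eq_or_lt with h0 | h0
        · refine le_trans ?_ (measureReal_mono hsub2 hfin)
          rw [Real.volume_real_Icc_of_le (by linarith)]; linarith
        have h := measureReal_mono (union_subset hsub hsub2) hfin
        rw [measureReal_union (disjoint_left.2 fun y h1 h2 => by
          linarith [h1.2, h2.1]) measurableSet_Icc measure_Icc_lt_top.ne measure_Icc_lt_top.ne,
          Real.volume_real_Icc_of_le (by linarith), Real.volume_real_Icc_of_le (by linarith)] at h
        linarith
      · have hsub2 : Icc (z - r) (z - s) ⊆ holedInterval N p s ∩ Icc (x - r) (x + r) :=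
          subset_inter ((Icc_subset_Icc (by linarith) le_rfl).trans hleft)
            (Icc_subset_Icc (by linarith) (by linarith))
        rcases hs0.eq_or_lt with h0 | h0
        · refine le_trans ?_ (measureReal_mono hsub2 hfin)
          rw [Real.volume_real_Icc_of_le (by linarith)]; linarith
        have h := measureReal_mono (union_subset hsub hsub2) hfin
        rw [measureReal_union (disjoint_left.2 fun y h1 h2 => by
          linarith [h1.1, h2.2]) measurableSet_Icc measure_Icc_lt_top.ne measure_Icc_lt_top.ne,
          Real.volume_real_Icc_of_le (by linarith), Real.volume_real_Icc_of_le (by linarith)] at h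
        linarith
    · have hxs' : s ≤ |x - z| := by
        by_contra h
        exact hhole ⟨not_le.1 hxs, not_le.1 h⟩
      rw [abs_le] at hxk
      rcases le_abs.1 hxs' with h | h
      · exact volume_ball_inter_ge_of_component hright ⟨by linarith, by linarith⟩ hr.le (by linarith)
      · exact volume_ball_inter_ge_of_component hleft ⟨by linarith, by linarith⟩ hr.le (by linarith)
  -- a large ball contains an interval of length `r`, which meets at most `r / p + 2` periods
  · push Not at hrp
    obtain ⟨u, h1, h2⟩ := exists_subinterval hx.1 hr.le (by linarith)
    have hu0 : 0 ≤ u := (h1 ⟨le_rfl, by linarith⟩).1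
    have hA := volume_inter_holedInterval_ge (s := s) hs0 h1
      (K := Finset.Ico ⌊u / p⌋₊ ⌈(u + r) / p⌉₊) (by
        rintro k - y hy ⟨-, hy2⟩
        rw [abs_lt] at hy2
        unfold centre at hy2
        rw [Finset.mem_Ico]
        constructor
        · refine Nat.lt_succ_iff.1 ((Nat.floor_lt (by positivity)).2 ?_)
          rw [div_lt_iff₀ hp]; push_cast; linarith [hy.1]
        · rw [Nat.lt_ceil, lt_div_iff₀ hp]; linarith [hy.2])
    rw [Real.volume_real_Icc_of_le (by linarith), add_sub_cancel_left] at hA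
    have hcard := card_Ico_floor_ceil_le (a := u / p) (b := (u + r) / p) (by positivity)
      (by gcongr; linarith)
    have hB : ((Finset.Ico ⌊u / p⌋₊ ⌈(u + r) / p⌉₊).card : ℝ) * s ≤ 9 * ε * r := by
      calc _ ≤ ((u + r) / p - u / p + 2) * s := by gcongr
        _ = ε * (r + 2 * p) := by rw [hs]; field_simp; ring
        _ ≤ ε * (r + 8 * r) := mul_le_mul_of_nonneg_left (by linarith) hε
        _ = _ := by ring
    have hC : volume.real (holedInterval N p s ∩ Icc u (u + r))
        ≤ volume.real (holedInterval N p s ∩ Icc (x - r) (x + r)) :=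
      measureReal_mono (inter_subset_inter_right _ h2)
      ((measure_mono inter_subset_right).trans_lt measure_Icc_lt_top).ne
    linarith

/-! ### Separated Hölder bumps -/

lemma abs_rpow_sub_rpow_le {u w β : ℝ} (hu : 0 ≤ u) (hw : 0 ≤ w) (hβ : 0 ≤ β) (hβ1 : β ≤ 1) :
    |u ^ β - w ^ β| ≤ |u - w| ^ β := by
  wlog h : w ≤ u generalizing u w
  · rw [abs_sub_comm, abs_sub_comm u w]
    exact this hw hu (not_le.1 h).le
  rw [abs_of_nonneg (sub_nonneg.2 (Real.rpow_le_rpow hw h hβ)), abs_of_nonneg (sub_nonneg.2 h)]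
  have := Real.rpow_add_le_add_rpow hw (sub_nonneg.2 h) hβ hβ1
  rw [add_sub_cancel] at this
  linarith

/-- The plateau of height `s / 2` on the ball with centre `z` and radius `s / 2`, which decreases
with slope `1` to `0`. -/
noncomputable def plateau {X : Type*} [NormedAddCommGroup X] (s : ℝ) (z x : X) : ℝ :=
  max 0 (min (s / 2) (s - ‖x - z‖))

section Plateau

variable {X : Type*} [NormedAddCommGroup X] {s : ℝ} {z x : X}

lemma plateau_nonneg : 0 ≤ plateau s z x := le_max_left _ _

lemma plateau_le (hs : 0 ≤ s) : plateau s z x ≤ s / 2 := max_le (by linarith) (min_le_left _ _)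

lemma plateau_of_le (hs : 0 ≤ s) (h : ‖x - z‖ ≤ s / 2) : plateau s z x = s / 2 := by
  rw [plateau, min_eq_left (by linarith), max_eq_right (by linarith)]

lemma plateau_of_ge (h : s ≤ ‖x - z‖) : plateau s z x = 0 :=
  max_eq_left ((min_le_right _ _).trans (by linarith))

lemma abs_plateau_sub_le (y : X) : |plateau s z x - plateau s z y| ≤ ‖x - y‖ := by
  refine (abs_max_sub_max_le_max _ _ _ _).trans (max_le (by simp) ?_)
  refine (abs_min_sub_min_le_max _ _ _ _).trans (max_le (by simp) ?_)
  rw [sub_sub_sub_cancel_left, abs_sub_comm]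
  refine (abs_norm_sub_norm_le _ _).trans (by rw [sub_sub_sub_cancel_right])

end Plateau

/-- Signed Hölder bumps with centres `z κ`. -/
noncomputable def bumpFun {ι X : Type*} [Fintype ι] [NormedAddCommGroup X] (A β s : ℝ)
    (z : ι → X) (a : ι → ℝ) (x : X) : ℝ :=
  ∑ κ, a κ * (A * plateau s (z κ) x ^ β)

section Bump

variable {ι X : Type*} [Fintype ι] [NormedAddCommGroup X] {A β s p : ℝ} {z : ι → X} {a : ι → ℝ}

lemma bumpFun_of_lt (hβ : 0 < β) (hz : ∀ i j, i ≠ j → p ≤ ‖z i - z j‖) (hsp : 2 * s ≤ p) {κ : ι}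
    {x : X} (hx : ‖x - z κ‖ < s) : bumpFun A β s z a x = a κ * (A * plateau s (z κ) x ^ β) := by
  refine Finset.sum_eq_single κ (fun j _ hj => ?_) (by simp)
  have h1 : s ≤ ‖x - z j‖ := by
    have h2 : ‖z j - z κ‖ ≤ ‖x - z κ‖ + ‖x - z j‖ := by
      have := norm_sub_le (x - z κ) (x - z j)
      rwa [sub_sub_sub_cancel_left] at this
    linarith [hz j κ hj]
  rw [plateau_of_ge h1, Real.zero_rpow hβ.ne', mul_zero, mul_zero]

lemma bumpFun_of_ge (hβ : 0 < β) {x : X} (hx : ∀ κ, s ≤ ‖x - z κ‖) : bumpFun A β s z a x = 0 :=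
  Finset.sum_eq_zero fun κ _ => by
    rw [plateau_of_ge (hx κ), Real.zero_rpow hβ.ne', mul_zero, mul_zero]

/-- Two different bumps are so far apart that their heights together do not violate the Hölder
condition. -/
lemma abs_bumpFun_sub_le (hA : 0 ≤ A) (hβ : 0 < β) (hβ1 : β ≤ 1) (hs : 0 ≤ s)
    (hz : ∀ i j, i ≠ j → p ≤ ‖z i - z j‖) (hsp : 2 * s ≤ p)
    (hgap : 2 * (s / 2) ^ β ≤ (p - 2 * s) ^ β) (ha : ∀ κ, |a κ| ≤ 1) (x y : X) :
    |bumpFun A β s z a x - bumpFun A β s z a y| ≤ A * ‖x - y‖ ^ β := by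
  -- one bump
  have one : ∀ κ x y, |a κ * (A * plateau s (z κ) x ^ β) - a κ * (A * plateau s (z κ) y ^ β)|
      ≤ A * ‖x - y‖ ^ β := by
    intro κ x y
    rw [← mul_sub, ← mul_sub, abs_mul, abs_mul, abs_of_nonneg hA]
    refine (mul_le_of_le_one_left (by positivity) (ha κ)).trans ?_
    refine mul_le_mul_of_nonneg_left ?_ hA
    exact (abs_rpow_sub_rpow_le plateau_nonneg plateau_nonneg hβ.le hβ1).trans
      (Real.rpow_le_rpow (abs_nonneg _) (abs_plateau_sub_le y) hβ.le)
  have far : ∀ κ x y, ‖x - z κ‖ < s → (∀ j, s ≤ ‖y - z j‖) →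
      |bumpFun A β s z a x - bumpFun A β s z a y| ≤ A * ‖x - y‖ ^ β := by
    intro κ x y hx hy
    have e : bumpFun A β s z a y = a κ * (A * plateau s (z κ) y ^ β) := by
      rw [bumpFun_of_ge hβ hy, plateau_of_ge (hy κ), Real.zero_rpow hβ.ne', mul_zero, mul_zero]
    rw [e, bumpFun_of_lt hβ hz hsp hx]
    exact one κ x y
  by_cases hx : ∃ κ, ‖x - z κ‖ < s
  · obtain ⟨κ, hκ⟩ := hx
    by_cases hy : ∃ j, ‖y - z j‖ < s
    · obtain ⟨j, hj⟩ := hy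
      by_cases hjκ : j = κ
      · subst hjκ
        rw [bumpFun_of_lt hβ hz hsp hκ, bumpFun_of_lt hβ hz hsp hj]
        exact one j x y
      · have hb : ∀ κ x, |a κ * (A * plateau s (z κ) x ^ β)| ≤ A * (s / 2) ^ β := by
          intro κ x
          have h0 : 0 ≤ plateau s (z κ) x := plateau_nonneg
          rw [abs_mul, abs_of_nonneg (a := A * _) (by positivity)]
          refine (mul_le_of_le_one_left (by positivity) (ha κ)).trans ?_
          gcongr
          exact plateau_le hs
        have hd : p - 2 * s ≤ ‖x - y‖ := by
          have h1 := hz κ j (Ne.symm hjκ)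
          have h2 : ‖z κ - z j‖ ≤ ‖x - z κ‖ + ‖x - y‖ + ‖y - z j‖ := by
            have h3 : z κ - z j = -(x - z κ) + (x - y) + (y - z j) := by abel
            rw [h3]
            refine (norm_add_le _ _).trans (add_le_add_left ((norm_add_le _ _).trans ?_) _)
            rw [norm_neg]
          linarith
        rw [bumpFun_of_lt hβ hz hsp hκ, bumpFun_of_lt hβ hz hsp hj]
        calc _ ≤ A * (s / 2) ^ β + A * (s / 2) ^ β :=
              (abs_sub _ _).trans (add_le_add (hb _ _) (hb _ _))
          _ = A * (2 * (s / 2) ^ β) := by ring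
          _ ≤ A * (p - 2 * s) ^ β := mul_le_mul_of_nonneg_left hgap hA
          _ ≤ A * ‖x - y‖ ^ β :=
              mul_le_mul_of_nonneg_left (Real.rpow_le_rpow (by linarith) hd hβ.le) hA
    · push Not at hy
      exact far κ x y hκ hy
  · push Not at hx
    by_cases hy : ∃ j, ‖y - z j‖ < s
    · obtain ⟨j, hj⟩ := hy
      rw [abs_sub_comm, norm_sub_rev]
      exact far j y x hj hx
    · push Not at hy
      rw [bumpFun_of_ge hβ hx, bumpFun_of_ge hβ hy, sub_self, abs_zero]
      positivity

end Bump

/-! ### The context law with holes -/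

/-- The length of the periods of the holed interval with `N` periods. The total length `1 - 9 ε` is
chosen such that the loss of density around the holes is compensated by the normalization. -/
noncomputable def period (N : ℕ) (ε : ℝ) : ℝ := (1 - 9 * ε) / N

/-- The support of one coordinate of the context. -/
noncomputable def holedSet (N : ℕ) (ε : ℝ) : Set ℝ :=
  holedInterval N (period N ε) (ε * period N ε)

/-- The context law with independent coordinates, uniform on the holed interval. -/
noncomputable def holedLaw (d N : ℕ) (ε : ℝ) : Measure (Ctx d) :=
  Measure.pi fun _ => cond volume (holedSet N ε)

section HoledLaw

variable {d N : ℕ} {ε : ℝ}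

lemma period_pos (hN : 0 < N) (hε : ε ≤ 1 / 18) : 0 < period N ε := by
  have : (0 : ℝ) < N := by exact_mod_cast hN
  exact div_pos (by linarith) this

lemma mul_period (hN : 0 < N) : N * period N ε = 1 - 9 * ε := by
  have : (0 : ℝ) < N := by exact_mod_cast hN
  unfold period
  field_simp

lemma measurableSet_holedSet : MeasurableSet (holedSet N ε) := measurableSet_holedInterval _ _ _

lemma volume_holedSet_le (hN : 0 < N) (hε : ε ≤ 1 / 18) :
    volume.real (holedSet N ε) ≤ 1 - 9 * ε := by
  rw [← mul_period (ε := ε) hN]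
  exact volume_holedInterval_le (period_pos hN hε).le

lemma volume_holedSet_ge (hN : 0 < N) (hε0 : 0 ≤ ε) (hε : ε ≤ 1 / 18) :
    (1 - 9 * ε) * (1 - ε) ≤ volume.real (holedSet N ε) := by
  have hp := period_pos hN hε
  refine le_trans (le_of_eq ?_) (volume_holedInterval_ge hp.le (mul_nonneg hε0 hp.le))
  rw [← mul_period (ε := ε) hN]; ring

lemma volume_holedSet_pos (hN : 0 < N) (hε0 : 0 ≤ ε) (hε : ε ≤ 1 / 18) :
    0 < volume.real (holedSet N ε) :=
  lt_of_lt_of_le (mul_pos (by linarith) (by linarith)) (volume_holedSet_ge hN hε0 hε)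

lemma isProbabilityMeasure_cond_holedSet (hN : 0 < N) (hε0 : 0 ≤ ε) (hε : ε ≤ 1 / 18) :
    IsProbabilityMeasure (cond volume (holedSet N ε)) := by
  have h := volume_holedSet_pos hN hε0 hε
  rw [measureReal_def, ENNReal.toReal_pos_iff] at h
  exact cond_isProbabilityMeasure_of_finite h.1.ne' h.2.ne

lemma isProbabilityMeasure_holedLaw (hN : 0 < N) (hε0 : 0 ≤ ε) (hε : ε ≤ 1 / 18) :
    IsProbabilityMeasure (holedLaw d N ε) := by
  have := isProbabilityMeasure_cond_holedSet hN hε0 hε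
  unfold holedLaw
  infer_instance

lemma cond_holedSet_real (t : Set ℝ) : (cond volume (holedSet N ε)).real t
    = (volume.real (holedSet N ε))⁻¹ * volume.real (holedSet N ε ∩ t) := by
  rw [measureReal_def, cond_apply measurableSet_holedSet, ENNReal.toReal_mul, ENNReal.toReal_inv]
  rfl

lemma le_cond_holedSet_ball (hN : 0 < N) (hε0 : 0 ≤ ε) (hε : ε ≤ 1 / 18) {x : ℝ}
    (hx : x ∈ holedSet N ε) {r : ℝ} (hr : 0 < r) (hr1 : r ≤ 1) :
    r ≤ (cond volume (holedSet N ε)).real (Metric.closedBall x r) := by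
  have hV := volume_holedSet_pos hN hε0 hε
  have hp := period_pos hN hε
  rw [cond_holedSet_real, Real.closedBall_eq_Icc, inv_mul_eq_div, le_div_iff₀ hV]
  rcases le_or_gt r (1 - 9 * ε) with h | h
  · refine le_trans ?_ (volume_holedInterval_inter_ball_ge hN hp hε0 (by linarith) hx hr
      (by rwa [mul_period hN]))
    rw [mul_comm]
    exact mul_le_mul_of_nonneg_right (volume_holedSet_le hN hε) hr.le
  · have hsub : holedSet N ε ⊆ Icc 0 (1 - 9 * ε) := by
      rw [← mul_period (ε := ε) hN]; exact holedInterval_subset _ _ _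
    have hx' := hsub hx
    rw [inter_eq_self_of_subset_left (hsub.trans
      (Icc_subset_Icc (by linarith [hx'.2]) (by linarith [hx'.1])))]
    exact mul_le_of_le_one_left hV.le hr1

lemma cond_holedSet_ball_le (hN : 0 < N) (hε0 : 0 ≤ ε) (hε : ε ≤ 1 / 18) (x : ℝ) {r : ℝ}
    (hr : 0 ≤ r) : (cond volume (holedSet N ε)).real (Metric.closedBall x r)
      ≤ 2 / ((1 - 9 * ε) * (1 - ε)) * r := by
  have hV := volume_holedSet_pos hN hε0 hε
  rw [cond_holedSet_real, Real.closedBall_eq_Icc]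
  have h1 : volume.real (holedSet N ε ∩ Icc (x - r) (x + r)) ≤ 2 * r := by
    refine (measureReal_mono inter_subset_right measure_Icc_lt_top.ne).trans ?_
    rw [Real.volume_real_Icc_of_le (by linarith)]; linarith
  have h2 : (volume.real (holedSet N ε))⁻¹ ≤ ((1 - 9 * ε) * (1 - ε))⁻¹ :=
    inv_anti₀ (mul_pos (by linarith) (by linarith)) (volume_holedSet_ge hN hε0 hε)
  calc _ ≤ ((1 - 9 * ε) * (1 - ε))⁻¹ * (2 * r) :=
        mul_le_mul h2 h1 measureReal_nonneg (inv_nonneg.2 (mul_nonneg (by linarith) (by linarith)))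
    _ = _ := by ring

lemma holedLaw_real_closedBall (x : Ctx d) {r : ℝ} (hr : 0 ≤ r) :
    (holedLaw d N ε).real (Metric.closedBall x r)
      = ∏ i, (cond volume (holedSet N ε)).real (Metric.closedBall (x i) r) := by
  simp only [holedLaw, measureReal_def]
  rw [Measure.pi_closedBall _ _ hr, ENNReal.toReal_prod]

lemma holedLaw_ae (hN : 0 < N) (hε0 : 0 ≤ ε) (hε : ε ≤ 1 / 18) :
    ∀ᵐ x ∂holedLaw d N ε, ∀ i, x i ∈ holedSet N ε := by
  have := isProbabilityMeasure_cond_holedSet hN hε0 hε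
  rw [ae_all_iff]
  intro i
  exact (measurePreserving_eval (fun _ : Fin d => cond volume (holedSet N ε)) i
    ).quasiMeasurePreserving.ae (ae_cond_mem measurableSet_holedSet)

lemma holedLaw_ae_cube (hN : 0 < N) (hε0 : 0 ≤ ε) (hε : ε ≤ 1 / 18) :
    ∀ᵐ x ∂holedLaw d N ε, x ∈ cube d := by
  filter_upwards [holedLaw_ae hN hε0 hε] with x hx
  have hsub : holedSet N ε ⊆ Icc 0 (1 - 9 * ε) := by
    rw [← mul_period (ε := ε) hN]; exact holedInterval_subset _ _ _
  exact ⟨fun i => (hsub (hx i)).1, fun i => (hsub (hx i)).2.trans (by simp; linarith)⟩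

lemma mem_holedSet_of_mem_support (hN : 0 < N) (hε0 : 0 ≤ ε) (hε : ε ≤ 1 / 18) {x : Ctx d}
    (hx : x ∈ (holedLaw d N ε).support) (i : Fin d) : x i ∈ holedSet N ε := by
  have hcl : IsClosed {x : Ctx d | ∀ i, x i ∈ holedSet N ε} := by
    have e : {x : Ctx d | ∀ i, x i ∈ holedSet N ε} = Set.univ.pi fun _ => holedSet N ε := by
      ext x; simp
    rw [e]
    exact isClosed_set_pi fun i _ => isClosed_holedInterval _ _ _
  exact Measure.support_subset_of_isClosed hcl (holedLaw_ae hN hε0 hε) hx i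

lemma holedLaw_density (hN : 0 < N) (hε0 : 0 ≤ ε) (hε : ε ≤ 1 / 18) {x : Ctx d}
    (hx : x ∈ (holedLaw d N ε).support) {r : ℝ} (hr : 0 < r) (hr1 : r ≤ 1) :
    r ^ d ≤ (holedLaw d N ε).real (Metric.closedBall x r) ∧
      (holedLaw d N ε).real (Metric.closedBall x r)
        ≤ (2 / ((1 - 9 * ε) * (1 - ε))) ^ d * r ^ d := by
  rw [holedLaw_real_closedBall x hr.le]
  constructor
  · calc r ^ d = ∏ _i : Fin d, r := by simp
      _ ≤ _ := Finset.prod_le_prod (fun _ _ => hr.le) fun i _ =>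
        le_cond_holedSet_ball hN hε0 hε (mem_holedSet_of_mem_support hN hε0 hε hx i) hr hr1
  · calc _ ≤ ∏ _i : Fin d, (2 / ((1 - 9 * ε) * (1 - ε)) * r) :=
        Finset.prod_le_prod (fun _ _ => measureReal_nonneg) fun i _ =>
          cond_holedSet_ball_le hN hε0 hε _ hr.le
      _ = _ := by rw [Finset.prod_const, Finset.card_univ, Fintype.card_fin, mul_pow]

/-- The centres of the `N ^ d` cells of the holed cube. -/
noncomputable def cellCentre (N : ℕ) (ε : ℝ) (κ : Fin d → Fin N) : Ctx d :=
  fun i => centre (period N ε) (κ i)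

lemma period_le_norm_cellCentre_sub (hN : 0 < N) (hε : ε ≤ 1 / 18) {κ κ' : Fin d → Fin N}
    (h : κ ≠ κ') : period N ε ≤ ‖cellCentre N ε κ - cellCentre N ε κ'‖ := by
  obtain ⟨i, hi⟩ := Function.ne_iff.1 h
  refine le_trans ?_ (norm_le_pi_norm _ i)
  exact le_abs_centre_sub (period_pos hN hε).le fun e => hi (Fin.ext e)

lemma holedLaw_real_bump (hN : 0 < N) (hε0 : 0 ≤ ε) (hε : ε ≤ 1 / 18) (κ : Fin d → Fin N) :
    (holedLaw d N ε).real (Metric.closedBall (cellCentre N ε κ) (ε * period N ε / 2))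
      = (ε * period N ε / volume.real (holedSet N ε)) ^ d := by
  have hp := period_pos hN hε
  have hs0 : 0 ≤ ε * period N ε := mul_nonneg hε0 hp.le
  rw [holedLaw_real_closedBall _ (by linarith)]
  refine (Finset.prod_congr rfl fun i _ => ?_).trans (by rw [Finset.prod_const, Finset.card_univ,
    Fintype.card_fin])
  rw [cond_holedSet_real, Real.closedBall_eq_Icc, inter_eq_self_of_subset_right,
    Real.volume_real_Icc_of_le (by linarith)]
  · rw [inv_mul_eq_div]; congr 1; ring
  · intro y hy
    have h : |y - centre (period N ε) (κ i)| ≤ ε * period N ε / 2 :=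
      abs_le.2 ⟨by linarith [hy.1, show cellCentre N ε κ i = centre (period N ε) (κ i) from rfl],
        by linarith [hy.2, show cellCentre N ε κ i = centre (period N ε) (κ i) from rfl]⟩
    exact mem_holedInterval hp (by nlinarith) (κ i).2 (by nlinarith) (Or.inl h)

/-- A point of the holed cube lies in a bump or outside the support of its extension. -/
lemma norm_sub_cellCentre_of_mem (hN : 0 < N) {x : Ctx d} (hε0 : 0 ≤ ε) (hε : ε ≤ 1 / 18)
    (hx : ∀ i, x i ∈ holedSet N ε) (κ : Fin d → Fin N) :
    ‖x - cellCentre N ε κ‖ ≤ ε * period N ε / 2 ∨ ε * period N ε ≤ ‖x - cellCentre N ε κ‖ := by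
  have hp := period_pos hN hε
  have hs0 : 0 ≤ ε * period N ε := mul_nonneg hε0 hp.le
  by_cases h : ∀ i, |x i - centre (period N ε) (κ i)| ≤ ε * period N ε / 2
  · exact Or.inl ((pi_norm_le_iff_of_nonneg (by linarith)).2 h)
  · push Not at h
    obtain ⟨i, hi⟩ := h
    refine Or.inr (le_trans ?_ (norm_le_pi_norm _ i))
    by_contra h2
    refine (hx i).2 ?_
    simp only [mem_iUnion, Finset.mem_range, exists_prop]
    exact ⟨κ i, (κ i).2, hi, not_le.1 h2⟩

end HoledLaw

/-! ### Lower bounds for the oracle regret -/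

/-- The environment with context law `holedLaw` and gap `v` belongs to the class. The Hölder
condition on the whole cube concerns a version `f` of the gap. -/
lemma exists_env {c : ClassConstants} (hc : c.Good) (hlow : c.cLow ≤ 1) {N : ℕ} (hN : 0 < N) {ε : ℝ}
    (hε0 : 0 ≤ ε) (hε : ε ≤ 1 / 18) (hup : (2 / ((1 - 9 * ε) * (1 - ε))) ^ c.d ≤ c.cUp) {α : ℝ≥0∞}
    {v f : Ctx c.d → ℝ} (hv : Measurable v) (hv1 : ∀ x, |v x| ≤ 1)
    (hvf : ∀ x, (∀ i, x i ∈ holedSet N ε) → f x = v x)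
    (hf : ∀ x y, |f x - f y| ≤ 2 * c.L * ‖x - y‖ ^ c.β)
    (hm : ∀ δ, 0 ≤ δ → δ ≤ c.δ₀ → (holedLaw c.d N ε).real {x | 0 < |v x| ∧ |v x| ≤ δ}
      ≤ c.D₀ * marginPow δ α) :
    ∃ E ∈ envClass c α, E.law = biasedLaw (holedLaw c.d N ε) v ∧ ∀ x, E.gap x = f x := by
  have hprob := isProbabilityMeasure_holedLaw (d := c.d) hN hε0 hε
  have hae : ∀ᵐ x ∂holedLaw c.d N ε, f x = v x := by
    filter_upwards [holedLaw_ae hN hε0 hε] with x hx using hvf x hx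
  set E := biasedEnv (holedLaw c.d N ε) (holedLaw_ae_cube hN hε0 hε) v hv hv1 f hae with hE
  have hctx : E.ctxLaw = holedLaw c.d N ε := biasedEnv_ctxLaw _ _ v hv hv1 f hae
  have hgap : ∀ x, E.gap x = f x := biasedEnv_gap _ _ v hv hv1 f hae
  refine ⟨E, ⟨?_, ?_, ?_⟩, rfl, hgap⟩
  · intro x hx r hr hr1
    rw [hctx] at hx ⊢
    obtain ⟨h1, h2⟩ := holedLaw_density hN hε0 hε hx hr hr1
    have hr0 : 0 ≤ r ^ c.d := by positivity
    exact ⟨(mul_le_of_le_one_left hr0 hlow).trans h1,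
      h2.trans (mul_le_mul_of_nonneg_right hup hr0)⟩
  · intro k x _ y _
    have h1 : |E.f k x - E.f k y| = |f x - f y| / 2 := by
      cases k
      · rw [show E.f false x - E.f false y = -((f x - f y) / 2) by
          simp only [hE, biasedEnv, Bool.false_eq_true, if_false]; ring, abs_neg, abs_div,
          abs_two]
      · rw [show E.f true x - E.f true y = (f x - f y) / 2 by
          simp only [hE, biasedEnv, if_true]; ring, abs_div, abs_two]
    rw [h1]
    have h2 : ‖x - y‖ ^ c.β ≤ ‖WithLp.toLp 2 (x - y)‖ ^ c.β :=
      Real.rpow_le_rpow (norm_nonneg _) (norm_le_norm_toLp_two _) hc.β_pos.le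
    have h3 := mul_le_mul_of_nonneg_left h2 hc.L_pos.le
    linarith [hf x y]
  · intro δ hδ hδ₀
    refine le_trans (le_of_eq ?_) (hm δ hδ hδ₀)
    rw [hctx]
    refine measureReal_congr ?_
    filter_upwards [hae] with x hx
    have h1 : E.f true x - E.f false x = v x := (hgap x).trans hx
    refine propext ?_
    change (0 < |E.f true x - E.f false x| ∧ |E.f true x - E.f false x| ≤ δ) ↔
      (0 < |v x| ∧ |v x| ≤ δ)
    rw [h1]

/-- The first round: a policy errs there if the gap always disagrees with its choice. -/
lemma mul_ctxLaw_le_regret {d T M : ℕ} (π : BatchPolicy d T M) (hT : 0 < T) {r : Ctx d → Arm}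
    (hr : Measurable r) (hπ : ∀ ω, π.arm ⟨0, hT⟩ ω = r (ω ⟨0, hT⟩).1) (E : Environment d) {η : ℝ}
    (hη : 0 ≤ η) (b : Arm) (hgap : ∀ x, armSign b * E.gap x = -η) :
    ENNReal.ofReal η * E.ctxLaw {x | r x = b} ≤ regret π E := by
  have hA : MeasurableSet {x | r x = b} := hr (MeasurableSpace.measurableSet_top (s := {b}))
  have hg : Measurable fun z : Outcome d => {x | r x = b}.indicator (1 : Ctx d → ℝ≥0∞) z.1 :=
    (measurable_one.indicator hA).comp measurable_fst
  have e : ENNReal.ofReal η * E.ctxLaw {x | r x = b} = ∫⁻ ω, ENNReal.ofReal η *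
      {x | r x = b}.indicator 1 (ω ⟨0, hT⟩).1 ∂(Measure.pi fun _ : Fin T => E.law) := by
    rw [(measurePreserving_eval (fun _ : Fin T => E.law) ⟨0, hT⟩).lintegral_comp
      (hg.const_mul _), lintegral_const_mul _ hg]
    congr 1
    rw [Environment.ctxLaw, Measure.map_apply measurable_fst hA,
      ← lintegral_indicator_one (measurable_fst hA)]
    rfl
  rw [e]
  refine lintegral_mono fun ω => ?_
  refine le_trans ?_ (Finset.single_le_sum (f := fun t : Fin T => ENNReal.ofReal
    (max (E.f true (ω t).1) (E.f false (ω t).1) - E.f (π.arm t ω) (ω t).1))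
    (fun _ _ => zero_le) (Finset.mem_univ ⟨0, hT⟩))
  by_cases h : r (ω ⟨0, hT⟩).1 = b
  · have hgx := hgap (ω ⟨0, hT⟩).1
    dsimp only
    rw [hπ, h, E.instant_regret_eq _ _ (by linarith)]
    have habs : |E.gap (ω ⟨0, hT⟩).1| = η := by
      have h1 : |armSign b| = 1 := by cases b <;> simp [armSign]
      have h2 := congrArg abs hgx
      rwa [abs_mul, h1, one_mul, abs_neg, abs_of_nonneg hη] at h2
    rw [habs]
    exact mul_le_of_le_one_right zero_le (indicator_le_self' (fun _ _ => zero_le) _)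
  · rw [indicator_of_notMem (by exact h), mul_zero]
    exact zero_le

/-- Even the oracle cannot know the better arm in the first round. -/
lemma le_oracleRegret_of_first_round {c : ClassConstants} (hc : c.Good) (hlow : c.cLow ≤ 1) {ε : ℝ}
    (hε0 : 0 ≤ ε) (hε : ε ≤ 1 / 18) (hup : (2 / ((1 - 9 * ε) * (1 - ε))) ^ c.d ≤ c.cUp)
    {T : ℕ} (hT : 0 < T) (M : ℕ) (α : ℝ≥0∞) :
    ENNReal.ofReal (c.δ₀ / 2) ≤ oracleRegret c T M α := by
  -- a constant gap of absolute value in `(δ₀, 1]` satisfies the margin condition for all exponents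
  set η := (1 + c.δ₀) / 2 with hη
  have hδ := hc.δ₀_pos
  have hδ1 := hc.δ₀_lt
  have hη0 : 0 ≤ η := by rw [hη]; linarith
  have key : ∀ b : Arm, ∃ E ∈ envClass c α,
      E.law = biasedLaw (holedLaw c.d 1 ε) (fun _ => armSign b * η) ∧
        ∀ x, E.gap x = armSign b * η := by
    intro b
    have habs : |armSign b * η| = η := by
      rw [abs_mul, abs_of_nonneg hη0]
      cases b <;> simp [armSign]
    refine exists_env hc hlow one_pos hε0 hε hup measurable_const (fun _ => ?_) (fun _ _ => rfl)
      (fun x y => ?_) (fun δ h0 h1 => ?_)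
    · rw [habs, hη]; linarith
    · rw [sub_self, abs_zero]
      have := hc.L_pos
      positivity
    · have e : {x : Ctx c.d | 0 < |armSign b * η| ∧ |armSign b * η| ≤ δ} = ∅ := by
        ext x
        simp only [mem_ofPred_eq, mem_empty_iff_false, iff_false, not_and, not_le, habs]
        intro _
        rw [hη]; linarith
      rw [e, measureReal_empty]
      exact mul_nonneg hc.D₀_pos.le (marginPow_nonneg h0 _)
  obtain ⟨E, hE, hEl, hEg⟩ := key true
  obtain ⟨E', hE', hEl', hEg'⟩ := key false
  have hprob := isProbabilityMeasure_holedLaw (d := c.d) one_pos hε0 hε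
  have hctx : ∀ F : Environment c.d, ∀ b : Arm,
      F.law = biasedLaw (holedLaw c.d 1 ε) (fun _ => armSign b * η) →
      F.ctxLaw = holedLaw c.d 1 ε := by
    intro F b hF
    rw [Environment.ctxLaw, hF]
    refine map_fst_biasedLaw _ measurable_const fun _ => ?_
    rw [abs_mul, abs_of_nonneg hη0]
    exact mul_le_one₀ (abs_armSign_le b) hη0 (by rw [hη]; linarith)
  refine le_iInf fun π => ?_
  obtain ⟨r, hr, hπ⟩ := π.arm_zero_eq hT
  have h1 := mul_ctxLaw_le_regret π hT hr hπ E hη0 false fun x => by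
    rw [hEg]; simp [armSign]
  have h2 := mul_ctxLaw_le_regret π hT hr hπ E' hη0 true fun x => by
    rw [hEg']; simp [armSign]
  rw [hctx E _ hEl] at h1
  rw [hctx E' _ hEl'] at h2
  set R := ⨆ F ∈ envClass c α, regret π F with hR
  have h3 : ENNReal.ofReal η ≤ R + R := by
    have hA : MeasurableSet {x | r x = false} :=
      hr (MeasurableSpace.measurableSet_top (s := {false}))
    have hAc : {x | r x = true} = {x | r x = false}ᶜ := by ext x; simp
    calc ENNReal.ofReal η = ENNReal.ofReal η * holedLaw c.d 1 ε {x | r x = false}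
          + ENNReal.ofReal η * holedLaw c.d 1 ε {x | r x = true} := by
          rw [← mul_add, hAc, measure_add_measure_compl hA, measure_univ, mul_one]
      _ ≤ R + R := add_le_add (h1.trans (le_iSup₂_of_le E hE le_rfl))
          (h2.trans (le_iSup₂_of_le E' hE' le_rfl))
  rw [← two_mul, mul_comm] at h3
  calc ENNReal.ofReal (c.δ₀ / 2) ≤ ENNReal.ofReal (η / 2) :=
        ENNReal.ofReal_le_ofReal (by rw [hη]; linarith)
    _ = ENNReal.ofReal η / 2 := by
        rw [ENNReal.ofReal_div_of_pos two_pos, ENNReal.ofReal_ofNat]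
    _ ≤ R := ENNReal.div_le_of_le_mul h3

/-- The lower bound from `n` bumps, in terms of the height `h` and the mass `m` of a bump. -/
lemma le_oracleRegret_of_bumps {c : ClassConstants} (hc : c.Good) (hlow : c.cLow ≤ 1) {N : ℕ}
    (hN : 0 < N) {ε : ℝ} (hε0 : 0 < ε) (hε : ε ≤ 1 / 18)
    (hup : (2 / ((1 - 9 * ε) * (1 - ε))) ^ c.d ≤ c.cUp)
    (hgap : 2 * (ε / 2) ^ c.β ≤ (1 - 2 * ε) ^ c.β) {α : ℝ≥0∞} (hα : α ≠ ∞) (T M : ℕ) {n : ℕ}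
    (hn : n ≤ N ^ c.d) {h m : ℝ} (hh : h = 2 * c.L * (ε * period N ε / 2) ^ c.β)
    (hm : m = (ε * period N ε / volume.real (holedSet N ε)) ^ c.d) (hh1 : h ≤ 1)
    (hsmall : h ^ 2 + T * (m * h ^ 2) ≤ 1 / 8) (hmargin : n * m ≤ c.D₀ * h ^ α.toReal) :
    ENNReal.ofReal (T * n * (h * m) / 4) ≤ oracleRegret c T M α := by
  have hp := period_pos hN hε
  have hprob := isProbabilityMeasure_holedLaw (d := c.d) hN hε0.le hε
  have hL := hc.L_pos
  set s := ε * period N ε with hs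
  have hs0 : 0 < s := by positivity
  have hh0 : 0 < h := by rw [hh]; positivity
  have hsp : 2 * s ≤ period N ε := by rw [hs]; nlinarith
  obtain ⟨J, -, hJ⟩ := Finset.exists_subset_card_eq (s := (Finset.univ : Finset (Fin c.d → Fin N)))
    (n := n) (by simpa using hn)
  set z : J → Ctx c.d := fun κ => cellCentre N ε κ.1 with hz
  set B : J → Set (Ctx c.d) := fun κ => Metric.closedBall (z κ) (s / 2) with hB
  have hzsep : ∀ i j : J, i ≠ j → period N ε ≤ ‖z i - z j‖ := fun i j hij =>
    period_le_norm_cellCentre_sub hN hε fun e => hij (Subtype.ext e)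
  have hBm : ∀ κ, MeasurableSet (B κ) := fun κ => Metric.isClosed_closedBall.measurableSet
  have hdisj : Pairwise fun i j => Disjoint (B i) (B j) := by
    intro i j hij
    refine Metric.closedBall_disjoint_closedBall ?_
    rw [dist_eq_norm]
    linarith [hzsep i j hij]
  have hBmass : ∀ κ, (holedLaw c.d N ε).real (B κ) = m := fun κ => by
    rw [hm]; exact holedLaw_real_bump hN hε0.le hε κ.1
  have hfB : ∀ (a : J → ℝ) κ x, x ∈ B κ → bumpFun (2 * c.L) c.β s z a x = a κ * h := by
    intro a κ x hx
    rw [hB, Metric.mem_closedBall, dist_eq_norm] at hx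
    rw [bumpFun_of_lt hc.β_pos hzsep hsp (by linarith : ‖x - z κ‖ < s), plateau_of_le hs0.le hx, hh]
  have key : ∀ σ : J → Arm, ∃ E ∈ envClass c α,
      E.law = biasedLaw (holedLaw c.d N ε) (stepFun B h fun κ => armSign (σ κ)) ∧
        ∀ x, E.gap x = bumpFun (2 * c.L) c.β s z (fun κ => armSign (σ κ)) x := by
    intro σ
    set a : J → ℝ := fun κ => armSign (σ κ) with ha
    refine exists_env hc hlow hN hε0.le hε hup (measurable_stepFun hBm h a)
      (fun x => (abs_stepFun_le hdisj hh0.le (fun κ => abs_armSign_le _) x).trans hh1) ?_ ?_ ?_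
    · intro x hx
      by_cases hxB : ∃ κ, x ∈ B κ
      · obtain ⟨κ, hκ⟩ := hxB
        rw [hfB a κ x hκ, stepFun_of_mem hdisj h a hκ]
      · push Not at hxB
        rw [stepFun_of_notMem h a hxB]
        refine bumpFun_of_ge hc.β_pos fun κ => ?_
        refine (norm_sub_cellCentre_of_mem hN hε0.le hε hx κ.1).resolve_left fun h' => ?_
        exact hxB κ (by rw [hB, Metric.mem_closedBall, dist_eq_norm]; exact h')
    · refine abs_bumpFun_sub_le (by positivity) hc.β_pos hc.β_le hs0.le hzsep hsp ?_
        fun κ => abs_armSign_le _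
      have e1 : s / 2 = ε / 2 * period N ε := by rw [hs]; ring
      have e2 : period N ε - 2 * s = (1 - 2 * ε) * period N ε := by rw [hs]; ring
      rw [e1, e2, Real.mul_rpow (by positivity) hp.le, Real.mul_rpow (by linarith) hp.le,
        ← mul_assoc]
      exact mul_le_mul_of_nonneg_right hgap (by positivity)
    · intro δ hδ0 hδ₀
      have hval : ∀ x, 0 < |stepFun B h a x| → |stepFun B h a x| = h ∧ ∃ κ, x ∈ B κ := by
        intro x hx
        by_cases hxB : ∃ κ, x ∈ B κ
        · refine ⟨?_, hxB⟩
          obtain ⟨κ, hκ⟩ := hxB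
          rw [stepFun_of_mem hdisj h a hκ, abs_mul, abs_of_pos hh0]
          have : |a κ| = 1 := by simp only [ha]; cases σ κ <;> simp [armSign]
          rw [this, one_mul]
        · push Not at hxB
          rw [stepFun_of_notMem h a hxB, abs_zero] at hx
          exact absurd hx (lt_irrefl _)
      rcases lt_or_ge δ h with hδh | hδh
      · have e : {x | 0 < |stepFun B h a x| ∧ |stepFun B h a x| ≤ δ} = ∅ := by
          ext x
          simp only [mem_ofPred_eq, mem_empty_iff_false, iff_false, not_and, not_le]
          intro hx
          rwa [(hval x hx).1]
        rw [e, measureReal_empty]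
        exact mul_nonneg hc.D₀_pos.le (marginPow_nonneg hδ0 _)
      · have hsub : {x | 0 < |stepFun B h a x| ∧ |stepFun B h a x| ≤ δ}
            ⊆ ⋃ κ ∈ (Finset.univ : Finset J), B κ := by
          rintro x ⟨hx, -⟩
          obtain ⟨-, κ, hκ⟩ := hval x hx
          exact mem_biUnion (Finset.mem_coe.2 (Finset.mem_univ κ)) hκ
        calc _ ≤ (holedLaw c.d N ε).real (⋃ κ ∈ (Finset.univ : Finset J), B κ) :=
              measureReal_mono hsub (measure_ne_top _ _)
          _ ≤ ∑ κ : J, (holedLaw c.d N ε).real (B κ) := measureReal_biUnion_finset_le _ _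
          _ = n * m := by
              rw [Finset.sum_congr rfl fun κ _ => hBmass κ, Finset.sum_const, Finset.card_univ,
                Fintype.card_coe, hJ, nsmul_eq_mul]
          _ ≤ c.D₀ * h ^ α.toReal := hmargin
          _ ≤ c.D₀ * marginPow δ α := by
              rw [marginPow, if_neg hα]
              exact mul_le_mul_of_nonneg_left
                (Real.rpow_le_rpow hh0.le hδh ENNReal.toReal_nonneg) hc.D₀_pos.le
  choose E hE hEl hEg using key
  refine le_iInf fun π => ?_
  obtain ⟨σ, hσ⟩ := exists_regret_ge (holedLaw c.d N ε) hBm hdisj hh0.le hh1 hsmall hBmass E hEl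
    (fun σ κ x hx => by rw [hEg, hfB _ κ x hx]) π
  rw [Fintype.card_coe, hJ] at hσ
  exact hσ.trans (le_iSup₂_of_le (E σ) (hE σ) le_rfl)

/-! ### The rate of the oracle regret -/

/-- Holes which are short enough for the upper density bound `c.cUp > 2 ^ d` and for the Hölder
condition between different bumps. -/
lemma exists_hole_ratio {c : ClassConstants} (hc : c.Good) (hUp : 2 ^ c.d < c.cUp) :
    ∃ ε : ℝ, 0 < ε ∧ ε ≤ 1 / 36 ∧ (2 / ((1 - 9 * ε) * (1 - ε))) ^ c.d ≤ c.cUp ∧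
      2 * (ε / 2) ^ c.β ≤ (1 - 2 * ε) ^ c.β := by
  have hβ := hc.β_pos
  have h1 : ∀ᶠ ε : ℝ in nhds 0, (2 / ((1 - 9 * ε) * (1 - ε))) ^ c.d < c.cUp := by
    have hcont : ContinuousAt (fun ε : ℝ => (2 / ((1 - 9 * ε) * (1 - ε))) ^ c.d) 0 :=
      (ContinuousAt.div (by fun_prop) (by fun_prop) (by norm_num)).pow _
    exact hcont.eventually_lt_const (by simpa using hUp)
  have h2 : ∀ᶠ ε : ℝ in nhds 0, 2 * (ε / 2) ^ c.β - (1 - 2 * ε) ^ c.β < 0 := by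
    have hcont : ContinuousAt (fun ε : ℝ => 2 * (ε / 2) ^ c.β - (1 - 2 * ε) ^ c.β) 0 :=
      (((continuousAt_id.div_const 2).rpow_const (Or.inr hβ.le)).const_mul 2).sub
        (ContinuousAt.rpow_const (by fun_prop) (Or.inr hβ.le))
    refine hcont.eventually_lt_const ?_
    simp [Real.zero_rpow hβ.ne']
  have h3 : ∀ᶠ ε : ℝ in nhds 0, ε < 1 / 36 := eventually_lt_nhds (by norm_num)
  have h4 : ∀ᶠ ε : ℝ in nhdsWithin 0 (Ioi 0), 0 < ε := eventually_mem_nhdsWithin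
  obtain ⟨ε, ⟨⟨a, b⟩, e⟩, f⟩ :=
    (((h1.and h2).and h3).filter_mono nhdsWithin_le_nhds |>.and h4).exists
  exact ⟨ε, f, e.le, a.le, by linarith⟩

/-- A single bump satisfies the margin condition: this is the place of the condition
`2 ^ d ≤ D₀ L ^ (d / β)`. -/
lemma bump_mass_le {c : ClassConstants} (hc : c.Good)
    (hD₀ : 2 ^ c.d ≤ c.D₀ * c.L ^ ((c.d : ℝ) / c.β)) {s h m ρ a : ℝ} (hs : 0 < s)
    (hh : h = 2 * c.L * (s / 2) ^ c.β) (hh1 : h ≤ 1) (hm : m = (ρ * s) ^ c.d) (hρ0 : 0 ≤ ρ)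
    (hρ : ρ ≤ 2) (ha : a ≤ c.d / c.β) : m ≤ c.D₀ * h ^ a := by
  have hβ := hc.β_pos
  have hL := hc.L_pos
  have hh0 : 0 < h := by rw [hh]; positivity
  have h1 : h ^ ((c.d : ℝ) / c.β) = 2 ^ ((c.d : ℝ) / c.β) * c.L ^ ((c.d : ℝ) / c.β) *
      (s / 2) ^ c.d := by
    rw [hh, Real.mul_rpow (by positivity) (by positivity), Real.mul_rpow (by norm_num) hL.le,
      ← Real.rpow_mul (by positivity), mul_div_cancel₀ _ hβ.ne', Real.rpow_natCast]
  have h2 : (2 : ℝ) ^ c.d ≤ 2 ^ ((c.d : ℝ) / c.β) := by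
    rw [← Real.rpow_natCast]
    refine Real.rpow_le_rpow_of_exponent_le (by norm_num) ?_
    rw [le_div_iff₀ hβ]
    exact mul_le_of_le_one_right (Nat.cast_nonneg _) hc.β_le
  calc m ≤ (2 * s) ^ c.d := by rw [hm]; gcongr
    _ = 2 ^ c.d * (2 ^ c.d * (s / 2) ^ c.d) := by rw [← mul_pow, ← mul_pow]; ring_nf
    _ ≤ (c.D₀ * c.L ^ ((c.d : ℝ) / c.β)) * (2 ^ ((c.d : ℝ) / c.β) * (s / 2) ^ c.d) :=
        mul_le_mul hD₀ (mul_le_mul_of_nonneg_right h2 (by positivity)) (by positivity)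
          ((by positivity : (0 : ℝ) ≤ 2 ^ c.d).trans hD₀)
    _ = c.D₀ * h ^ ((c.d : ℝ) / c.β) := by rw [h1]; ring
    _ ≤ c.D₀ * h ^ a :=
        mul_le_mul_of_nonneg_left (Real.rpow_le_rpow_of_exponent_ge hh0 hh1 ha) hc.D₀_pos.le

/-- The largest number of bumps which the cube and the margin condition admit. -/
lemma exists_bump_count {k : ℕ} {m y : ℝ} (hm : 0 < m) (hmy : m ≤ y) :
    ∃ n : ℕ, n ≤ k ∧ n * m ≤ y ∧ min (k * m) (y / 2) ≤ n * m := by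
  have hx1 : 1 ≤ y / m := by rwa [le_div_iff₀ hm, one_mul]
  refine ⟨min k ⌊y / m⌋₊, min_le_left _ _, ?_, ?_⟩
  · have h1 : ((min k ⌊y / m⌋₊ : ℕ) : ℝ) ≤ y / m :=
      (Nat.cast_le.2 (min_le_right _ _)).trans (Nat.floor_le (by linarith))
    rwa [le_div_iff₀ hm] at h1
  · rcases le_total k ⌊y / m⌋₊ with h | h
    · rw [min_eq_left h]; exact min_le_left _ _
    · rw [min_eq_right h]
      refine (min_le_right _ _).trans ?_
      have h2 : (1 : ℝ) ≤ ⌊y / m⌋₊ := by exact_mod_cast (Nat.one_le_floor_iff _).2 hx1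
      have h3 := Nat.lt_floor_add_one (y / m)
      have h4 : y / m / 2 ≤ ⌊y / m⌋₊ := by linarith
      have h5 := mul_le_mul_of_nonneg_right h4 hm.le
      have h6 : y / m / 2 * m = y / 2 := by field_simp
      linarith

/-- A scale at which `T` rounds do not reveal the sign of a bump. -/
lemma exists_scale {c : ClassConstants} (hc : c.Good) :
    ∃ K : ℝ, 1 ≤ K ∧ 8 * c.L ≤ K ^ c.β ∧ 2 ^ c.d * (64 * c.L ^ 2) ≤ K ^ (2 * c.β + c.d) := by
  have h1 := (tendsto_rpow_atTop hc.β_pos).eventually_ge_atTop (8 * c.L)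
  have h2 := (tendsto_rpow_atTop (lt_of_lt_of_le one_pos hc.exponent_pos)).eventually_ge_atTop (2 ^ c.d * (64 * c.L ^ 2))
  obtain ⟨K, ⟨a, b⟩, e⟩ := ((h1.and h2).and (Filter.eventually_ge_atTop 1)).exists
  exact ⟨K, e, a, b⟩

lemma bump_height_le {c : ClassConstants} (hc : c.Good) {K s : ℝ} (hK : 0 < K)
    (hKβ : 8 * c.L ≤ K ^ c.β) (hs : 0 < s) (hsK : s ≤ 1 / K) :
    2 * c.L * (s / 2) ^ c.β ≤ 1 / 4 := by
  have hL := hc.L_pos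
  have h1 : (s / 2) ^ c.β ≤ (1 / K) ^ c.β :=
    Real.rpow_le_rpow (by linarith) (by linarith) hc.β_pos.le
  rw [Real.div_rpow zero_le_one hK.le, Real.one_rpow] at h1
  have hKβ0 : 0 < K ^ c.β := Real.rpow_pos_of_pos hK _
  calc 2 * c.L * (s / 2) ^ c.β ≤ 2 * c.L * (1 / K ^ c.β) :=
        mul_le_mul_of_nonneg_left h1 (by linarith)
    _ = 2 * c.L / K ^ c.β := by ring
    _ ≤ 1 / 4 := by rw [div_le_iff₀ hKβ0]; linarith

/-- The information on the sign of a bump of diameter `s` in `T` rounds. -/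
lemma bump_information_le {c : ClassConstants} (hc : c.Good) {K s m T : ℝ} (hK : 0 < K)
    (hKp : 2 ^ c.d * (64 * c.L ^ 2) ≤ K ^ (2 * c.β + c.d)) (hs : 0 < s)
    (hm : m ≤ 2 ^ c.d * s ^ c.d) (hT : 0 < T)
    (hsK : s ≤ 1 / (K * T ^ (1 / (2 * c.β + c.d)))) :
    T * (m * (2 * c.L * (s / 2) ^ c.β) ^ 2) ≤ 1 / 16 := by
  have hL := hc.L_pos
  have hβ := hc.β_pos
  have hp : 0 < 2 * c.β + c.d := lt_of_lt_of_le one_pos hc.exponent_pos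
  have h2 : (2 * c.L * (s / 2) ^ c.β) ^ 2 ≤ 4 * c.L ^ 2 * s ^ (2 * c.β) := by
    have h3 : (s / 2) ^ c.β ≤ s ^ c.β := Real.rpow_le_rpow (by linarith) (by linarith) hβ.le
    have h4 : 0 ≤ (s / 2) ^ c.β := by positivity
    calc (2 * c.L * (s / 2) ^ c.β) ^ 2 = 4 * c.L ^ 2 * ((s / 2) ^ c.β) ^ 2 := by ring
      _ ≤ 4 * c.L ^ 2 * (s ^ c.β) ^ 2 := by gcongr
      _ = 4 * c.L ^ 2 * s ^ (2 * c.β) := by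
        rw [← Real.rpow_natCast (s ^ c.β), ← Real.rpow_mul hs.le]
        congr 2; push_cast; ring
  have h4 : s ^ (2 * c.β + c.d) ≤ 1 / (K ^ (2 * c.β + c.d) * T) := by
    refine (Real.rpow_le_rpow hs.le hsK hp.le).trans (le_of_eq ?_)
    rw [Real.div_rpow zero_le_one (by positivity), Real.one_rpow,
      Real.mul_rpow hK.le (by positivity), ← Real.rpow_mul hT.le, one_div_mul_cancel hp.ne',
      Real.rpow_one]
  have h5 : s ^ c.d * s ^ (2 * c.β) = s ^ (2 * c.β + c.d) := by
    rw [← Real.rpow_natCast, ← Real.rpow_add hs, add_comm]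
  have hKγ : 0 < K ^ (2 * c.β + c.d) := Real.rpow_pos_of_pos hK _
  calc T * (m * (2 * c.L * (s / 2) ^ c.β) ^ 2)
      ≤ T * (2 ^ c.d * s ^ c.d * (4 * c.L ^ 2 * s ^ (2 * c.β))) :=
        mul_le_mul_of_nonneg_left (mul_le_mul hm h2 (sq_nonneg _) (by positivity)) hT.le
    _ = T * (2 ^ c.d * (4 * c.L ^ 2)) * (s ^ c.d * s ^ (2 * c.β)) := by ring
    _ ≤ T * (2 ^ c.d * (4 * c.L ^ 2)) * (1 / (K ^ (2 * c.β + c.d) * T)) := by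
        rw [h5]; exact mul_le_mul_of_nonneg_left h4 (by positivity)
    _ = 2 ^ c.d * (64 * c.L ^ 2) / K ^ (2 * c.β + c.d) / 16 := by field_simp; ring
    _ ≤ 1 / 16 := by
        have := (div_le_one hKγ).2 hKp
        linarith

lemma bump_height_rpow_ge {c : ClassConstants} (hc : c.Good) {k K ε s T a : ℝ} (hε : 0 < ε)
    (hK : 0 < K) (hk0 : 0 < k) (hk1 : k ≤ 1) (hk : k ≤ 2 * c.L * (ε / (8 * K)) ^ c.β) (hT : 0 < T)
    (hs : ε / (4 * (K * T ^ (1 / (2 * c.β + c.d)))) ≤ s) (ha0 : 0 ≤ a) (ha : a ≤ c.d / c.β) :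
    k ^ (1 + (c.d : ℝ) / c.β) * T ^ (-rateExp c a)
      ≤ 2 * c.L * (s / 2) ^ c.β * (2 * c.L * (s / 2) ^ c.β) ^ a := by
  have hL := hc.L_pos
  have hβ := hc.β_pos
  set γ := 2 * c.β + c.d with hγ
  set w := T ^ (1 / γ) with hw
  have hw0 : 0 < w := by positivity
  have hs0 : 0 < s := lt_of_lt_of_le (by positivity) hs
  have h1 : ε / (8 * K) * w⁻¹ ≤ s / 2 := by
    have h3 : ε / (8 * K) * w⁻¹ = ε / (4 * (K * w)) / 2 := by field_simp; norm_num
    rw [h3]; linarith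
  have h4 : (w⁻¹) ^ c.β = T ^ (-(c.β / γ)) := by
    rw [hw, Real.inv_rpow (by positivity), ← Real.rpow_mul hT.le, ← Real.rpow_neg hT.le]
    congr 1; ring
  set h := 2 * c.L * (s / 2) ^ c.β with hh
  have hh0 : 0 < h := by positivity
  have hhl : k * T ^ (-(c.β / γ)) ≤ h := by
    calc k * T ^ (-(c.β / γ)) ≤ 2 * c.L * (ε / (8 * K)) ^ c.β * T ^ (-(c.β / γ)) :=
          mul_le_mul_of_nonneg_right hk (by positivity)
      _ = 2 * c.L * (ε / (8 * K) * w⁻¹) ^ c.β := by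
          rw [Real.mul_rpow (by positivity) (by positivity), h4]; ring
      _ ≤ h := mul_le_mul_of_nonneg_left (Real.rpow_le_rpow (by positivity) h1 hβ.le) (by linarith)
  calc k ^ (1 + (c.d : ℝ) / c.β) * T ^ (-rateExp c a)
      ≤ k ^ (1 + a) * T ^ (-rateExp c a) := by
        refine mul_le_mul_of_nonneg_right ?_ (by positivity)
        exact Real.rpow_le_rpow_of_exponent_ge hk0 hk1 (by linarith)
    _ = (k * T ^ (-(c.β / γ))) ^ (1 + a) := by
        rw [Real.mul_rpow hk0.le (by positivity), ← Real.rpow_mul hT.le]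
        congr 2; rw [rateExp]; ring
    _ ≤ h ^ (1 + a) := Real.rpow_le_rpow (by positivity) hhl (by linarith)
    _ = h * h ^ a := by rw [Real.rpow_add hh0, Real.rpow_one]

/-- The oracle regret is at least of order `T ^ (1 - rateExp c α)`: there are `≍ h ^ α / s ^ d` bumps
of diameter `s ≍ T ^ (-1 / (2 β + d))` and height `h ≍ s ^ β`. -/
lemma exists_le_oracleRegret {c : ClassConstants} (hc : c.Good) (hlow : c.cLow ≤ 1)
    (hUp : 2 ^ c.d < c.cUp) (hD₀ : 2 ^ c.d ≤ c.D₀ * c.L ^ ((c.d : ℝ) / c.β)) :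
    ∃ c' : ℝ, 0 < c' ∧ ∀ T M : ℕ, 0 < T → (∀ α, ENNReal.ofReal c' ≤ oracleRegret c T M α) ∧
      ∀ α ≤ ENNReal.ofReal (c.d / c.β),
        ENNReal.ofReal (c' * (T : ℝ) ^ (1 - rateExp c α.toReal)) ≤ oracleRegret c T M α := by
  obtain ⟨ε, hε0, hε36, hup, hgap⟩ := exists_hole_ratio hc hUp
  have hε : ε ≤ 1 / 18 := by linarith
  obtain ⟨K, hK1, hKβ, hKp⟩ := exists_scale hc
  have hp : 0 < 2 * c.β + c.d := lt_of_lt_of_le one_pos hc.exponent_pos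
  have hK0 : 0 < K := by linarith
  have hβ := hc.β_pos
  have hL := hc.L_pos
  have hD := hc.D₀_pos
  set γ := 2 * c.β + c.d with hγ
  -- the bumps have total mass at least `q * h ^ α`, and height at least `k * T ^ (-β / γ)`
  set q := min (ε ^ c.d) (c.D₀ / 2) with hq
  have hq0 : 0 < q := lt_min (by positivity) (by positivity)
  set k := min 1 (2 * c.L * (ε / (8 * K)) ^ c.β) with hk
  have hk0 : 0 < k := lt_min one_pos (by positivity)
  have hk1 : k ≤ 1 := min_le_left _ _
  set c' := min (c.δ₀ / 2) (q * k ^ (1 + (c.d : ℝ) / c.β) / 4) with hc'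
  have hδ := hc.δ₀_pos
  refine ⟨c', lt_min (by linarith) (by positivity), fun T M hT => ⟨fun α =>
    (ENNReal.ofReal_le_ofReal (min_le_left _ _)).trans
      (le_oracleRegret_of_first_round hc hlow hε0.le hε hup hT M α), fun α hα => ?_⟩⟩
  have hαtop : α ≠ ∞ := ne_top_of_le_ne_top ENNReal.ofReal_ne_top hα
  have ha0 : 0 ≤ α.toReal := ENNReal.toReal_nonneg
  have ha : α.toReal ≤ c.d / c.β := ENNReal.toReal_le_of_le_ofReal (by positivity) hα
  have hT1 : (1 : ℝ) ≤ T := by exact_mod_cast hT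
  have hT0 : (0 : ℝ) < T := by linarith
  set a := α.toReal with haα
  -- the number of cells per coordinate
  set w := (T : ℝ) ^ (1 / γ) with hw
  have hw1 : 1 ≤ w := Real.one_le_rpow hT1 (by positivity)
  have hKw : 1 ≤ K * w := one_le_mul_of_one_le_of_one_le hK1 hw1
  set N := ⌈K * w⌉₊ with hN
  have hN0 : 0 < N := Nat.ceil_pos.2 (by linarith)
  have hNr : (0 : ℝ) < N := by exact_mod_cast hN0
  have hNl : K * w ≤ N := Nat.le_ceil _
  have hNu : (N : ℝ) ≤ 2 * (K * w) := by
    have := Nat.ceil_lt_add_one (by linarith : 0 ≤ K * w)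
    linarith
  -- the diameter, the height and the mass of a bump
  have hper := period_pos hN0 hε
  set s := ε * period N ε with hs
  have hs0 : 0 < s := by positivity
  have hNs : N * s = ε * (1 - 9 * ε) := by
    rw [hs, ← mul_period (ε := ε) hN0]; ring
  have hsKw : s ≤ 1 / (K * w) := by
    rw [le_div_iff₀ (by linarith)]
    have h1 := mul_le_mul_of_nonneg_left hNl hs0.le
    have h2 : ε * (1 - 9 * ε) ≤ 1 := mul_le_one₀ (by linarith) (by linarith) (by linarith)
    linarith
  set h := 2 * c.L * (s / 2) ^ c.β with hh
  have hh0 : 0 < h := by positivity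
  set V := volume.real (holedSet N ε) with hV
  have hV0 : 0 < V := volume_holedSet_pos hN0 hε0.le hε
  have hVu : V ≤ 1 - 9 * ε := volume_holedSet_le hN0 hε
  have hVl : 1 / 2 ≤ V := by
    refine le_trans ?_ (volume_holedSet_ge hN0 hε0.le hε)
    calc (1 : ℝ) / 2 ≤ 3 / 4 * (35 / 36) := by norm_num
      _ ≤ _ := mul_le_mul (by linarith) (by linarith) (by norm_num) (by linarith)
  set m := (s / V) ^ c.d with hm
  have hm0 : 0 < m := by positivity
  have hmρ : m = (V⁻¹ * s) ^ c.d := by rw [hm, div_eq_inv_mul]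
  have hρ : V⁻¹ ≤ 2 := by rw [inv_le_comm₀ hV0 two_pos]; linarith
  have hh4 : h ≤ 1 / 4 := bump_height_le hc hK0 hKβ hs0
    (hsKw.trans (one_div_le_one_div_of_le hK0 (le_mul_of_one_le_right hK0.le hw1)))
  have hinfo : T * (m * h ^ 2) ≤ 1 / 16 := by
    refine bump_information_le hc hK0 hKp hs0 ?_ hT0 hsKw
    rw [hmρ, ← mul_pow]
    exact pow_le_pow_left₀ (by positivity) (mul_le_mul_of_nonneg_right hρ hs0.le) _
  have hsmall : h ^ 2 + T * (m * h ^ 2) ≤ 1 / 8 := by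
    have h1 := pow_le_pow_left₀ hh0.le hh4 2
    norm_num at h1
    linarith
  -- the number of bumps
  have hha0 : 0 < h ^ a := Real.rpow_pos_of_pos hh0 a
  have hha1 : h ^ a ≤ 1 := Real.rpow_le_one hh0.le (by linarith) ha0
  obtain ⟨n, hn, hnm, hnl⟩ := exists_bump_count (k := N ^ c.d) hm0
    (bump_mass_le hc hD₀ hs0 hh (by linarith) hmρ (inv_nonneg.2 hV0.le) hρ ha)
  refine le_trans (ENNReal.ofReal_le_ofReal ?_) (le_oracleRegret_of_bumps hc hlow hN0 hε0 hε hup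
    hgap hαtop T M hn hh hm (by linarith) hsmall hnm)
  have hqn : q * h ^ a ≤ n * m := by
    refine le_trans (le_min ?_ ?_) hnl
    · have h1 : ε ^ c.d ≤ ((N ^ c.d : ℕ) : ℝ) * m := by
        rw [hm, Nat.cast_pow, ← mul_pow]
        refine pow_le_pow_left₀ hε0.le ?_ _
        rw [← mul_div_assoc, hNs, le_div_iff₀ hV0]
        exact mul_le_mul_of_nonneg_left hVu hε0.le
      calc q * h ^ a ≤ q * 1 := by gcongr
        _ ≤ ε ^ c.d := by rw [mul_one]; exact min_le_left _ _
        _ ≤ _ := h1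
    · calc q * h ^ a ≤ c.D₀ / 2 * h ^ a := mul_le_mul_of_nonneg_right (min_le_right _ _) hha0.le
        _ = c.D₀ * h ^ a / 2 := by ring
  have hpow : k ^ (1 + (c.d : ℝ) / c.β) * (T : ℝ) ^ (-rateExp c a) ≤ h * h ^ a :=
    bump_height_rpow_ge hc hε0 hK0 hk0 hk1 (min_le_right _ _) hT0
      (by
        have h1 := mul_le_mul_of_nonneg_left hNu hs0.le
        have h2 : ε * (1 / 2) ≤ ε * (1 - 9 * ε) :=
          mul_le_mul_of_nonneg_left (by linarith) hε0.le
        rw [← hγ, ← hw, div_le_iff₀ (by linarith)]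
        linarith) ha0 ha
  calc c' * (T : ℝ) ^ (1 - rateExp c a)
      ≤ q * k ^ (1 + (c.d : ℝ) / c.β) / 4 * (T : ℝ) ^ (1 - rateExp c a) :=
        mul_le_mul_of_nonneg_right (min_le_right _ _) (by positivity)
    _ = T * q * (k ^ (1 + (c.d : ℝ) / c.β) * (T : ℝ) ^ (-rateExp c a)) / 4 := by
        rw [sub_eq_add_neg, Real.rpow_add hT0, Real.rpow_one]; ring
    _ ≤ T * q * (h * h ^ a) / 4 := by gcongr
    _ = T * h * (q * h ^ a) / 4 := by ring
    _ ≤ T * h * (n * m) / 4 := by gcongr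
    _ = T * n * (h * m) / 4 := by ring

/-! ### Regret inflation -/

/-- A lower density bound at scale `1` with a constant above `1` is impossible. -/
lemma cLow_le_one_of_mem {c : ClassConstants} {α : ℝ≥0∞} {E : Environment c.d}
    (hE : E ∈ envClass c α) : c.cLow ≤ 1 := by
  obtain ⟨x, hx⟩ := Measure.nonempty_support (μ := E.ctxLaw) (IsProbabilityMeasure.ne_zero _)
  have h := (hE.1 x hx 1 one_pos le_rfl).1
  rw [one_pow, mul_one] at h
  exact h.trans measureReal_le_one

lemma nonempty_batchPolicy {d T M : ℕ} (hM : 0 < M) (hMT : M ≤ T) :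
    Nonempty (BatchPolicy d T M) := by
  obtain ⟨π, -⟩ := exists_policy_of_rule (d := d) (T := T) (M := M)
    (fun i => if i < M then i else T) (if_pos hM) (fun i hi => by
      by_cases h : i + 1 < M
      · simp only [if_pos hi, if_pos h]; omega
      · simp only [if_pos hi, if_neg h]; omega) (if_neg (lt_irrefl _)) (fun _ _ => true)
    fun _ => measurable_const
  exact ⟨π⟩

lemma regret_le_horizon {d T M : ℕ} (π : BatchPolicy d T M) (E : Environment d) :
    regret π E ≤ T := by
  have hae : ∀ᵐ ω ∂(Measure.pi fun _ : Fin T => E.law), ∀ t : Fin T, ∀ k,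
      E.f k (ω t).1 ∈ Icc (0 : ℝ) 1 := by
    rw [ae_all_iff]
    exact fun t => (measurePreserving_eval (fun _ : Fin T => E.law) t
      ).quasiMeasurePreserving.ae E.f_mem
  calc regret π E ≤ ∫⁻ _ω, (T : ℝ≥0∞) ∂(Measure.pi fun _ : Fin T => E.law) := by
        refine lintegral_mono_ae ?_
        filter_upwards [hae] with ω hω
        refine (Finset.sum_le_card_nsmul _ _ 1 fun t _ => ?_).trans (by simp)
        rw [← ENNReal.ofReal_one]
        refine ENNReal.ofReal_le_ofReal ?_
        have h1 := (hω t (π.arm t ω)).1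
        have h2 := max_le (hω t true).2 (hω t false).2
        linarith
    _ = T := by simp

lemma regretInflation_le {c : ClassConstants} {T M : ℕ} (π : BatchPolicy c.d T M) {K : ℝ≥0∞}
    (h : ∀ α ∈ marginParams c, ∀ E ∈ envClass c α, regret π E ≤ K * oracleRegret c T M α) :
    regretInflation c π ≤ K :=
  iSup₂_le fun α hα => iSup₂_le fun E hE => ENNReal.div_le_of_le_mul (h α hα E hE)

lemma loglog_three_pos : 0 < Real.log (Real.log 3) := by
  refine Real.log_pos ?_
  rw [Real.lt_log_iff_exp_lt (by norm_num)]
  exact Real.exp_one_lt_three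

/-- Long horizons: the quotient of the upper and the lower bound. -/
lemma regretInflation_le_of_large {c : ClassConstants} {T M : ℕ} {C c' : ℝ}
    (hC : 0 < C) (hc' : 0 < c') (hT : 1 ≤ Real.log (Real.log T)) (hT1 : 1 ≤ Real.log T)
    {π : BatchPolicy c.d T M}
    (htop : ∀ E ∈ envClass c ∞, regret π E ≤ ENNReal.ofReal (C * Real.log T))
    (hpow : ∀ α : ℝ≥0∞, α ≤ ENNReal.ofReal (c.d / c.β) → ∀ E ∈ envClass c α,
      regret π E ≤ ENNReal.ofReal (C * Real.log (Real.log T) * Real.log T *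
        (T : ℝ) ^ (1 - rateExp c α.toReal)))
    (hotop : ENNReal.ofReal c' ≤ oracleRegret c T M ∞)
    (hopow : ∀ α ≤ ENNReal.ofReal (c.d / c.β),
      ENNReal.ofReal (c' * (T : ℝ) ^ (1 - rateExp c α.toReal)) ≤ oracleRegret c T M α) :
    regretInflation c π
      ≤ ENNReal.ofReal (C / c' * Real.log (Real.log T) ^ 5 * Real.log T) := by
  set l := Real.log (Real.log T) with hl
  set g := Real.log (T : ℝ) with hg
  refine regretInflation_le π fun α hα E hE => ?_
  rcases hα with hα | rfl
  · refine (hpow α hα E hE).trans (le_trans ?_ (mul_le_mul_right (hopow α hα) _))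
    set r := (T : ℝ) ^ (1 - rateExp c α.toReal) with hr
    have hr0 : 0 ≤ r := by positivity
    rw [← ENNReal.ofReal_mul (by positivity)]
    refine ENNReal.ofReal_le_ofReal ?_
    have h5 : l ≤ l ^ 5 := le_self_pow₀ hT (by norm_num)
    calc C * l * g * r ≤ C * l ^ 5 * g * r := by gcongr
      _ = C / c' * l ^ 5 * g * (c' * r) := by field_simp
  · refine (htop E hE).trans (le_trans ?_ (mul_le_mul_right hotop _))
    rw [← ENNReal.ofReal_mul (by positivity)]
    refine ENNReal.ofReal_le_ofReal ?_
    have h5 : 1 ≤ l ^ 5 := one_le_pow₀ hT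
    calc C * g = C * 1 * g := by ring
      _ ≤ C * l ^ 5 * g := by gcongr
      _ = C / c' * l ^ 5 * g * c' := by field_simp

/-- Bounded horizons: every policy has bounded regret inflation. -/
lemma regretInflation_le_of_bounded {c : ClassConstants} {T M : ℕ} {T₀ c' : ℝ} (hc' : 0 < c')
    (hT3 : 3 ≤ T) (hT₀ : (T : ℝ) ≤ T₀) (ho : ∀ α, ENNReal.ofReal c' ≤ oracleRegret c T M α)
    (π : BatchPolicy c.d T M) :
    regretInflation c π ≤ ENNReal.ofReal
      (T₀ / c' / (Real.log (Real.log 3) ^ 5 * Real.log 3) * Real.log (Real.log T) ^ 5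
        * Real.log T) := by
  have hl3 := loglog_three_pos
  have hlog3 : 0 < Real.log 3 := Real.log_pos (by norm_num)
  have hT3' : (3 : ℝ) ≤ T := by exact_mod_cast hT3
  have h1 : Real.log 3 ≤ Real.log T := Real.log_le_log (by norm_num) hT3'
  have h2 : Real.log (Real.log 3) ≤ Real.log (Real.log T) := Real.log_le_log hlog3 h1
  have hT₀0 : 0 ≤ T₀ := by linarith
  set D := Real.log (Real.log 3) ^ 5 * Real.log 3 with hD
  have hD0 : 0 < D := by positivity
  refine regretInflation_le π fun α _ E _ => ?_
  refine (regret_le_horizon π E).trans (le_trans ?_ (mul_le_mul_right (ho α) _))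
  have h0 : 0 ≤ Real.log (Real.log T) := hl3.le.trans h2
  have h0' : 0 ≤ Real.log T := hlog3.le.trans h1
  rw [← ENNReal.ofReal_mul (by positivity), ← ENNReal.ofReal_natCast]
  refine ENNReal.ofReal_le_ofReal ?_
  have h3 : D ≤ Real.log (Real.log T) ^ 5 * Real.log T := by rw [hD]; gcongr
  calc (T : ℝ) ≤ T₀ := hT₀
    _ = T₀ / c' / D * D * c' := by field_simp
    _ ≤ T₀ / c' / D * (Real.log (Real.log T) ^ 5 * Real.log T) * c' := by gcongr
    _ = _ := by ring

lemma exists_large_horizon (B : ℝ) : ∃ T₀ : ℝ, 0 < T₀ ∧ ∀ T : ℝ, T₀ ≤ T →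
    1 ≤ Real.log (Real.log T) ∧ 1 ≤ Real.log T ∧ B * Real.log T ≤ T := by
  have h1 := (Real.tendsto_log_atTop.comp Real.tendsto_log_atTop).eventually_ge_atTop 1
  have h2 := Real.tendsto_log_atTop.eventually_ge_atTop 1
  have h3 : ∀ᶠ T : ℝ in Filter.atTop, B * Real.log T ≤ T := by
    have h4 := ((Real.isLittleO_log_id_atTop).const_mul_left B).bound (one_pos (α := ℝ))
    filter_upwards [h4, Filter.eventually_ge_atTop 0] with T hT hT0
    rw [one_mul, Real.norm_eq_abs, Real.norm_eq_abs, id, abs_of_nonneg hT0] at hT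
    exact (le_abs_self _).trans hT
  obtain ⟨T₀, hT₀⟩ := Filter.eventually_atTop.1 ((h1.and h2).and h3)
  refine ⟨max T₀ 1, lt_max_of_lt_right one_pos, fun T hT => ?_⟩
  obtain ⟨⟨a, b⟩, e⟩ := hT₀ T ((le_max_left _ _).trans hT)
  exact ⟨a, b, e⟩

end BatchedBandit

theorem mainTheorem5 (c : BatchedBandit.ClassConstants)
    (hd : 1 ≤ c.d) (hβ : 0 < c.β) (hβ1 : c.β ≤ 1) (hL : 0 < c.L)
    (hcLow : 0 < c.cLow) (hcUp : 2 ^ c.d < c.cUp)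
    (hδ₀ : 0 < c.δ₀) (hδ₀1 : c.δ₀ < 1)
    (hD₀ : 2 ^ c.d ≤ c.D₀ * c.L ^ ((c.d : ℝ) / c.β)) :
    ∃ c₁ C : ℝ, 0 < c₁ ∧ 0 < C ∧
      ∀ T M : ℕ, 3 ≤ T → M ≤ T → c₁ * Real.log (Real.log T) ≤ M →
        ⨅ π : BatchedBandit.BatchPolicy c.d T M, BatchedBandit.regretInflation c π
          ≤ ENNReal.ofReal (C * Real.log (Real.log T) ^ 5 * Real.log T) := by
  have hc : c.Good := ⟨hd, hβ, hβ1, hL, hcLow, lt_trans (by positivity) hcUp, hδ₀, hδ₀1,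
    pos_of_mul_pos_left (lt_of_lt_of_le (by positivity) hD₀) (by positivity)⟩
  obtain ⟨c₁, C, B, hc₁, hC, -, hpol⟩ := BatchedBandit.exists_adaptive_policy hc
  -- `M` is positive, since `3 ≤ T`
  have hMpos : ∀ T M : ℕ, 3 ≤ T → c₁ * Real.log (Real.log T) ≤ M → 0 < M := by
    intro T M hT hM
    have hT' : (3 : ℝ) ≤ T := by exact_mod_cast hT
    have h1 : Real.log (Real.log 3) ≤ Real.log (Real.log T) :=
      Real.log_le_log (Real.log_pos (by norm_num)) (Real.log_le_log (by norm_num) hT')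
    have h2 := mul_pos hc₁ (BatchedBandit.loglog_three_pos.trans_le h1)
    exact_mod_cast h2.trans_le hM
  by_cases hlow : c.cLow ≤ 1
  · obtain ⟨c', hc', horacle⟩ := BatchedBandit.exists_le_oracleRegret hc hlow hcUp hD₀
    obtain ⟨T₀, hT₀0, hT₀⟩ := BatchedBandit.exists_large_horizon B
    set D := Real.log (Real.log 3) ^ 5 * Real.log 3 with hD
    have hD0 : 0 < D :=
      mul_pos (pow_pos BatchedBandit.loglog_three_pos 5) (Real.log_pos (by norm_num))
    refine ⟨c₁, max (C / c') (T₀ / c' / D), hc₁, lt_max_of_lt_left (by positivity),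
      fun T M hT3 hMT hM => ?_⟩
    obtain ⟨ho1, ho2⟩ := horacle T M (by omega)
    have hT3' : (3 : ℝ) ≤ T := by exact_mod_cast hT3
    have hl : 0 ≤ Real.log T := Real.log_nonneg (by linarith)
    have hll : 0 ≤ Real.log (Real.log T) := BatchedBandit.loglog_three_pos.le.trans
      (Real.log_le_log (Real.log_pos (by norm_num)) (Real.log_le_log (by norm_num) hT3'))
    have hmono : ∀ K ≤ max (C / c') (T₀ / c' / D),
        ENNReal.ofReal (K * Real.log (Real.log T) ^ 5 * Real.log T) ≤ ENNReal.ofReal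
          (max (C / c') (T₀ / c' / D) * Real.log (Real.log T) ^ 5 * Real.log T) :=
      fun K hK => ENNReal.ofReal_le_ofReal (by gcongr)
    rcases le_total T₀ T with hT | hT
    · obtain ⟨h1, h2, h3⟩ := hT₀ T hT
      obtain ⟨π, hπtop, hπpow⟩ := hpol T M h1 h3 hMT hM
      exact (iInf_le _ π).trans ((BatchedBandit.regretInflation_le_of_large hC hc' h1 h2
        hπtop hπpow (ho1 _) ho2).trans (hmono _ (le_max_left _ _)))
    · obtain ⟨π⟩ := BatchedBandit.nonempty_batchPolicy (d := c.d) (hMpos T M hT3 hM) hMT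
      exact (iInf_le _ π).trans ((BatchedBandit.regretInflation_le_of_bounded hc' hT3 hT ho1 π).trans
        (hmono _ (le_max_right _ _)))
  · -- the classes are empty
    refine ⟨c₁, 1, hc₁, one_pos, fun T M hT3 hMT hM => ?_⟩
    obtain ⟨π⟩ := BatchedBandit.nonempty_batchPolicy (d := c.d) (hMpos T M hT3 hM) hMT
    refine (iInf_le _ π).trans ((BatchedBandit.regretInflation_le π (K := 0) fun α _ E hE => ?_).trans
      zero_le)
    exact absurd (BatchedBandit.cLow_le_one_of_mem hE) hlow
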